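/- **Setting.** Let $K$ be a field and $\Lambda=KQ/I$ a gentle algebra: $Q$ is a quiver with finitely many vertices, $I$ is an admissible ideal generated by paths of length two, at most two arrows start and at most two arrows end at each vertex, and for each arrow $a$ there is at most one arrow $b$ with $ba$ a path not in $I$, at most one $b$ with $ba$ a path in $I$, at most one $c$ with $ac$ a path not in $I$, and at most one $c$ with $ac$ a path in $I$. Paths are read from right to left, $s$ and $e$ denote start and end, modules are left modules, $P(x)=\Lambda e_x$. A *path in $(Q,I)$* is a path not in $I$. *Homotopy strings and bands.* A homotopy letter is a path $p$ of positive length in $(Q,I)$ (direct) or a formal inverse $\bar p$ of one (inverse). A homotopy string $\sigma=\cdots\sigma_{2}\sigma_1$ (finite, or infinite on one or both sides, where infinite to the left requires that the letters are eventually single arrows, and infinite to the right that they are eventually single inverse arrows) is a reduced walk decomposed into homotopy letters, consecutive homotopy letters of the same direction being separated by a relation; for each vertex $x$ there is also the trivial homotopy string $1_x$. A homotopy band is a cyclic sequence $\sigma=\sigma_n\cdots\sigma_1$ of homotopy letters, satisfying these conditions cyclically, that is not a proper power and has equally many direct and inverse homotopy letters. We write $\sigma_i=\emptyset$ if there is no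 such letter; for bands indices are cyclic. The complex $Q^\bullet_\sigma$ has one summand $P(x)$ for each vertex $x$ passed by $\sigma$ (in a compatible choice of degrees $\deg$); a direct letter $p$ gives the component $P(e(p))\to P(s(p))$, $u\mapsto up$, of the differential, and $\bar p$ gives that same component. For a homotopy band a scalar $\lambda\in K^*$ is placed on one chosen direct letter $\sigma_r$, that is, its component is multiplied by $\lambda$. *String and band modules.* A string $w=w_l\cdots w_1$ is a reduced walk in arrows and inverse arrows (possibly trivial, $1_x$) with no subwalk $v$ such that $v\in I$ or $\bar v\in I$; a band is a closed walk of positive length all of whose powers are strings, and which is not a proper power. The string module $M(w)$ has a basis $z_0,\dots,z_l$ at the successive vertices of $w$; a letter $w_k=a$ gives $az_{k-1}=z_k$, a letter $w_k=\bar a$ gives $az_k=z_{k-1}$, and arrows act by zero otherwise. The band module $B(w,\mu)$, $\mu\in K^*$, is defined in the same way with the indices of $z$ taken modulo $l$ and with $\mu$ placed on the first letter $w_1$, an arrow. *Rules.* An alternating homotopy substring is $\sigma_j\cdots\sigma_i$, $i<j$, in which direct and inverse letters alternate; it is maximal if neither $\sigma_i\sigma_{i-1}$ nor $\sigma_{j+1}\sigma_j$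 alternates (in particular if these neighbours are $\emptyset$). Below, $w^{-}$ and ${}^{-}w$ denote the walk $w$ with its first letter (right end), respectively its last letter (left end), removed. For a path $p=a_k\cdots a_1$ starting at $x$, let $q(p)$ be the maximal path in $(Q,I)$ that starts at $x$ with an arrow other than $a_1$ (the trivial path if there is none). 1. *Maximal alternating substring rule.* If $\tau=\sigma_j\cdots\sigma_i$ is a maximal alternating homotopy substring, it contributes $M({}^{-}\tau^{-})$ in degree $d=\max\{\deg P(s(\sigma_i)),\deg P(e(\sigma_i))\}$, unless the combined rule or its dual applies to $\tau$. 2. *Cokernel rule.* If $\sigma=\cdots\sigma_2\sigma_1$ starts with a direct letter $\sigma_1$, and $\sigma_2$ is direct or $\emptyset$, then $M({}^{-}\sigma_1\,\overline{q(\sigma_1)})$ is contributed in degree $\deg P(s(\sigma_1))$. 3. *Combined rule.* If $\sigma_1$ is direct and $\tau=\sigma_j\cdots\sigma_1$ is maximal alternating, then $M({}^{-}\tau\,\overline{q(\sigma_1)})$ is contributed in degree $\deg P(s(\sigma_1))$. If moreover $\tau=\sigma=\sigma_n\cdots\sigma_1$ with $\sigma_n=\bar p$ inverse, the contribution is instead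 $M(q(p)\,\sigma\,\overline{q(\sigma_1)})$. 4. *Kernel rule.* If $\sigma=\sigma_n\sigma_{n-1}\cdots$ ends with a direct letter $\sigma_n=b_l\cdots b_1$ and there is an arrow $c$ with $cb_l\in I$ a path, let $c_m\cdots c_1$ be the maximal path in $(Q,I)$ with $c_1=c$; then $M(c_m\cdots c_2)$ is contributed in degree $\deg P(e(\sigma_n))$ (the simple module at $e(c)$ if $m=1$). 5. *Nontrivial homotopy letter rule.* If $\sigma_i=a_k\cdots a_1$ is direct with $k\ge 2$, $\sigma_{i-1}$ is direct, and $\sigma_{i+1}$ is direct or $\emptyset$, then $M(a_{k-1}\cdots a_2)$ is contributed in degree $\deg P(s(\sigma_i))$ (for $k=2$ the simple module at $e(a_1)$). Rules 2–5 include their duals, obtained by applying them to the inverse $\bar\sigma$. **Theorem.** Every word occurring in these rules is a string, respectively a band in (c), and: (a) If $\sigma$ is a homotopy string with at least one homotopy letter, or a homotopy band that is not cyclically alternating (with any $\lambda\in K^*$), then for every $d\in\mathbb Z$ the cohomology $H^d(Q^\bullet_\sigma)$ is isomorphic, as a $\Lambda$-module, to the direct sum of the string modules contributed in degree $d$, one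 for each application of a rule to $\sigma$. (b) If $\sigma=1_x$ is trivial, with $P(x)$ in degree $d$, then $H^d(Q^\bullet_\sigma)\cong M(q'\bar q)$, where $q,q'$ are the two maximal paths in $(Q,I)$ starting at $x$ with different first arrows (trivial where such an arrow is missing), and all other cohomology vanishes. (c) If $\sigma=\sigma_n\cdots\sigma_1$ is a homotopy band whose letters alternate cyclically, with $\lambda$ placed on the direct letter $\sigma_r$, and $d=\deg P(s(\sigma_r))$, then $H^d(Q^\bullet_\sigma)\cong B(w,(-1)^{n/2}\lambda^{-1})$, where $w=\sigma_{r-1}\cdots\sigma_1\sigma_n\cdots\sigma_r$ is the walk of $\sigma$ read from $\sigma_r$ on, and all other cohomology vanishes. -/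

import Mathlib

open CategoryTheory
open scoped DirectSum

namespace GentleCohomology

noncomputable section

universe u v w

/-! ## Gentle quivers with relations -/

/-- Arrows of a quiver `Q`: `a.left` is the source `s(a)`, `a.right` is the end `e(a)`. -/
abbrev Arrow (V : Type v) [Quiver.{w} V] := Quiver.Total V

/-- A gentle bound quiver `(Q, I)`. The ideal `I` is generated by the length two paths `b a`
(first `a`, then `b`) with `rel b a`; so a path lies in `I` iff two consecutive arrows of it are
related. With finitely many vertices, `bounded` says that `I` is admissible. -/
structure GentleQuiver (V : Type v) [Quiver.{w} V] where
  rel : Arrow V → Arrow V → Prop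
  rel_comp : ∀ {b a}, rel b a → a.right = b.left
  card_out : ∀ x : V, {a : Arrow V | a.left = x}.encard ≤ 2
  card_in : ∀ x : V, {a : Arrow V | a.right = x}.encard ≤ 2
  nonrel_after : ∀ a : Arrow V, {b : Arrow V | a.right = b.left ∧ ¬ rel b a}.Subsingleton
  nonrel_before : ∀ a : Arrow V, {c : Arrow V | c.right = a.left ∧ ¬ rel a c}.Subsingleton
  rel_after : ∀ a : Arrow V, {b : Arrow V | rel b a}.Subsingleton
  rel_before : ∀ a : Arrow V, {c : Arrow V | rel a c}.Subsingleton
  bounded : ∃ m : ℕ, ∀ p : List (Arrow V),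
    p.IsChain (fun a b => a.right = b.left ∧ ¬ rel b a) → p.length ≤ m

variable {V : Type v} [Quiver.{w} V]

/-- The path `a_k ⋯ a_1` is stored as the list `[a_1, …, a_k]`, in order of travel. `G.IsPath x y p`
says that `p` is a path of positive length from `x` to `y` in `(Q, I)`, i.e. not in `I`. -/
structure GentleQuiver.IsPath (G : GentleQuiver V) (x y : V) (p : List (Arrow V)) : Prop where
  source : p.head?.map Quiver.Total.left = some x
  target : p.getLast?.map Quiver.Total.right = some y
  chain : p.IsChain (fun a b => a.right = b.left ∧ ¬ G.rel b a)

/-- `p` is a path of positive length in `(Q, I)` starting with the arrow `c`, and it is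
maximal: `d p` is zero for each arrow `d`. -/
structure GentleQuiver.IsMaximalPath (G : GentleQuiver V) (c : Arrow V)
    (p : List (Arrow V)) : Prop where
  head : p.head? = some c
  chain : p.IsChain (fun a b => a.right = b.left ∧ ¬ G.rel b a)
  maximal : ∀ a, p.getLast? = some a → ∀ d : Arrow V, a.right = d.left → G.rel d a

/-! ## The algebra `Λ = KQ/I` -/

section Algebra

variable (K : Type u) [Field K] [Fintype V] (G : GentleQuiver V)

/-- The defining relations of `KQ/I` as a quotient of the free algebra on vertices and arrows. -/
inductive BoundRel : FreeAlgebra K (V ⊕ Arrow V) → FreeAlgebra K (V ⊕ Arrow V) → Prop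
  | idem (x : V) : BoundRel
      (FreeAlgebra.ι K (Sum.inl x) * FreeAlgebra.ι K (Sum.inl x)) (FreeAlgebra.ι K (Sum.inl x))
  | orth (x y : V) (h : x ≠ y) : BoundRel
      (FreeAlgebra.ι K (Sum.inl x) * FreeAlgebra.ι K (Sum.inl y)) 0
  | unit : BoundRel (∑ x : V, FreeAlgebra.ι K (Sum.inl x)) 1
  | target (a : Arrow V) : BoundRel
      (FreeAlgebra.ι K (Sum.inl a.right) * FreeAlgebra.ι K (Sum.inr a)) (FreeAlgebra.ι K (Sum.inr a))
  | source (a : Arrow V) : BoundRel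
      (FreeAlgebra.ι K (Sum.inr a) * FreeAlgebra.ι K (Sum.inl a.left)) (FreeAlgebra.ι K (Sum.inr a))
  | rel (b a : Arrow V) (h : G.rel b a) : BoundRel
      (FreeAlgebra.ι K (Sum.inr b) * FreeAlgebra.ι K (Sum.inr a)) 0

/-- The gentle algebra `Λ = KQ/I`. Paths are composed from right to left. -/
def GentleAlgebra : Type (max u v w) := RingQuot (BoundRel K G)

instance : Ring (GentleAlgebra K G) := inferInstanceAs (Ring (RingQuot (BoundRel K G)))

instance : Algebra K (GentleAlgebra K G) := inferInstanceAs (Algebra K (RingQuot (BoundRel K G)))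

/-- The projection of the free algebra onto `Λ`. -/
def toGentleAlgebra : FreeAlgebra K (V ⊕ Arrow V) →ₐ[K] GentleAlgebra K G :=
  RingQuot.mkAlgHom K (BoundRel K G)

variable {K G} in
theorem toGentleAlgebra_rel {x y : FreeAlgebra K (V ⊕ Arrow V)} (h : BoundRel K G x y) :
    toGentleAlgebra K G x = toGentleAlgebra K G y := RingQuot.mkAlgHom_rel K h

/-- The idempotent `e_x` of `Λ` at the vertex `x`. -/
def vertexElt (x : V) : GentleAlgebra K G :=
  toGentleAlgebra K G (FreeAlgebra.ι K (Sum.inl x))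

/-- The element of `Λ` given by an arrow. -/
def arrowElt (a : Arrow V) : GentleAlgebra K G :=
  toGentleAlgebra K G (FreeAlgebra.ι K (Sum.inr a))

/-- The element `a_k ⋯ a_1` of `Λ` given by the path `[a_1, …, a_k]`. -/
def pathElt : List (Arrow V) → GentleAlgebra K G
  | [] => 1
  | a :: p => pathElt p * arrowElt K G a

/-- The indecomposable projective left module `P(x) = Λ e_x`. -/
def P (x : V) : Submodule (GentleAlgebra K G) (GentleAlgebra K G) :=
  Submodule.span _ {vertexElt K G x}

/-- Right multiplication `P(x) → P(y)`, `u ↦ u r e_y`. If `r` is a path from `y` to `x` this is the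
map `u ↦ u r`. -/
def rightMul (x y : V) (r : GentleAlgebra K G) : P K G x →ₗ[GentleAlgebra K G] P K G y :=
  LinearMap.codRestrict (P K G y)
    ((LinearMap.toSpanSingleton (GentleAlgebra K G) (GentleAlgebra K G)
      (r * vertexElt K G y)).comp (P K G x).subtype)
    (fun u => by
      have h := Submodule.smul_mem (P K G y) ((u : GentleAlgebra K G) * r)
        (Submodule.mem_span_singleton_self (vertexElt K G y))
      simpa [mul_assoc] using h)

variable {K G}

theorem rightMul_coe (x y : V) (r : GentleAlgebra K G) (u : P K G x) :
    (rightMul K G x y r u : GentleAlgebra K G) = u * (r * vertexElt K G y) := rfl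

theorem rightMul_zero (x y : V) : rightMul K G x y 0 = 0 := by
  ext u; simp [rightMul_coe]

theorem arrowElt_mul_source (a : Arrow V) :
    arrowElt K G a * vertexElt K G a.left = arrowElt K G a := by
  have := toGentleAlgebra_rel (BoundRel.source (K := K) (G := G) a)
  simpa [arrowElt, vertexElt] using this

theorem arrowElt_mul_arrowElt {b a : Arrow V} (h : G.rel b a) :
    arrowElt K G b * arrowElt K G a = 0 := by
  have := toGentleAlgebra_rel (BoundRel.rel (K := K) b a h)
  simpa [arrowElt] using this

theorem pathElt_mul_vertexElt {x y : V} {p : List (Arrow V)} (h : G.IsPath x y p) :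
    pathElt K G p * vertexElt K G x = pathElt K G p := by
  cases p with
  | nil => simpa using h.source
  | cons a p =>
    obtain rfl : a.left = x := by simpa using h.source
    rw [pathElt, mul_assoc, arrowElt_mul_source]

theorem pathElt_append (p q : List (Arrow V)) :
    pathElt K G (p ++ q) = pathElt K G q * pathElt K G p := by
  induction p with
  | nil => simp [pathElt]
  | cons a p ih => rw [List.cons_append, pathElt, pathElt, ih, mul_assoc]

theorem pathElt_mul_pathElt {p q : List (Arrow V)} {a b : Arrow V} (ha : p.getLast? = some a)
    (hb : q.head? = some b) (h : G.rel b a) : pathElt K G q * pathElt K G p = 0 := by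
  obtain ⟨p, rfl⟩ := List.getLast?_eq_some_iff.mp ha
  obtain ⟨q, rfl⟩ := List.head?_eq_some_iff.mp hb
  rw [pathElt_append, pathElt, pathElt, pathElt, one_mul, mul_assoc,
    ← mul_assoc (arrowElt K G b), arrowElt_mul_arrowElt h, zero_mul, mul_zero]

end Algebra

/-! ## Homotopy strings and bands -/

/-- A homotopy letter: `direct p` is the path `p`, `inverse p` is the formal inverse of `p`. -/
inductive HLetter (V : Type v) [Quiver.{w} V] where
  | direct (p : List (Arrow V))
  | inverse (p : List (Arrow V))

/-- The homotopy letter `M` may follow the homotopy letter `L` (as in `M L`) in the decomposition of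
a walk into homotopy letters: with equal directions they are separated by a relation, with opposite
directions the walk is reduced where they meet. -/
def GentleQuiver.MayFollow (G : GentleQuiver V) : HLetter V → HLetter V → Prop
  | .direct q, .direct p => ∃ a b, p.getLast? = some a ∧ q.head? = some b ∧ G.rel b a
  | .inverse q, .inverse p => ∃ a b, q.getLast? = some a ∧ p.head? = some b ∧ G.rel b a
  | .inverse q, .direct p => p.getLast? ≠ q.getLast?
  | .direct q, .inverse p => p.head? ≠ q.head?

/-- A sequence of homotopy letters with a grading. The index type `ι` is `ℤ` for homotopy strings
and `ZMod n` for homotopy bands; `pos` is the set of places where a vertex sits. The homotopy letter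
`letter i` joins place `i` (its start) to place `i + 1` (its end), and is `none` (the symbol `∅`) if
one of these places is absent. `deg i` is the cohomological degree of `P(vertex i)`: a direct
letter is a map from the projective at its end to the one at its start, an inverse letter
is a map from the projective at its start to the one at its end. -/
structure HSequence (G : GentleQuiver V) (ι : Type) [CommRing ι] where
  pos : Set ι
  vertex : ι → V
  letter : ι → Option (HLetter V)
  deg : ι → ℤ
  letter_isSome : ∀ i, (letter i).isSome ↔ i ∈ pos ∧ i + 1 ∈ pos
  direct_path : ∀ i p, letter i = some (.direct p) → G.IsPath (vertex i) (vertex (i + 1)) p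
  inverse_path : ∀ i p, letter i = some (.inverse p) → G.IsPath (vertex (i + 1)) (vertex i) p
  direct_deg : ∀ i p, letter i = some (.direct p) → deg i = deg (i + 1) + 1
  inverse_deg : ∀ i p, letter i = some (.inverse p) → deg (i + 1) = deg i + 1
  mayFollow : ∀ i L M, letter i = some L → letter (i + 1) = some M → G.MayFollow M L

/-- A (finite, one-sided infinite or two-sided infinite) homotopy string `⋯ σ₂ σ₁ ⋯` decomposed into
its homotopy letters, together with a grading. If it is infinite to the left it is eventually a
direct antipath there, if it is infinite to the right it is eventually an inverse antipath there
(antipath: each homotopy letter is a single arrow or inverse arrow). The trivial homotopy string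
`1_x` is the case of one place and no letters. -/
structure HomotopyString (G : GentleQuiver V) extends HSequence G ℤ where
  nonempty : pos.Nonempty
  interval : pos.OrdConnected
  left_tail : ¬ BddAbove pos → ∃ m : ℤ, ∀ i, m ≤ i → ∃ a, letter i = some (.direct [a])
  right_tail : ¬ BddBelow pos → ∃ m : ℤ, ∀ i, i ≤ m → ∃ a, letter i = some (.inverse [a])

/-- A homotopy band with `n` homotopy letters, indexed cyclically, together with a grading:
it is not a proper power (it agrees with none of its nontrivial rotations), and has equal
numbers of direct and of inverse homotopy letters. -/
structure HomotopyBand (G : GentleQuiver V) (n : ℕ) extends HSequence G (ZMod n) where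
  pos_eq : pos = Set.univ
  primitive : ∀ k : ZMod n, k ≠ 0 → ∃ i, letter (i + k) ≠ letter i
  balanced : {i | ∃ p, letter i = some (.direct p)}.ncard =
    {i | ∃ p, letter i = some (.inverse p)}.ncard

/-! ## String and band complexes -/

section Complex

variable (K : Type u) [Field K] [Fintype V] {G : GentleQuiver V} {ι : Type} [CommRing ι]

namespace HSequence

variable (σ : HSequence G ι) (c : ι → K)

/-- The places of cohomological degree `d`. -/
abbrev Place (d : ℤ) := {i : ι // i ∈ σ.pos ∧ σ.deg i = d}

/-- The degree `d` term `⨁ P(x_i)`, over the places `i` of degree `d`. -/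
abbrev Term (d : ℤ) := ⨁ i : σ.Place d, P K G (σ.vertex i.1)

open Classical in
/-- Right multiplication by `r` from the summand at place `i` to the summand at place `j`
of the term of degree `d` (zero if `j` is not a place of degree `d`). -/
def component (i j : ι) (d : ℤ) (r : GentleAlgebra K G) :
    P K G (σ.vertex i) →ₗ[GentleAlgebra K G] σ.Term K d :=
  if h : j ∈ σ.pos ∧ σ.deg j = d then
    (DirectSum.lof (GentleAlgebra K G) (σ.Place d) (fun k => P K G (σ.vertex k.1)) ⟨j, h⟩).comp
      (rightMul K G (σ.vertex i) (σ.vertex j) r)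
  else 0

variable {K}

/-- The entry of the differential from place `i` to place `i + 1`; `c` is the family of scalars placed
on the homotopy letters. -/
def nextEntry (i : ι) : GentleAlgebra K G :=
  match σ.letter i with
  | some (.inverse p) => c i • pathElt K G p
  | _ => 0

/-- The entry of the differential from place `i` to place `i - 1`. -/
def prevEntry (i : ι) : GentleAlgebra K G :=
  match σ.letter (i - 1) with
  | some (.direct p) => c (i - 1) • pathElt K G p
  | _ => 0

open Classical in
/-- The differential, as a map from the term of degree `d` to the term of degree `d'`. It is
zero unless `d' = d + 1`. -/
def diff (d d' : ℤ) : σ.Term K d →ₗ[GentleAlgebra K G] σ.Term K d' :=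
  DirectSum.toModule _ _ _ fun i =>
    σ.component K i.1 (i.1 + 1) d' (σ.nextEntry c i.1) +
      σ.component K i.1 (i.1 - 1) d' (σ.prevEntry c i.1)

theorem component_zero (i j : ι) (d : ℤ) : σ.component K i j d 0 = 0 := by
  unfold component
  split_ifs
  · rw [rightMul_zero, LinearMap.comp_zero]
  · rfl

theorem nextEntry_cases (i : ι) : σ.nextEntry c i = 0 ∨
    ∃ p, σ.letter i = some (.inverse p) ∧ σ.nextEntry c i = c i • pathElt K G p := by
  unfold nextEntry
  split
  · exact Or.inr ⟨_, by assumption, rfl⟩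
  · exact Or.inl rfl

theorem prevEntry_cases (i : ι) : σ.prevEntry c i = 0 ∨
    ∃ p, σ.letter (i - 1) = some (.direct p) ∧
      σ.prevEntry c i = c (i - 1) • pathElt K G p := by
  unfold prevEntry
  split
  · exact Or.inr ⟨_, by assumption, rfl⟩
  · exact Or.inl rfl

open Classical in
theorem diff_lof (d d' : ℤ) (i : σ.Place d) (u : P K G (σ.vertex i.1)) :
    σ.diff c d d' (DirectSum.lof (GentleAlgebra K G) (σ.Place d)
      (fun k => P K G (σ.vertex k.1)) i u) =
    σ.component K i.1 (i.1 + 1) d' (σ.nextEntry c i.1) u +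
      σ.component K i.1 (i.1 - 1) d' (σ.prevEntry c i.1) u := by
  rw [diff, DirectSum.toModule_lof, LinearMap.add_apply]

open Classical in
theorem diff_shape (d d' : ℤ) (h : ¬ d + 1 = d') : σ.diff c d d' = 0 := by
  refine DirectSum.linearMap_ext _ fun i => ?_
  obtain ⟨i, hi, hd⟩ := i
  ext1 u
  simp only [diff, LinearMap.comp_apply, DirectSum.toModule_lof, LinearMap.add_apply,
    LinearMap.zero_apply]
  have h1 : σ.component K i (i + 1) d' (σ.nextEntry c i) = 0 := by
    rcases σ.nextEntry_cases c i with h0 | ⟨p, hp, -⟩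
    · rw [h0, component_zero]
    · rw [component, dif_neg]
      rintro ⟨-, h2⟩
      have := σ.inverse_deg i p hp
      omega
  have h2 : σ.component K i (i - 1) d' (σ.prevEntry c i) = 0 := by
    rcases σ.prevEntry_cases c i with h0 | ⟨p, hp, -⟩
    · rw [h0, component_zero]
    · rw [component, dif_neg]
      rintro ⟨-, h2⟩
      have := σ.direct_deg (i - 1) p hp
      rw [sub_add_cancel] at this
      omega
  rw [h1, h2]
  simp

theorem component_comp {i j k : ι} {d : ℤ} {r : GentleAlgebra K G}
    (r' : GentleAlgebra K G)
    (hr : r * vertexElt K G (σ.vertex j) * r' = 0)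
    (u : P K G (σ.vertex i)) (v : P K G (σ.vertex j))
    (hv : v = rightMul K G (σ.vertex i) (σ.vertex j) r u) :
    σ.component K j k d r' v = 0 := by
  unfold component
  split_ifs with h
  · have : rightMul K G (σ.vertex j) (σ.vertex k) r' v = 0 := by
      apply Subtype.ext
      rw [rightMul_coe, hv, rightMul_coe, mul_assoc, ← mul_assoc (r * _), hr]
      simp
    rw [LinearMap.comp_apply, this, map_zero]
  · rfl

open Classical in
theorem diff_component (i j : ι) (d d' : ℤ) (r : GentleAlgebra K G)
    (hn : r * vertexElt K G (σ.vertex j) * σ.nextEntry c j = 0)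
    (hp : r * vertexElt K G (σ.vertex j) * σ.prevEntry c j = 0) (u : P K G (σ.vertex i)) :
    σ.diff c d d' (σ.component K i j d r u) = 0 := by
  by_cases h : j ∈ σ.pos ∧ σ.deg j = d
  · rw [component, dif_pos h, LinearMap.comp_apply, diff, DirectSum.toModule_lof,
      LinearMap.add_apply, σ.component_comp _ hn u _ rfl,
      σ.component_comp _ hp u _ rfl, add_zero]
  · rw [component, dif_neg h, LinearMap.zero_apply, map_zero]

open Classical in
theorem diff_comp_diff (d d' d'' : ℤ) : (σ.diff c d' d'').comp (σ.diff c d d') = 0 := by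
  refine DirectSum.linearMap_ext _ fun i => ?_
  obtain ⟨i, hi, hd⟩ := i
  ext1 u
  simp only [LinearMap.comp_apply, LinearMap.zero_apply]
  rw [diff_lof, map_add]
  have h1 : σ.diff c d' d'' (σ.component K i (i + 1) d' (σ.nextEntry c i) u) = 0 := by
    apply diff_component
    · rcases σ.nextEntry_cases c i with h0 | ⟨p, hp, h0⟩
      · rw [h0, zero_mul, zero_mul]
      rcases σ.nextEntry_cases c (i + 1) with h0' | ⟨q, hq, h0'⟩
      · rw [h0', mul_zero]
      obtain ⟨a, b, ha, hb, hab⟩ := σ.mayFollow i _ _ hp hq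
      rw [h0, h0', smul_mul_assoc, pathElt_mul_vertexElt (σ.inverse_path i p hp),
        smul_mul_smul_comm, pathElt_mul_pathElt ha hb hab, smul_zero]
    · rcases σ.nextEntry_cases c i with h0 | ⟨p, hp, h0⟩
      · rw [h0, zero_mul, zero_mul]
      rcases σ.prevEntry_cases c (i + 1) with h0' | ⟨q, hq, h0'⟩
      · rw [h0', mul_zero]
      rw [add_sub_cancel_right, hp] at hq
      cases hq
  have h2 : σ.diff c d' d'' (σ.component K i (i - 1) d' (σ.prevEntry c i) u) = 0 := by
    apply diff_component
    · rcases σ.prevEntry_cases c i with h0 | ⟨p, hp, h0⟩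
      · rw [h0, zero_mul, zero_mul]
      rcases σ.nextEntry_cases c (i - 1) with h0' | ⟨q, hq, h0'⟩
      · rw [h0', mul_zero]
      rw [hp] at hq
      cases hq
    · rcases σ.prevEntry_cases c i with h0 | ⟨p, hp, h0⟩
      · rw [h0, zero_mul, zero_mul]
      rcases σ.prevEntry_cases c (i - 1) with h0' | ⟨q, hq, h0'⟩
      · rw [h0', mul_zero]
      have hq' : σ.letter (i - 1 - 1 + 1) = some (.direct p) := by rw [sub_add_cancel, hp]
      obtain ⟨a, b, ha, hb, hab⟩ := σ.mayFollow (i - 1 - 1) _ _ hq hq'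
      rw [h0, h0', smul_mul_assoc, pathElt_mul_vertexElt (σ.direct_path (i - 1) p hp),
        smul_mul_smul_comm, pathElt_mul_pathElt ha hb hab, smul_zero]
  rw [h1, h2, add_zero]

/-- The complex of projective `Λ`-modules obtained by wrapping up `σ`, with scalars `c`. -/
def complex : CochainComplex (ModuleCat (GentleAlgebra K G)) ℤ where
  X d := ModuleCat.of _ (σ.Term K d)
  d d d' := ModuleCat.ofHom (σ.diff c d d')
  shape d d' h := by
    rw [σ.diff_shape c d d' h]
    rfl
  d_comp_d' d d' d'' _ _ := by
    rw [← ModuleCat.ofHom_comp, σ.diff_comp_diff]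
    rfl

end HSequence

/-- The string complex of a homotopy string. -/
def HomotopyString.stringComplex (σ : HomotopyString G) :
    CochainComplex (ModuleCat (GentleAlgebra K G)) ℤ :=
  σ.toHSequence.complex (fun _ => (1 : K))

open Classical in
/-- The band complex of a homotopy band, with parameter `t` placed on the homotopy letter
`r` (a direct one, in use). -/
def HomotopyBand.bandComplex {K} [Field K] {n : ℕ} (σ : HomotopyBand G n) (r : ZMod n) (t : K) :
    CochainComplex (ModuleCat (GentleAlgebra K G)) ℤ :=
  σ.toHSequence.complex (fun i => if i = r then t else 1)

end Complex

/-! ## Strings, bands, string modules and band modules -/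

/-- Letters of walks: arrows `fwd a` and formal inverses `bwd a` of arrows. -/
inductive Letter (V : Type v) [Quiver.{w} V] where
  | fwd (a : Arrow V)
  | bwd (a : Arrow V)

namespace Letter

def arrow : Letter V → Arrow V
  | fwd a => a
  | bwd a => a

def source : Letter V → V
  | fwd a => a.left
  | bwd a => a.right

def target : Letter V → V
  | fwd a => a.right
  | bwd a => a.left

end Letter

/-- The letter `m` may follow the letter `l` (as in `m l`) in a string: the end of `l` is
the start of `m`, the two are not inverse to each other, and neither `m l` nor its inverse is a
relation. -/
def GentleQuiver.Composable (G : GentleQuiver V) (l m : Letter V) : Prop :=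
  l.target = m.source ∧
    match l, m with
    | .fwd a, .fwd b => ¬ G.rel b a
    | .bwd a, .bwd b => ¬ G.rel a b
    | .fwd a, .bwd b => a ≠ b
    | .bwd a, .fwd b => a ≠ b

/-- A word `w_l ⋯ w_1`, stored as its start vertex and the list `[w_1, …, w_l]`. -/
structure Word (V : Type v) [Quiver.{w} V] where
  start : V
  letters : List (Letter V)

/-- The word is a (possibly trivial) string. -/
structure GentleQuiver.IsString (G : GentleQuiver V) (w : Word V) : Prop where
  start : ∀ l, w.letters.head? = some l → l.source = w.start
  chain : w.letters.IsChain G.Composable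

/-- The nonempty cyclic word `w_n ⋯ w_1`, stored as `[w_1, …, w_n]`, is a band: all its powers are
strings, and it is not a proper power. -/
structure GentleQuiver.IsBand (G : GentleQuiver V) (w : List (Letter V)) : Prop where
  nonempty : w ≠ []
  cyclic : ∀ k : Fin w.length, G.Composable (w.get k) (w.get (finRotate w.length k))
  primitive : ∀ (v : List (Letter V)) (m : ℕ), 2 ≤ m → w ≠ (List.replicate m v).flatten

variable {G : GentleQuiver V} in
theorem GentleQuiver.IsString.vertex_castSucc {w : Word V} (hw : G.IsString w)
    (k : Fin w.letters.length) :
    (Fin.cases w.start (fun k => (w.letters.get k).target) k.castSucc : V) =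
      (w.letters.get k).source := by
  obtain ⟨k, hk⟩ := k
  cases k with
  | zero => exact (hw.start _ (by rw [List.head?_eq_getElem?, List.getElem?_eq_getElem hk]; rfl)).symm
  | succ k => exact ((List.isChain_iff_getElem.mp hw.chain) k hk).1

variable {G : GentleQuiver V} in
theorem GentleQuiver.Composable.not_rel {l m : Letter V} (h : G.Composable l m) :
    (∀ a b, l = .fwd a → m = .fwd b → ¬ G.rel b a) ∧
      (∀ a b, l = .bwd a → m = .bwd b → ¬ G.rel a b) := by
  constructor
  · rintro a b rfl rfl
    exact h.2
  · rintro a b rfl rfl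
    exact h.2

section Modules

variable (K : Type u) [Field K] [Fintype V] (G : GentleQuiver V)

/-- Combinatorial data for a representation of `(Q, I)`: a set `J` of basis vectors sitting at
vertices, and a set `N` of edges labelled by arrows; the arrow `a` maps the basis vector
`tail k` to `coef k` times `head k`, summed over the edges `k` labelled `a` (and zero if there
is none). -/
structure Schema (J N : Type) where
  vertex : J → V
  arrow : N → Arrow V
  tail : N → J
  head : N → J
  coef : N → K
  tail_vertex : ∀ k, vertex (tail k) = (arrow k).left
  head_vertex : ∀ k, vertex (head k) = (arrow k).right
  not_rel : ∀ k k', head k = tail k' → ¬ G.rel (arrow k') (arrow k)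

namespace Schema

variable {K G} {J N : Type} [Fintype J] [DecidableEq J] [Fintype N] (S : Schema K G J N)

open Classical in
def vertexMatrix (x : V) : Matrix J J K :=
  Matrix.diagonal fun j => if S.vertex j = x then 1 else 0

open Classical in
def arrowMatrix (a : Arrow V) : Matrix J J K :=
  Matrix.of fun j i => ∑ k : N, if S.arrow k = a ∧ S.tail k = i ∧ S.head k = j then S.coef k else 0

theorem lift_rel ⦃x y : FreeAlgebra K (V ⊕ Arrow V)⦄ (h : BoundRel K G x y) :
    FreeAlgebra.lift K (Sum.elim S.vertexMatrix S.arrowMatrix) x =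
      FreeAlgebra.lift K (Sum.elim S.vertexMatrix S.arrowMatrix) y := by
  classical
  induction h with
  | idem x => 
    simp [vertexMatrix, Matrix.diagonal_mul_diagonal]
  | orth x y h =>
    simp only [map_mul, FreeAlgebra.lift_ι_apply, Sum.elim_inl, vertexMatrix,
      Matrix.diagonal_mul_diagonal, map_zero]
    ext i j
    by_cases hij : i = j
    · subst hij
      by_cases hx : S.vertex i = x
      · simp [hx, h]
      · simp [hx]
    · simp [hij]
  | unit =>
    simp only [map_sum, FreeAlgebra.lift_ι_apply, Sum.elim_inl, map_one]
    ext i j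
    simp only [vertexMatrix, Matrix.sum_apply, Matrix.diagonal_apply, Matrix.one_apply]
    by_cases hij : i = j
    · simp [hij]
    · simp [hij]
  | target a =>
    simp only [map_mul, FreeAlgebra.lift_ι_apply, Sum.elim_inl, Sum.elim_inr]
    ext j i
    rw [vertexMatrix, Matrix.diagonal_mul]
    by_cases hj : S.vertex j = a.right
    · simp [hj]
    · rw [if_neg hj, zero_mul]
      symm
      refine Finset.sum_eq_zero fun k _ => if_neg ?_
      rintro ⟨rfl, -, rfl⟩
      exact hj (S.head_vertex k)
  | source a =>
    simp only [map_mul, FreeAlgebra.lift_ι_apply, Sum.elim_inl, Sum.elim_inr]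
    ext j i
    rw [vertexMatrix, Matrix.mul_diagonal]
    by_cases hj : S.vertex i = a.left
    · simp [hj]
    · rw [if_neg hj, mul_zero]
      symm
      refine Finset.sum_eq_zero fun k _ => if_neg ?_
      rintro ⟨rfl, rfl, -⟩
      exact hj (S.tail_vertex k)
  | rel b a h =>
    simp only [map_mul, FreeAlgebra.lift_ι_apply, Sum.elim_inr, map_zero]
    ext j i
    rw [Matrix.mul_apply]
    refine Finset.sum_eq_zero fun m _ => ?_
    rw [arrowMatrix, arrowMatrix, Matrix.of_apply, Matrix.of_apply, Finset.sum_mul_sum]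
    refine Finset.sum_eq_zero fun k' _ => Finset.sum_eq_zero fun k _ => ?_
    by_cases h1 : S.arrow k' = b ∧ S.tail k' = m ∧ S.head k' = j
    · by_cases h2 : S.arrow k = a ∧ S.tail k = i ∧ S.head k = m
      · exact absurd (h1.1 ▸ h2.1 ▸ h) (S.not_rel k k' (h2.2.2.trans h1.2.1.symm))
      · rw [if_neg h2, mul_zero]
    · rw [if_neg h1, zero_mul]

/-- The action of `Λ` on column vectors indexed by the basis `J`. -/
def action : GentleAlgebra K G →ₐ[K] Module.End K (J → K) :=
  (Matrix.toLinAlgEquiv' : Matrix J J K ≃ₐ[K] _).toAlgHom.comp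
    (RingQuot.liftAlgHom K ⟨FreeAlgebra.lift K (Sum.elim S.vertexMatrix S.arrowMatrix),
      S.lift_rel⟩)

/-- The `Λ`-module given by the combinatorial data. -/
def module : ModuleCat.{u} (GentleAlgebra K G) :=
  letI : Module (GentleAlgebra K G) (J → K) := Module.compHom (J → K) S.action.toRingHom
  ModuleCat.of (GentleAlgebra K G) (J → K)

end Schema

variable {G}

/-- The data of the string module of `w`: basis vectors `0, …, l`, and letter number `k` joins the
basis vectors `k` and `k + 1`. -/
def stringSchema (w : Word V) (hw : G.IsString w) :
    Schema K G (Fin (w.letters.length + 1)) (Fin w.letters.length) where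
  vertex := Fin.cases w.start fun k => (w.letters.get k).target
  arrow k := (w.letters.get k).arrow
  tail k := match w.letters.get k with
    | .fwd _ => k.castSucc
    | .bwd _ => k.succ
  head k := match w.letters.get k with
    | .fwd _ => k.succ
    | .bwd _ => k.castSucc
  coef _ := 1
  tail_vertex k := by
    have h := hw.vertex_castSucc k
    cases hk : w.letters.get k with
    | fwd a => rw [hk] at h; exact h
    | bwd a => simpa [Letter.target, Letter.arrow] using congrArg Letter.target hk
  head_vertex k := by
    have h := hw.vertex_castSucc k
    cases hk : w.letters.get k with
    | fwd a => simpa [Letter.target, Letter.arrow] using congrArg Letter.target hk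
    | bwd a => rw [hk] at h; exact h
  not_rel k k' h := by
    have hc := fun (i : ℕ) hi => ((List.isChain_iff_getElem.mp hw.chain) i hi).not_rel
    cases hk : w.letters.get k with
    | fwd a =>
      cases hk' : w.letters.get k' with
      | fwd b =>
        simp only [hk, hk'] at h
        have e : k.val + 1 = k'.val := congrArg Fin.val h
        refine (hc k.val (e ▸ k'.isLt)).1 a b hk ?_
        simp only [e]
        exact hk'
      | bwd b =>
        simp only [hk, hk'] at h
        rw [Fin.succ_injective _ h, hk'] at hk
        cases hk
    | bwd a =>
      cases hk' : w.letters.get k' with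
      | fwd b =>
        simp only [hk, hk'] at h
        rw [Fin.castSucc_injective _ h, hk'] at hk
        cases hk
      | bwd b =>
        simp only [hk, hk'] at h
        have e : k.val = k'.val + 1 := congrArg Fin.val h
        refine (hc k'.val (e ▸ k.isLt)).2 b a hk' ?_
        simp only [← e]
        exact hk

/-- The string module `M(w)`. -/
def stringModule (w : Word V) (hw : G.IsString w) : ModuleCat.{u} (GentleAlgebra K G) :=
  (stringSchema K w hw).module

open Classical in
/-- The data of the (quasi-simple) band module of `w`: basis vectors in cyclic order, letter
number `k` joins the basis vector `k` to the next one, and the parameter `t` is placed on the first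
letter (a direct one, in use). -/
def bandSchema {K} [Field K] (w : List (Letter V)) (hw : G.IsBand w) (t : K) :
    Schema K G (Fin w.length) (Fin w.length) where
  vertex k := (w.get k).source
  arrow k := (w.get k).arrow
  tail k := match w.get k with
    | .fwd _ => k
    | .bwd _ => finRotate w.length k
  head k := match w.get k with
    | .fwd _ => finRotate w.length k
    | .bwd _ => k
  coef k := if k.val = 0 then t else 1
  tail_vertex k := by
    have h := (hw.cyclic k).1
    cases hk : w.get k with
    | fwd a => exact congrArg Letter.source hk
    | bwd a => rw [hk] at h; exact h.symm
  head_vertex k := by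
    have h := (hw.cyclic k).1
    cases hk : w.get k with
    | fwd a => rw [hk] at h; exact h.symm
    | bwd a => exact congrArg Letter.source hk
  not_rel k k' h := by
    cases hk : w.get k with
    | fwd a =>
      cases hk' : w.get k' with
      | fwd b =>
        simp only [hk, hk'] at h
        exact (hw.cyclic k).not_rel.1 a b hk (h ▸ hk')
      | bwd b =>
        simp only [hk, hk'] at h
        rw [(finRotate _).injective h, hk'] at hk
        cases hk
    | bwd a =>
      cases hk' : w.get k' with
      | fwd b =>
        simp only [hk, hk'] at h
        rw [h, hk'] at hk
        cases hk
      | bwd b =>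
        simp only [hk, hk'] at h
        exact (hw.cyclic k').not_rel.2 b a hk' (h ▸ hk)

/-- The (quasi-simple) band module `B(w, t)`. -/
def bandModule {K} [Field K] (w : List (Letter V)) (hw : G.IsBand w) (t : K) :
    ModuleCat.{u} (GentleAlgebra K G) :=
  (bandSchema w hw t).module

end Modules

/-! ## The combinatorial rules -/

namespace Word

/-- The word with the first letter (the right end) removed. -/
def dropFirst (w : Word V) : Word V :=
  match w.letters with
  | [] => w
  | l :: t => ⟨l.target, t⟩

/-- The word with the last letter (the left end) removed. -/
def dropLast (w : Word V) : Word V := ⟨w.start, w.letters.dropLast⟩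

/-- The word `w u`, with `u` the inverse of the path `q`, which starts where `w` starts. -/
def extendRight (w : Word V) (q : List (Arrow V)) : Word V :=
  ⟨(q.getLast?.map Quiver.Total.right).getD w.start, (q.map Letter.bwd).reverse ++ w.letters⟩

/-- The word `q w`, for a path `q` which starts where `w` ends. -/
def extendLeft (w : Word V) (q : List (Arrow V)) : Word V :=
  ⟨w.start, w.letters ++ q.map Letter.fwd⟩

end Word

/-- The walk underlying a homotopy letter. -/
def HLetter.walk : HLetter V → List (Letter V)
  | .direct p => p.map Letter.fwd
  | .inverse p => (p.map Letter.bwd).reverse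

/-- `L` and `M` both exist, and one of them is direct and the other one inverse. -/
def Alternate (L M : Option (HLetter V)) : Prop :=
  (∃ p q, L = some (.direct p) ∧ M = some (.inverse q)) ∨
    ∃ p q, L = some (.inverse p) ∧ M = some (.direct q)

/-- `q` is the maximal path in `(Q, I)` that starts at `x` with an arrow other than the first arrow of
`p`, or the empty list if there is no such arrow. -/
def GentleQuiver.IsOtherLeg (G : GentleQuiver V) (x : V) (p q : List (Arrow V)) : Prop :=
  (q = [] ∧ ∀ c : Arrow V, c.left = x → p.head? = some c) ∨
    ∃ c : Arrow V, c.left = x ∧ p.head? ≠ some c ∧ G.IsMaximalPath c q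

/-- `q` is the maximal path in `(Q, I)` that starts with an arrow `c` such that `c b = 0`, where
`b` is the last arrow of `p` (and `c b` is a path of the quiver). -/
def GentleQuiver.IsKernelLeg (G : GentleQuiver V) (p q : List (Arrow V)) : Prop :=
  ∃ b c : Arrow V, p.getLast? = some b ∧ G.rel c b ∧ G.IsMaximalPath c q

namespace HSequence

variable {G : GentleQuiver V} {ι : Type} [CommRing ι] (σ : HSequence G ι)

/-- The word underlying the homotopy substring of the `m` homotopy letters at `i, …, i + m - 1`. -/
def subword (i : ι) (m : ℕ) : Word V :=
  ⟨σ.vertex i, (List.range m).flatMap fun k => ((σ.letter (i + k)).map HLetter.walk).getD []⟩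

/-- The `m` homotopy letters at `i, …, i + m - 1` form a maximal alternating homotopy
substring. -/
structure IsMaxAlternating (i : ι) (m : ℕ) : Prop where
  two_le : 2 ≤ m
  alternate : ∀ k : ℕ, k + 1 < m → Alternate (σ.letter (i + k)) (σ.letter (i + k + 1))
  right : ¬ Alternate (σ.letter (i - 1)) (σ.letter i)
  left : ¬ Alternate (σ.letter (i + m - 1)) (σ.letter (i + m))

/-- `σ` starts (on the right) at place `i`, with a direct homotopy letter. -/
def StartsDirect (i : ι) (p : List (Arrow V)) : Prop :=
  σ.letter (i - 1) = none ∧ σ.letter i = some (.direct p)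

/-- `σ` starts (on the right) at place `i`, with an inverse homotopy letter. -/
def StartsInverse (i : ι) (p : List (Arrow V)) : Prop :=
  σ.letter (i - 1) = none ∧ σ.letter i = some (.inverse p)

/-- `σ` ends (on the left) at place `j`, with a direct homotopy letter. -/
def EndsDirect (j : ι) (p : List (Arrow V)) : Prop :=
  σ.letter j = none ∧ σ.letter (j - 1) = some (.direct p)

/-- `σ` ends (on the left) at place `j`, with an inverse homotopy letter. -/
def EndsInverse (j : ι) (p : List (Arrow V)) : Prop :=
  σ.letter j = none ∧ σ.letter (j - 1) = some (.inverse p)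

/-- The applications of the rules to `σ`, other than those to an alternating band:
* `maxAlternating`: the maximal alternating homotopy substring rule, where no combined rule applies;
* `cokernel`: the cokernel rule, where no combined rule applies;
* `combined`: the combined rule; `combinedBoth` is the rule combined with its dual;
* `kernel`: the kernel rule, in the case that there is an arrow `c` as required;
* `homotopyLetter`: the nontrivial homotopy letter rule, for homotopy letters of length at
  least two;
* the duals of these. -/
inductive Summand where
  | maxAlternating (i : ι) (m : ℕ) (h : σ.IsMaxAlternating i m)
      (hr : ∀ p, ¬ σ.StartsDirect i p) (hl : ∀ p, ¬ σ.EndsInverse (i + m) p)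
  | cokernel (i : ι) (p q : List (Arrow V)) (h : σ.StartsDirect i p)
      (hl : ¬ Alternate (σ.letter i) (σ.letter (i + 1))) (hq : G.IsOtherLeg (σ.vertex i) p q)
  | cokernelDual (j : ι) (p q : List (Arrow V)) (h : σ.EndsInverse j p)
      (hr : ¬ Alternate (σ.letter (j - 2)) (σ.letter (j - 1)))
      (hq : G.IsOtherLeg (σ.vertex j) p q)
  | combined (i : ι) (m : ℕ) (p q : List (Arrow V)) (h : σ.IsMaxAlternating i m)
      (hr : σ.StartsDirect i p) (hl : ∀ p, ¬ σ.EndsInverse (i + m) p)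
      (hq : G.IsOtherLeg (σ.vertex i) p q)
  | combinedDual (i : ι) (m : ℕ) (p q : List (Arrow V)) (h : σ.IsMaxAlternating i m)
      (hr : ∀ p, ¬ σ.StartsDirect i p) (hl : σ.EndsInverse (i + m) p)
      (hq : G.IsOtherLeg (σ.vertex (i + m)) p q)
  | combinedBoth (i : ι) (m : ℕ) (p q p' q' : List (Arrow V)) (h : σ.IsMaxAlternating i m)
      (hr : σ.StartsDirect i p) (hq : G.IsOtherLeg (σ.vertex i) p q)
      (hl : σ.EndsInverse (i + m) p') (hq' : G.IsOtherLeg (σ.vertex (i + m)) p' q')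
  | kernel (j : ι) (p q : List (Arrow V)) (h : σ.EndsDirect j p) (hq : G.IsKernelLeg p q)
  | kernelDual (i : ι) (p q : List (Arrow V)) (h : σ.StartsInverse i p) (hq : G.IsKernelLeg p q)
  | homotopyLetter (i : ι) (p p' : List (Arrow V)) (h : σ.letter i = some (.direct p))
      (hp : 2 ≤ p.length) (hr : σ.letter (i - 1) = some (.direct p'))
      (hl : ¬ Alternate (σ.letter i) (σ.letter (i + 1)))
  | homotopyLetterDual (i : ι) (p p' : List (Arrow V)) (h : σ.letter i = some (.inverse p))
      (hp : 2 ≤ p.length) (hl : σ.letter (i + 1) = some (.inverse p'))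
      (hr : ¬ Alternate (σ.letter (i - 1)) (σ.letter i))

/-- Any two neighbouring homotopy letters of `σ` alternate (for a homotopy band: also cyclically), and
`σ` has no ends. -/
def IsAlternating : Prop := ∀ i, Alternate (σ.letter i) (σ.letter (i + 1))

variable {σ}

/-- The cohomological degree to which an application of a rule contributes. -/
def Summand.degree : σ.Summand → ℤ
  | maxAlternating i _ _ _ _ => max (σ.deg i) (σ.deg (i + 1))
  | cokernel i _ _ _ _ _ => σ.deg i
  | cokernelDual j _ _ _ _ _ => σ.deg j
  | combined i _ _ _ _ _ _ _ => σ.deg i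
  | combinedDual i m _ _ _ _ _ _ => σ.deg (i + m)
  | combinedBoth i _ _ _ _ _ _ _ _ _ _ => σ.deg i
  | kernel j _ _ _ _ => σ.deg j
  | kernelDual i _ _ _ _ => σ.deg i
  | homotopyLetter i _ _ _ _ _ _ => σ.deg i
  | homotopyLetterDual i _ _ _ _ _ _ => σ.deg (i + 1)

/-- The string whose string module an application of a rule contributes. -/
def Summand.word : σ.Summand → Word V
  | maxAlternating i m _ _ _ => (σ.subword i m).dropFirst.dropLast
  | cokernel i _ q _ _ _ => (σ.subword i 1).dropLast.extendRight q
  | cokernelDual j _ q _ _ _ => (σ.subword (j - 1) 1).dropFirst.extendLeft q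
  | combined i m _ q _ _ _ _ => (σ.subword i m).dropLast.extendRight q
  | combinedDual i m _ q _ _ _ _ => (σ.subword i m).dropFirst.extendLeft q
  | combinedBoth i m _ q _ q' _ _ _ _ _ => ((σ.subword i m).extendLeft q').extendRight q
  | kernel j _ q _ _ => (⟨σ.vertex j, q.map Letter.fwd⟩ : Word V).dropFirst
  | kernelDual i _ q _ _ => (⟨σ.vertex i, q.map Letter.fwd⟩ : Word V).dropFirst
  | homotopyLetter i _ _ _ _ _ _ => (σ.subword i 1).dropFirst.dropLast
  | homotopyLetterDual i _ _ _ _ _ _ => (σ.subword i 1).dropFirst.dropLast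

end HSequence

end

end GentleCohomology


open GentleCohomology

/-!
The complex of a homotopy string or band `σ` has a basis of paths: the summand `P(x)` at a place has
the paths starting at the vertex `x` there, and the differential maps such a path to multiples of
paths in the summands at the two neighbouring places, namely its composites with the homotopy letters
that lead there (`diff_vec`). Since `Λ` is gentle, a path of positive length composes to a nonzero path
with at most one of two such letters, so the differential is almost a partial matching of paths.

The legs of the projectives at the ends of `σ` that occur in the rules behave like further homotopy
letters, whose other end is missing. `Completion` adds them to `σ` as virtual letters. A letter of the
completed sequence given by a path `q` then carries certain initial pieces of `q`, in the summand to
which the differential maps (`Completion.Owns`). These paths are cocycles (`Owns.diff_eq_zero`), they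
are independent modulo coboundaries (`Owns.exists_functional`), and any other path either is detected
by its differential or is, modulo coboundaries, a multiple of one of them (`reduces_or_detected`).
So their classes form a basis of the cohomology, and it remains to identify the action of `Λ`; this
is `Completion.homology_equiv`.

The action is read off from walks. A walk along a direct letter appends the arrows of its path one
by one, and a walk against an inverse letter removes them. Where an inverse letter is followed by a
direct one, the walk passes through a trivial path. Where a direct letter is followed by an inverse
one, the differential of the trivial path in between identifies the classes of the two letters up to
the negative of the ratio of the scalars (`follows_of_opposite`). Where directions agree, the walk
ends. Hence the cohomology is the direct sum of the string modules of the maximal alternating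
sequences of letters of the completed sequence (`IsRun.exists_realizes`, `homology_equiv_directSum`).
The rules enumerate these sequences: `isRun_summand` and `word_summand` assign one to each application
of a rule, `summand_injective` and `IsRun.exists_summand` say that each occurs exactly once.
A trivial homotopy string has just the two virtual letters, which gives part (b).

If a homotopy band alternates cyclically, the walk never ends but closes up, and after one turn
the class is multiplied by the product of the factors above, one for each direct letter, which is
`(-1) ^ (n / 2) * t⁻¹` (`runCoef_eq`). This gives the band module (`IsAlternatingRun.realizesBand`).
Its word is not a proper power because the homotopy letters are the maximal pieces of the word in one
direction, and `σ` is not a proper power (`not_proper_power`).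
-/

open CategoryTheory
open scoped DirectSum

namespace GentleCohomology

noncomputable section

universe u v w

variable {V : Type v} [Quiver.{w} V]

set_option linter.unusedSectionVars false

/-! ### The path basis of `P(x)` -/

/-- `p` is a possibly trivial path in `(Q, I)` starting at `x`. -/
structure GentleQuiver.IsPathFrom (G : GentleQuiver V) (x : V) (p : List (Arrow V)) : Prop where
  source : ∀ a, p.head? = some a → a.left = x
  chain : p.IsChain (fun a b => a.right = b.left ∧ ¬ G.rel b a)

/-- The end of a possibly trivial path starting at `x`. -/
def pathEnd (x : V) (p : List (Arrow V)) : V := (p.getLast?.map Quiver.Total.right).getD x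

@[simp] theorem pathEnd_nil (x : V) : pathEnd x [] = x := rfl

@[simp] theorem pathEnd_concat (x : V) (p : List (Arrow V)) (a : Arrow V) :
    pathEnd x (p ++ [a]) = a.right := by simp [pathEnd]

theorem GentleQuiver.isPathFrom_nil (G : GentleQuiver V) (x : V) : G.IsPathFrom x [] :=
  ⟨by simp, List.isChain_nil⟩

theorem GentleQuiver.isPathFrom_concat {G : GentleQuiver V} {x : V} {p : List (Arrow V)}
    {a : Arrow V} : G.IsPathFrom x (p ++ [a]) ↔
      G.IsPathFrom x p ∧ pathEnd x p = a.left ∧ ∀ b, p.getLast? = some b → ¬ G.rel a b := by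
  rcases List.eq_nil_or_concat p with rfl | ⟨p, b, rfl⟩
  · constructor
    · intro h
      exact ⟨G.isPathFrom_nil x, (h.source a rfl).symm, by simp⟩
    · rintro ⟨-, h, -⟩
      exact ⟨by simpa using h.symm, by simp⟩
  · constructor
    · intro h
      have h2 := List.isChain_append.mp h.chain
      have h3 := h2.2.2 b (by simp) a (by simp)
      refine ⟨⟨fun c hc => h.source c ?_, h2.1⟩, by simpa using h3.1, by simpa using h3.2⟩
      rw [List.head?_append, hc]; rfl
    · rintro ⟨h, h1, h2⟩
      refine ⟨fun c hc => h.source c ?_, List.isChain_append.mpr ⟨h.chain, by simp, ?_⟩⟩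
      · rw [List.head?_append] at hc
        cases p <;> simpa using hc
      · intro c hc d hd
        simp only [List.concat_eq_append, List.getLast?_concat, Option.mem_some_iff,
          List.head?_cons] at hc hd
        subst hc hd
        exact ⟨by simpa using h1, by simpa using h2⟩

theorem GentleQuiver.IsPathFrom.append_left {G : GentleQuiver V} {x : V} {p q : List (Arrow V)}
    (h : G.IsPathFrom x (p ++ q)) : G.IsPathFrom x p :=
  ⟨fun a ha => h.source a (by rw [List.head?_append, ha]; rfl), (List.isChain_append.mp h.chain).1⟩

theorem GentleQuiver.IsPathFrom.prefix {G : GentleQuiver V} {x : V} {p q : List (Arrow V)}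
    (h : G.IsPathFrom x q) (hp : p <+: q) : G.IsPathFrom x p := by
  obtain ⟨r, rfl⟩ := hp
  exact h.append_left

theorem GentleQuiver.IsPath.isPathFrom {G : GentleQuiver V} {x y : V} {p : List (Arrow V)}
    (h : G.IsPath x y p) : G.IsPathFrom x p :=
  ⟨fun a ha => by simpa [ha] using h.source, h.chain⟩

theorem GentleQuiver.IsPath.ne_nil {G : GentleQuiver V} {x y : V} {p : List (Arrow V)}
    (h : G.IsPath x y p) : p ≠ [] := by
  rintro rfl
  simpa using h.source

theorem GentleQuiver.IsPath.pathEnd_eq {G : GentleQuiver V} {x y z : V} {p : List (Arrow V)}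
    (h : G.IsPath x y p) : pathEnd z p = y := by
  rw [pathEnd, h.target]; rfl

/-- A path in `(Q, I)` is determined by its first arrow and its length: of two paths with the same
first arrow one is an initial piece of the other. -/
theorem GentleQuiver.prefix_or_prefix (G : GentleQuiver V) {p q : List (Arrow V)}
    (hp : p.IsChain (fun a b => a.right = b.left ∧ ¬ G.rel b a))
    (hq : q.IsChain (fun a b => a.right = b.left ∧ ¬ G.rel b a))
    (h : p.head? = q.head?) : p <+: q ∨ q <+: p := by
  induction p generalizing q with
  | nil => exact Or.inl (List.nil_prefix)
  | cons a p ih =>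
    cases q with
    | nil => exact Or.inr (List.nil_prefix)
    | cons b q =>
      obtain rfl : a = b := by simpa using h
      have key : p <+: q ∨ q <+: p := by
        cases p with
        | nil => exact Or.inl (List.nil_prefix)
        | cons c p =>
          cases q with
          | nil => exact Or.inr (List.nil_prefix)
          | cons d q =>
            rw [List.isChain_cons_cons] at hp hq
            obtain rfl := G.nonrel_after a hp.1 hq.1
            exact ih hp.2 hq.2 rfl
      simpa [List.cons_prefix_cons] using key

section Algebra

variable (K : Type u) [Field K] [Fintype V] (G : GentleQuiver V)

open Classical in
/-- The action of an idempotent on the vector space with basis the paths starting at `x`. -/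
def pathVertexOp (x y : V) : Module.End K (List (Arrow V) →₀ K) :=
  Finsupp.linearCombination K fun p => if pathEnd x p = y then Finsupp.single p 1 else 0

open Classical in
/-- The action of an arrow on the vector space with basis the paths starting at `x`. -/
def pathArrowOp (x : V) (a : Arrow V) : Module.End K (List (Arrow V) →₀ K) :=
  Finsupp.linearCombination K fun p =>
    if pathEnd x p = a.left ∧ ∀ b, p.getLast? = some b → ¬ G.rel a b then
      Finsupp.single (p ++ [a]) 1 else 0

variable {K}

open Classical in
@[simp] theorem pathVertexOp_single (x y : V) (p : List (Arrow V)) :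
    pathVertexOp K x y (Finsupp.single p 1) =
      if pathEnd x p = y then Finsupp.single p 1 else 0 := by
  simp [pathVertexOp]

open Classical in
@[simp] theorem pathArrowOp_single (x : V) (a : Arrow V) (p : List (Arrow V)) :
    pathArrowOp K G x a (Finsupp.single p 1) =
      if pathEnd x p = a.left ∧ ∀ b, p.getLast? = some b → ¬ G.rel a b then
        Finsupp.single (p ++ [a]) 1 else 0 := by
  simp [pathArrowOp]

theorem pathOp_rel (x : V) ⦃r s : FreeAlgebra K (V ⊕ Arrow V)⦄ (h : BoundRel K G r s) :
    FreeAlgebra.lift K (Sum.elim (pathVertexOp K x) (pathArrowOp K G x)) r =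
      FreeAlgebra.lift K (Sum.elim (pathVertexOp K x) (pathArrowOp K G x)) s := by
  classical
  refine Finsupp.lhom_ext' fun p => LinearMap.ext_ring ?_
  induction h with
  | idem y =>
    by_cases h1 : pathEnd x p = y <;>
    simp [h1]
  | orth y z h =>
    by_cases h1 : pathEnd x p = z <;>
    simp [h1, Ne.symm h]
  | unit => simp
  | target a =>
    simp only [map_mul, FreeAlgebra.lift_ι_apply, Sum.elim_inl, Sum.elim_inr,
      LinearMap.comp_apply, Module.End.mul_apply, Finsupp.lsingle_apply, pathArrowOp_single]
    split_ifs <;> simp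
  | source a =>
    simp only [map_mul, FreeAlgebra.lift_ι_apply, Sum.elim_inl, Sum.elim_inr,
      LinearMap.comp_apply, Module.End.mul_apply, Finsupp.lsingle_apply, pathVertexOp_single]
    by_cases h : pathEnd x p = a.left <;> simp [h]
  | rel b a h =>
    simp only [map_mul, FreeAlgebra.lift_ι_apply, Sum.elim_inr,
      LinearMap.comp_apply, Module.End.mul_apply, Finsupp.lsingle_apply, pathArrowOp_single,
      map_zero, LinearMap.zero_apply]
    split_ifs
    · rw [pathArrowOp_single, if_neg]
      simp [h]
    · simp

/-- The representation of `Λ` on the vector space with basis the lists of arrows, read as paths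
starting at `x`. -/
def pathRep (x : V) : GentleAlgebra K G →ₐ[K] Module.End K (List (Arrow V) →₀ K) :=
  RingQuot.liftAlgHom K ⟨_, pathOp_rel G x⟩

theorem pathRep_vertexElt (x y : V) : pathRep G x (vertexElt K G y) = pathVertexOp K x y := by
  refine (RingQuot.liftAlgHom_mkAlgHom_apply ..).trans ?_
  simp

theorem pathRep_arrowElt (x : V) (a : Arrow V) :
    pathRep G x (arrowElt K G a) = pathArrowOp K G x a := by
  refine (RingQuot.liftAlgHom_mkAlgHom_apply ..).trans ?_
  simp

variable {G}

theorem vertexElt_mul_self (x : V) :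
    vertexElt K G x * vertexElt K G x = vertexElt K G x := by
  have := toGentleAlgebra_rel (BoundRel.idem (K := K) (G := G) x)
  simpa [vertexElt] using this

theorem vertexElt_mul_of_ne {x y : V} (h : x ≠ y) :
    vertexElt K G x * vertexElt K G y = 0 := by
  have := toGentleAlgebra_rel (BoundRel.orth (K := K) (G := G) x y h)
  simpa [vertexElt] using this

theorem target_mul_arrowElt (a : Arrow V) :
    vertexElt K G a.right * arrowElt K G a = arrowElt K G a := by
  have := toGentleAlgebra_rel (BoundRel.target (K := K) (G := G) a)
  simpa [arrowElt, vertexElt] using this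

theorem pathElt_concat (p : List (Arrow V)) (a : Arrow V) :
    pathElt K G (p ++ [a]) = arrowElt K G a * pathElt K G p := by
  rw [pathElt_append]
  simp [pathElt]

theorem vertexElt_mul_pathElt (x y : V) (p : List (Arrow V)) :
    vertexElt K G y * (pathElt K G p * vertexElt K G x) =
      open Classical in if pathEnd x p = y then pathElt K G p * vertexElt K G x else 0 := by
  rcases List.eq_nil_or_concat p with rfl | ⟨p, b, rfl⟩
  · split_ifs with h
    · subst h
      simp [pathElt, vertexElt_mul_self]
    · simpa [pathElt] using vertexElt_mul_of_ne fun e => h e.symm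
  · rw [List.concat_eq_append, pathElt_concat, ← mul_assoc, ← mul_assoc]
    split_ifs with h
    · rw [pathEnd_concat] at h
      subst h
      rw [target_mul_arrowElt]
    · rw [pathEnd_concat] at h
      rw [← target_mul_arrowElt b, ← mul_assoc, vertexElt_mul_of_ne (Ne.symm h)]
      simp

theorem pathElt_mul_eq_zero {x : V} {p : List (Arrow V)} (h : ¬ G.IsPathFrom x p) :
    pathElt K G p * vertexElt K G x = 0 := by
  induction p using List.reverseRecOn with
  | nil => exact absurd (G.isPathFrom_nil x) h
  | append_singleton p a ih =>
    rw [pathElt_concat, mul_assoc]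
    by_cases hp : G.IsPathFrom x p
    · by_cases he : pathEnd x p = a.left
      · rw [GentleQuiver.isPathFrom_concat] at h
        simp only [hp, he, true_and, not_forall, not_not] at h
        obtain ⟨b, hb, hr⟩ := h
        obtain ⟨p, rfl⟩ := List.getLast?_eq_some_iff.mp hb
        rw [pathElt_concat, mul_assoc, ← mul_assoc, arrowElt_mul_arrowElt hr, zero_mul]
      · have := vertexElt_mul_pathElt (K := K) (G := G) x a.left p
        rw [if_neg he] at this
        rw [← arrowElt_mul_source, mul_assoc, this, mul_zero]
    · rw [ih hp, mul_zero]

theorem pathRep_pathElt {x : V} {p : List (Arrow V)} (h : G.IsPathFrom x p) :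
    pathRep G x (pathElt K G p * vertexElt K G x) (Finsupp.single [] 1) =
      Finsupp.single p 1 := by
  classical
  induction p using List.reverseRecOn with
  | nil => simp [pathElt, pathRep_vertexElt]
  | append_singleton p a ih =>
    obtain ⟨h1, h2⟩ := GentleQuiver.isPathFrom_concat.mp h
    rw [pathElt_concat, mul_assoc, map_mul, Module.End.mul_apply, ih h1, pathRep_arrowElt,
      pathArrowOp_single, if_pos h2]

variable (K G)

/-- The element of `P(x)` given by the path `p` starting at `x`; it is zero if `p` is not such
a path. -/
def pathVec (x : V) (p : List (Arrow V)) : P K G x :=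
  ⟨pathElt K G p * vertexElt K G x, Submodule.smul_mem _ _ (Submodule.mem_span_singleton_self _)⟩

variable {K G}

theorem pathVec_coe (x : V) (p : List (Arrow V)) :
    (pathVec K G x p : GentleAlgebra K G) = pathElt K G p * vertexElt K G x := rfl

theorem pathVec_eq_zero {x : V} {p : List (Arrow V)} (h : ¬ G.IsPathFrom x p) :
    pathVec K G x p = 0 := Subtype.ext (pathElt_mul_eq_zero h)

theorem arrowElt_smul_pathVec (x : V) (p : List (Arrow V)) (a : Arrow V) :
    arrowElt K G a • pathVec K G x p = pathVec K G x (p ++ [a]) := by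
  apply Subtype.ext
  simp only [SetLike.val_smul, pathVec_coe, smul_eq_mul, pathElt_concat, mul_assoc]

open Classical in
theorem vertexElt_smul_pathVec (x y : V) (p : List (Arrow V)) :
    vertexElt K G y • pathVec K G x p = if pathEnd x p = y then pathVec K G x p else 0 := by
  apply Subtype.ext
  simp only [SetLike.val_smul, pathVec_coe, smul_eq_mul, vertexElt_mul_pathElt]
  split_ifs <;> rfl

theorem rightMul_pathVec {x y : V} {q : List (Arrow V)} (hq : G.IsPath y x q)
    (p : List (Arrow V)) :
    rightMul K G x y (pathElt K G q) (pathVec K G x p) = pathVec K G y (q ++ p) := by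
  apply Subtype.ext
  have h := vertexElt_mul_pathElt (K := K) (G := G) y x q
  rw [if_pos hq.pathEnd_eq] at h
  rw [rightMul_coe, pathVec_coe, pathVec_coe, mul_assoc, h, pathElt_append, mul_assoc]

/-- `Λ` is generated by idempotents and arrows, in the form of an induction principle for additive
subgroups closed under scalars. -/
theorem smul_mem_of_generators {X : Type*} [AddCommGroup X] [Module K X]
    [Module (GentleAlgebra K G) X] [IsScalarTower K (GentleAlgebra K G) X] (W : Submodule K X)
    (hv : ∀ (y : V), ∀ m ∈ W, vertexElt K G y • m ∈ W)
    (ha : ∀ (a : Arrow V), ∀ m ∈ W, arrowElt K G a • m ∈ W)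
    (r : GentleAlgebra K G) {m : X} (hm : m ∈ W) : r • m ∈ W := by
  obtain ⟨r, rfl⟩ := RingQuot.mkAlgHom_surjective K (BoundRel K G) r
  change toGentleAlgebra K G r • m ∈ W
  induction r using FreeAlgebra.induction generalizing m with
  | grade0 k =>
    rw [AlgHom.commutes, algebraMap_smul]
    exact W.smul_mem k hm
  | grade1 i =>
    cases i with
    | inl y => exact hv y m hm
    | inr a => exact ha a m hm
  | mul r s hr hs =>
    rw [map_mul, mul_smul]
    exact hr (hs hm)
  | add r s hr hs =>
    rw [map_add, add_smul]
    exact W.add_mem (hr hm) (hs hm)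

theorem mem_span_pathVec (x : V) (m : P K G x) :
    m ∈ Submodule.span K (Set.range (pathVec K G x)) := by
  obtain ⟨m, hm⟩ := m
  obtain ⟨r, rfl⟩ := Submodule.mem_span_singleton.mp hm
  have : (⟨r • vertexElt K G x, hm⟩ : P K G x) = r • pathVec K G x [] := by
    apply Subtype.ext
    simp [pathVec_coe, pathElt]
  rw [this]
  apply smul_mem_of_generators
  · intro y m hm
    induction hm using Submodule.span_induction with
    | mem m hm =>
      obtain ⟨p, rfl⟩ := hm
      rw [vertexElt_smul_pathVec]
      split_ifs
      · exact Submodule.subset_span ⟨p, rfl⟩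
      · exact zero_mem _
    | zero => rw [smul_zero]; exact zero_mem _
    | add a b _ _ ha hb => rw [smul_add]; exact add_mem ha hb
    | smul k a _ ha => rw [smul_comm]; exact Submodule.smul_mem _ k ha
  · intro y m hm
    induction hm using Submodule.span_induction with
    | mem m hm =>
      obtain ⟨p, rfl⟩ := hm
      rw [arrowElt_smul_pathVec]
      exact Submodule.subset_span ⟨_, rfl⟩
    | zero => rw [smul_zero]; exact zero_mem _
    | add a b _ _ ha hb => rw [smul_add]; exact add_mem ha hb
    | smul k a _ ha => rw [smul_comm]; exact Submodule.smul_mem _ k ha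
  · exact Submodule.subset_span ⟨[], rfl⟩

variable (K G) in
/-- The coefficient of the path `p` in an element of `P(x)`. -/
def pathCoord (x : V) (p : List (Arrow V)) : P K G x →ₗ[K] K where
  toFun m := pathRep G x (m : GentleAlgebra K G) (Finsupp.single [] 1) p
  map_add' m n := by simp
  map_smul' k m := by
    simp only [Submodule.coe_smul_of_tower, map_smul]
    simp

open Classical in
theorem pathCoord_pathVec {x : V} {q : List (Arrow V)} (hq : G.IsPathFrom x q)
    (p : List (Arrow V)) : pathCoord K G x p (pathVec K G x q) = if q = p then 1 else 0 := by
  change pathRep G x (pathElt K G q * vertexElt K G x) (Finsupp.single [] 1) p = _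
  rw [pathRep_pathElt hq, Finsupp.single_apply]

end Algebra

/-! ### The path basis of the terms of the complex -/

section Term

variable (K : Type u) [Field K] [Fintype V] {G : GentleQuiver V} {ι : Type} [CommRing ι]

namespace HSequence

variable (σ : HSequence G ι)

/-- `p` is a path starting at the vertex at place `j`, and `j` is a place of degree `d`. The pairs
`(j, p)` of this kind index a basis of the term of degree `d`. -/
structure IsBasic (d : ℤ) (b : ι × List (Arrow V)) : Prop where
  place : b.1 ∈ σ.pos ∧ σ.deg b.1 = d
  path : G.IsPathFrom (σ.vertex b.1) b.2

open Classical in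
/-- The element of the term of degree `d` given by the path `p` in the summand at place `j`; zero if
`j` is not a place of degree `d` or `p` is not a path starting there. -/
def vec (d : ℤ) (b : ι × List (Arrow V)) : σ.Term K d :=
  if h : b.1 ∈ σ.pos ∧ σ.deg b.1 = d then
    DirectSum.lof (GentleAlgebra K G) (σ.Place d) (fun k => P K G (σ.vertex k.1)) ⟨b.1, h⟩
      (pathVec K G (σ.vertex b.1) b.2)
  else 0

open Classical in
/-- The coefficient of `vec d b` in an element of the term of degree `d`. -/
def coord (d : ℤ) (b : ι × List (Arrow V)) : σ.Term K d →ₗ[K] K :=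
  if h : b.1 ∈ σ.pos ∧ σ.deg b.1 = d then
    (pathCoord K G (σ.vertex b.1) b.2).comp
      ((DirectSum.component (GentleAlgebra K G) (σ.Place d) (fun k => P K G (σ.vertex k.1))
        ⟨b.1, h⟩).restrictScalars K)
  else 0

variable {K σ}

theorem vec_eq_zero {d : ℤ} {b : ι × List (Arrow V)} (h : ¬ σ.IsBasic d b) :
    σ.vec K d b = 0 := by
  unfold vec
  split_ifs with h1
  · rw [pathVec_eq_zero fun h2 => h ⟨h1, h2⟩, map_zero]
  · rfl

theorem arrowElt_smul_vec (d : ℤ) (j : ι) (p : List (Arrow V)) (a : Arrow V) :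
    arrowElt K G a • σ.vec K d (j, p) = σ.vec K d (j, p ++ [a]) := by
  unfold vec
  split_ifs
  · rw [← map_smul, arrowElt_smul_pathVec]
  · rw [smul_zero]

theorem vertexElt_smul_vec (d : ℤ) (j : ι) (p : List (Arrow V)) :
    vertexElt K G (pathEnd (σ.vertex j) p) • σ.vec K d (j, p) = σ.vec K d (j, p) := by
  unfold vec
  split_ifs
  · rw [← map_smul, vertexElt_smul_pathVec, if_pos rfl]
  · rw [smul_zero]

open Classical in
theorem coord_vec {d : ℤ} {b b' : ι × List (Arrow V)} (hb' : σ.IsBasic d b') :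
    σ.coord K d b (σ.vec K d b') = if b' = b then 1 else 0 := by
  obtain ⟨j, p⟩ := b
  obtain ⟨j', p'⟩ := b'
  unfold coord vec
  rw [dif_pos hb'.place]
  split_ifs with h1 h2 h2
  · cases h2
    rw [LinearMap.comp_apply, LinearMap.restrictScalars_apply, DirectSum.component.lof_self,
      pathCoord_pathVec hb'.path, if_pos rfl]
  · by_cases hj : j' = j
    · subst hj
      rw [LinearMap.comp_apply, LinearMap.restrictScalars_apply, DirectSum.component.lof_self,
        pathCoord_pathVec hb'.path, if_neg]
      rintro rfl
      exact h2 rfl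
    · rw [LinearMap.comp_apply, LinearMap.restrictScalars_apply, DirectSum.component.of, dif_neg,
        map_zero]
      rintro h3
      exact hj (congrArg Subtype.val h3)
  · cases h2
    exact absurd hb'.place h1
  · rfl

theorem mem_span_vec (d : ℤ) (z : σ.Term K d) :
    z ∈ Submodule.span K (Set.range fun b : {b // σ.IsBasic d b} => σ.vec K d b.1) := by
  classical
  induction z using DirectSum.induction_on with
  | zero => exact zero_mem _
  | add x y hx hy => exact add_mem hx hy
  | of i x =>
    have hx := mem_span_pathVec _ x
    change DirectSum.lof (GentleAlgebra K G) (σ.Place d) (fun k => P K G (σ.vertex k.1)) i x ∈ _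
    induction hx using Submodule.span_induction with
    | mem x hx =>
      obtain ⟨p, rfl⟩ := hx
      have : DirectSum.lof (GentleAlgebra K G) (σ.Place d) (fun k => P K G (σ.vertex k.1)) i
          (pathVec K G (σ.vertex i.1) p) = σ.vec K d (i.1, p) := by
        rw [vec, dif_pos i.2]
      rw [this]
      by_cases hb : σ.IsBasic d (i.1, p)
      · exact Submodule.subset_span ⟨⟨_, hb⟩, rfl⟩
      · rw [vec_eq_zero hb]
        exact zero_mem _
    | zero => rw [map_zero]; exact zero_mem _
    | add x y _ _ hx hy => rw [map_add]; exact add_mem hx hy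
    | smul k x _ hx =>
      have h := ((DirectSum.lof (GentleAlgebra K G) (σ.Place d)
        (fun k => P K G (σ.vertex k.1)) i).restrictScalars K).map_smul k x
      rw [LinearMap.restrictScalars_apply, LinearMap.restrictScalars_apply] at h
      rw [h]
      exact Submodule.smul_mem _ k hx

variable (K σ) in
/-- The basis of the term of degree `d` consisting of the paths in its summands. -/
def termBasis (d : ℤ) : Module.Basis {b // σ.IsBasic d b} K (σ.Term K d) :=
  Module.Basis.mk (v := fun b : {b // σ.IsBasic d b} => σ.vec K d b.1)
    (by
      classical
      rw [linearIndependent_iff']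
      intro s g hg b hb
      have := congrArg (σ.coord K d b.1) hg
      rw [map_sum, map_zero, Finset.sum_eq_single b] at this
      · simpa [coord_vec b.2] using this
      · intro b' _ hne
        rw [map_smul, coord_vec b'.2, if_neg fun h => hne (Subtype.ext h), smul_zero]
      · exact fun h => absurd hb h)
    (fun z _ => mem_span_vec d z)

theorem termBasis_apply (d : ℤ) (b : {b // σ.IsBasic d b}) :
    termBasis K σ d b = σ.vec K d b.1 := by simp [termBasis]

open Classical in
theorem component_vec {i j : ι} {q : List (Arrow V)} (hq : G.IsPath (σ.vertex j) (σ.vertex i) q)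
    (t : K) (d : ℤ) (p : List (Arrow V)) :
    σ.component K i j d (t • pathElt K G q) (pathVec K G (σ.vertex i) p) =
      t • σ.vec K d (j, q ++ p) := by
  unfold component vec
  split_ifs with h
  · have : rightMul K G (σ.vertex i) (σ.vertex j) (t • pathElt K G q) (pathVec K G (σ.vertex i) p)
        = t • pathVec K G (σ.vertex j) (q ++ p) := by
      rw [← rightMul_pathVec hq]
      apply Subtype.ext
      simp [rightMul_coe]
    rw [LinearMap.comp_apply, this]
    exact ((DirectSum.lof (GentleAlgebra K G) (σ.Place d)
        (fun k => P K G (σ.vertex k.1)) ⟨j, h⟩).restrictScalars K).map_smul t _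
  · simp

/-- The image of `vec d (j, p)` in the summand at place `j + 1`. -/
def nextVec (c : ι → K) (d : ℤ) (j : ι) (p : List (Arrow V)) : σ.Term K d :=
  match σ.letter j with
  | some (.inverse q) => c j • σ.vec K d (j + 1, q ++ p)
  | _ => 0

/-- The image of `vec d (j, p)` in the summand at place `j - 1`. -/
def prevVec (c : ι → K) (d : ℤ) (j : ι) (p : List (Arrow V)) : σ.Term K d :=
  match σ.letter (j - 1) with
  | some (.direct q) => c (j - 1) • σ.vec K d (j - 1, q ++ p)
  | _ => 0

open Classical in
theorem diff_vec (c : ι → K) {d : ℤ} (d' : ℤ) {j : ι} (hj : j ∈ σ.pos ∧ σ.deg j = d)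
    (p : List (Arrow V)) :
    σ.diff c d d' (σ.vec K d (j, p)) =
      nextVec (σ := σ) c d' j p + prevVec (σ := σ) c d' j p := by
  rw [vec, dif_pos hj, diff_lof]
  refine congrArg₂ (· + ·) ?_ ?_
  · change σ.component K j (j + 1) d' (σ.nextEntry c j) (pathVec K G (σ.vertex j) p) = _
    rcases hl : σ.letter j with _ | q | q
    · simp only [nextEntry, nextVec, hl, component_zero, LinearMap.zero_apply]
    · simp only [nextEntry, nextVec, hl, component_zero, LinearMap.zero_apply]
    · simp only [nextEntry, nextVec, hl]
      exact component_vec (σ.inverse_path _ _ hl) _ _ _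
  · change σ.component K j (j - 1) d' (σ.prevEntry c j) (pathVec K G (σ.vertex j) p) = _
    rcases hl : σ.letter (j - 1) with _ | q | q
    · simp only [prevEntry, prevVec, hl, component_zero, LinearMap.zero_apply]
    · simp only [prevEntry, prevVec, hl]
      have := σ.direct_path _ _ hl
      rw [sub_add_cancel] at this
      exact component_vec this _ _ _
    · simp only [prevEntry, prevVec, hl, component_zero, LinearMap.zero_apply]

end HSequence

end Term

/-! ### Homology from adapted bases -/

section Homology

theorem shortComplex_homology_equiv {R : Type*} [Ring R] (S : ShortComplex (ModuleCat R))
    {M : Type*} [AddCommGroup M] [Module R M] (φ : M →ₗ[R] S.X₂ ⧸ LinearMap.range S.f.hom)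
    (hinj : Function.Injective φ)
    (hrange : LinearMap.range φ = Submodule.map (Submodule.mkQ _) (LinearMap.ker S.g.hom)) :
    Nonempty (S.homology ≃ₗ[R] M) := by
  let ψ : LinearMap.ker S.g.hom →ₗ[R] S.X₂ ⧸ LinearMap.range S.f.hom :=
    (LinearMap.range S.f.hom).mkQ.comp (LinearMap.ker S.g.hom).subtype
  have hψ : LinearMap.range ψ = LinearMap.range φ := by
    rw [LinearMap.range_comp, Submodule.range_subtype, hrange]
  have hker : LinearMap.range S.moduleCatToCycles = LinearMap.ker ψ := by
    ext z
    rw [LinearMap.mem_ker]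
    change _ ↔ Submodule.Quotient.mk z.1 = (0 : S.X₂ ⧸ LinearMap.range S.f.hom)
    rw [Submodule.Quotient.mk_eq_zero]
    constructor
    · rintro ⟨y, rfl⟩
      exact ⟨y, rfl⟩
    · rintro ⟨y, hy⟩
      exact ⟨y, Subtype.ext hy⟩
  let e3 : (LinearMap.ker S.g.hom ⧸ LinearMap.range S.moduleCatToCycles) ≃ₗ[R] M :=
    (Submodule.quotEquivOfEq _ _ hker).trans (ψ.quotKerEquivRange.trans
      ((LinearEquiv.ofEq _ _ hψ).trans (LinearEquiv.ofInjective φ hinj).symm))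
  have e2 : S.homology ≃ₗ[R] (LinearMap.ker S.g.hom ⧸ LinearMap.range S.moduleCatToCycles) :=
    S.moduleCatHomologyIso.toLinearEquiv
  exact ⟨e2.trans e3⟩

variable {K : Type u} [Field K] [Fintype V] {G : GentleQuiver V} {ι : Type} [CommRing ι]

namespace HSequence

variable {σ : HSequence G ι} {c : ι → K}

/-- The cokernel of the differential into degree `d`, which contains the cohomology in degree
`d`. -/
abbrev Coker (σ : HSequence G ι) (c : ι → K) (d : ℤ) :=
  σ.Term K d ⧸ LinearMap.range (σ.diff c (d - 1) d)

theorem homology_equiv_of_range_eq {d : ℤ} {M : Type*} [AddCommGroup M]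
    [Module (GentleAlgebra K G) M] (φ : M →ₗ[GentleAlgebra K G] σ.Coker c d)
    (hinj : Function.Injective φ)
    (hrange : LinearMap.range φ = Submodule.map (Submodule.mkQ _)
      (LinearMap.ker (σ.diff c d (d + 1)))) :
    Nonempty ((σ.complex c).homology d ≃ₗ[GentleAlgebra K G] M) := by
  have e1 : (σ.complex c).homology d ≅ ((σ.complex c).sc' (d - 1) d (d + 1)).homology :=
    ShortComplex.homologyMapIso ((σ.complex c).isoSc' (d - 1) d (d + 1) (by simp) (by simp))
  obtain ⟨e2⟩ := shortComplex_homology_equiv ((σ.complex c).sc' (d - 1) d (d + 1)) φ hinj hrange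
  exact ⟨e1.toLinearEquiv.trans e2⟩

/-- A module `M` with a basis indexed by `N` is the cohomology in degree `d` if it maps to the
cokernel of the differential such that the basis vector `n` goes to a nonzero multiple of the class
of the path `pos n`, and these paths are cocycles, are independent modulo coboundaries, and every
other path is in their span modulo coboundaries or can be detected by its differential. -/
theorem homology_equiv_of_basis {d : ℤ} {N M : Type*} [AddCommGroup M] [Module K M]
    [Module (GentleAlgebra K G) M] [IsScalarTower K (GentleAlgebra K G) M]
    (Z : Module.Basis N K M) (φ : M →ₗ[GentleAlgebra K G] σ.Coker c d)
    (pos : N → ι × List (Arrow V)) (ε : N → K) (hε : ∀ n, ε n ≠ 0)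
    (hφ : ∀ n, φ (Z n) = Submodule.Quotient.mk (ε n • σ.vec K d (pos n)))
    (hker : ∀ n, σ.diff c d (d + 1) (σ.vec K d (pos n)) = 0)
    (hψ : ∀ n, ∃ ψ : σ.Term K d →ₗ[K] K, (∀ z, ψ (σ.diff c (d - 1) d z) = 0) ∧
      ψ (σ.vec K d (pos n)) ≠ 0 ∧ ∀ n', n' ≠ n → ψ (σ.vec K d (pos n')) = 0)
    (htri : ∀ b, σ.IsBasic d b →
      (∃ m, φ m = Submodule.Quotient.mk (σ.vec K d b)) ∨
      ∃ f : σ.Term K (d + 1) →ₗ[K] K, f (σ.diff c d (d + 1) (σ.vec K d b)) ≠ 0 ∧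
        ∀ b', σ.IsBasic d b' → b' ≠ b → f (σ.diff c d (d + 1) (σ.vec K d b')) = 0) :
    Nonempty ((σ.complex c).homology d ≃ₗ[GentleAlgebra K G] M) := by
  have hφ' : ∀ m, φ m = Submodule.Quotient.mk
      ((Z.repr m).sum fun n k => k • ε n • σ.vec K d (pos n)) := by
    intro m
    conv_lhs => rw [← Z.linearCombination_repr m, Finsupp.linearCombination_apply, Finsupp.sum,
      map_sum]
    rw [Finsupp.sum, ← Submodule.mkQ_apply, map_sum]
    refine Finset.sum_congr rfl fun n _ => ?_
    rw [← LinearMap.coe_restrictScalars K φ, map_smul, LinearMap.coe_restrictScalars, hφ]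
    rfl
  apply homology_equiv_of_range_eq φ
  · -- the functionals `ψ` read off the coefficients
    rw [injective_iff_map_eq_zero]
    intro m hm
    rw [hφ', Submodule.Quotient.mk_eq_zero] at hm
    obtain ⟨z, hz⟩ := hm
    apply Z.repr.injective
    rw [map_zero]
    ext n
    obtain ⟨ψ, h0, h1, h2⟩ := hψ n
    have h3 := h0 z
    rw [hz, Finsupp.sum, map_sum, Finset.sum_eq_single n] at h3
    · simpa [h1, hε n] using h3
    · intro n' _ hn'
      rw [map_smul, map_smul, h2 n' hn', smul_zero, smul_zero]
    · intro h
      rw [Finsupp.notMem_support_iff.mp h, zero_smul, map_zero]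
  · apply le_antisymm
    · rintro _ ⟨m, rfl⟩
      rw [hφ']
      refine ⟨_, ?_, rfl⟩
      rw [SetLike.mem_coe, LinearMap.mem_ker, Finsupp.sum, map_sum]
      refine Finset.sum_eq_zero fun n _ => ?_
      rw [← LinearMap.coe_restrictScalars K (σ.diff c d (d + 1)), map_smul, map_smul,
        LinearMap.coe_restrictScalars, hker, smul_zero, smul_zero]
    · rintro _ ⟨z, hz, rfl⟩
      rw [SetLike.mem_coe, LinearMap.mem_ker] at hz
      -- the paths that occur in a cocycle are not detected, so they lie in the range modulo
      -- coboundaries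
      set D : σ.Term K d →ₗ[K] σ.Term K (d + 1) :=
        (σ.diff c d (d + 1)).restrictScalars K with hD
      have hsum : z = ((termBasis K σ d).repr z).sum fun b k => k • σ.vec K d b.1 := by
        conv_lhs => rw [← (termBasis K σ d).linearCombination_repr z,
          Finsupp.linearCombination_apply]
        simp only [termBasis_apply]
      rw [hsum, Finsupp.sum, map_sum]
      refine Submodule.sum_mem _ fun b _ => ?_
      rcases htri b.1 b.2 with ⟨m, hm⟩ | ⟨f, hf1, hf2⟩
      · refine ⟨((termBasis K σ d).repr z b) • m, ?_⟩
        rw [← LinearMap.coe_restrictScalars K φ, map_smul, LinearMap.coe_restrictScalars, hm]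
        rfl
      · have h3 : f (D z) = 0 := by
          rw [hD, LinearMap.restrictScalars_apply, hz, map_zero]
        rw [hsum, Finsupp.sum, map_sum, map_sum, Finset.sum_eq_single b] at h3
        · rw [map_smul, map_smul] at h3
          have h4 : (termBasis K σ d).repr z b = 0 := by
            rcases smul_eq_zero.mp h3 with h | h
            · exact h
            · exact absurd h hf1
          rw [h4, zero_smul, map_zero]
          exact zero_mem _
        · intro b' _ hb'
          rw [map_smul, map_smul]
          have := hf2 b'.1 b'.2 fun h => hb' (Subtype.ext h)
          rw [hD, LinearMap.restrictScalars_apply, this, smul_zero]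
        · intro h
          rw [Finsupp.notMem_support_iff.mp h, zero_smul, map_zero, map_zero]

end HSequence

end Homology

/-! ### Homomorphisms from string and band modules -/

section Modules

variable {K : Type u} [Field K] [Fintype V] {G : GentleQuiver V}

namespace Schema

variable {J N : Type} [Fintype J] [DecidableEq J] [Fintype N] (S : Schema K G J N)

instance : Module K S.module := inferInstanceAs (Module K (J → K))

instance : IsScalarTower K (GentleAlgebra K G) S.module where
  smul_assoc k r m := by
    exact LinearMap.congr_fun (map_smul S.action k r) (show J → K from m)

/-- The basis vectors of the module given by the combinatorial data. -/
def basis : Module.Basis J K S.module := Pi.basisFun K J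

theorem action_vertexElt (x : V) :
    S.action (vertexElt K G x) = Matrix.toLin' (S.vertexMatrix x) := by
  change Matrix.toLin' (RingQuot.liftAlgHom K _ _) = _
  congr 1
  refine (RingQuot.liftAlgHom_mkAlgHom_apply ..).trans ?_
  simp

theorem action_arrowElt (a : Arrow V) :
    S.action (arrowElt K G a) = Matrix.toLin' (S.arrowMatrix a) := by
  change Matrix.toLin' (RingQuot.liftAlgHom K _ _) = _
  congr 1
  refine (RingQuot.liftAlgHom_mkAlgHom_apply ..).trans ?_
  simp

theorem basis_apply (j : J) : S.basis j = (show S.module from (Pi.single j 1 : J → K)) :=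
  Pi.basisFun_apply K J j

open Classical in
theorem action_vertexElt_single (x : V) (j : J) :
    S.action (vertexElt K G x) (Pi.single j 1) =
      if S.vertex j = x then (Pi.single j 1 : J → K) else 0 := by
  rw [action_vertexElt, Matrix.toLin'_apply, Matrix.mulVec_single_one]
  ext i
  change S.vertexMatrix x i j = _
  rw [vertexMatrix, Matrix.diagonal_apply]
  by_cases hij : i = j
  · subst hij
    split_ifs <;> simp_all
  · rw [if_neg hij]
    split_ifs <;> simp [hij]

open Classical in
theorem action_arrowElt_single (a : Arrow V) (i : J) :
    S.action (arrowElt K G a) (Pi.single i 1) =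
      ∑ k, if S.arrow k = a ∧ S.tail k = i then
        S.coef k • (Pi.single (S.head k) 1 : J → K) else 0 := by
  rw [action_arrowElt, Matrix.toLin'_apply, Matrix.mulVec_single_one]
  ext j
  rw [Finset.sum_apply]
  change S.arrowMatrix a j i = _
  rw [arrowMatrix, Matrix.of_apply]
  refine Finset.sum_congr rfl fun k _ => ?_
  by_cases h1 : S.arrow k = a ∧ S.tail k = i
  · rw [if_pos h1, Pi.smul_apply, Pi.single_apply]
    by_cases h2 : S.head k = j
    · rw [if_pos ⟨h1.1, h1.2, h2⟩, if_pos h2.symm, smul_eq_mul, mul_one]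
    · rw [if_neg fun h3 => h2 h3.2.2, if_neg (Ne.symm h2), smul_zero]
  · rw [if_neg h1, if_neg fun h3 => h1 ⟨h3.1, h3.2.1⟩]
    rfl

open Classical in
theorem vertexElt_smul_basis (x : V) (j : J) :
    vertexElt K G x • S.basis j = if S.vertex j = x then S.basis j else 0 := by
  rw [basis_apply]
  exact S.action_vertexElt_single x j

open Classical in
theorem arrowElt_smul_basis (a : Arrow V) (i : J) :
    arrowElt K G a • S.basis i =
      ∑ k, if S.arrow k = a ∧ S.tail k = i then S.coef k • S.basis (S.head k) else 0 := by
  simp only [basis_apply]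
  exact S.action_arrowElt_single a i

variable {X : Type*} [AddCommGroup X] [Module K X] [Module (GentleAlgebra K G) X]
  [IsScalarTower K (GentleAlgebra K G) X]

/-- Elements of a module at the right vertices, on which the arrows act as on the basis vectors,
define a homomorphism, provided that each arrow maps every basis vector to a multiple of a basis
vector. -/
theorem exists_hom (x : J → X) (hv : ∀ j, vertexElt K G (S.vertex j) • x j = x j)
    (hedge : ∀ k, arrowElt K G (S.arrow k) • x (S.tail k) = S.coef k • x (S.head k))
    (hzero : ∀ a i, arrowElt K G a • x i ≠ 0 → ∃ k, S.arrow k = a ∧ S.tail k = i)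
    (huniq : ∀ k k', S.arrow k = S.arrow k' → S.tail k = S.tail k' → k = k') :
    ∃ φ : S.module →ₗ[GentleAlgebra K G] X, ∀ j, φ (S.basis j) = x j := by
  classical
  let φ : S.module →ₗ[K] X := S.basis.constr K x
  have hφ : ∀ j, φ (S.basis j) = x j := S.basis.constr_basis K x
  -- linearity over the algebra is checked on the vertices and the arrows
  have key : ∀ (r : GentleAlgebra K G) (m : S.module), φ (r • m) = r • φ m := by
    intro r
    have red : ∀ r : GentleAlgebra K G, (∀ j, φ (r • S.basis j) = r • x j) →
        ∀ m, φ (r • m) = r • φ m := by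
      intro r hr m
      have : φ.comp (Module.toModuleEnd K (S := GentleAlgebra K G) S.module r) =
          (Module.toModuleEnd K (S := GentleAlgebra K G) X r).comp φ := by
        refine S.basis.ext fun j => ?_
        change φ (r • S.basis j) = r • φ (S.basis j)
        rw [hr, hφ]
      exact LinearMap.congr_fun this m
    obtain ⟨r, rfl⟩ := RingQuot.mkAlgHom_surjective K (BoundRel K G) r
    change ∀ m, φ (toGentleAlgebra K G r • m) = toGentleAlgebra K G r • φ m
    induction r using FreeAlgebra.induction with
    | grade0 k =>
      intro m
      rw [AlgHom.commutes, algebraMap_smul, algebraMap_smul, map_smul]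
    | grade1 i =>
      cases i with
      | inl y =>
        refine red _ fun j => ?_
        change φ (vertexElt K G y • S.basis j) = vertexElt K G y • x j
        rw [vertexElt_smul_basis]
        split_ifs with h
        · rw [hφ, ← h, hv]
        · rw [map_zero, ← hv j, ← mul_smul, vertexElt_mul_of_ne (Ne.symm h), zero_smul]
      | inr a =>
        refine red _ fun i => ?_
        change φ (arrowElt K G a • S.basis i) = arrowElt K G a • x i
        rw [arrowElt_smul_basis, map_sum]
        by_cases hk : ∃ k, S.arrow k = a ∧ S.tail k = i
        · obtain ⟨k, rfl, rfl⟩ := hk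
          rw [Finset.sum_eq_single k, if_pos ⟨rfl, rfl⟩, map_smul, hφ, hedge]
          · intro k' _ hk'
            rw [if_neg fun h => hk' (huniq _ _ h.1 h.2), map_zero]
          · exact fun h => absurd (Finset.mem_univ k) h
        · rw [Finset.sum_eq_zero]
          · by_contra h
            exact hk (hzero a i (Ne.symm h))
          · intro k _
            rw [if_neg fun h => hk ⟨k, h⟩, map_zero]
    | mul r s hr hs =>
      intro m
      rw [map_mul, mul_smul, mul_smul, hr, hs]
    | add r s hr hs =>
      intro m
      rw [map_add, add_smul, add_smul, map_add, hr, hs]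
  exact ⟨{ φ with map_smul' := key }, hφ⟩

end Schema

end Modules

/-! ### Completing a homotopy string by the legs at its ends -/

/-- The arrows starting at `x` are the first arrows of `r` and of `q`, and these differ. -/
def IsValley (x : V) (r q : List (Arrow V)) : Prop :=
  (∀ c : Arrow V, c.left = x → r.head? = some c ∨ q.head? = some c) ∧
    ∀ c : Arrow V, r.head? = some c → q.head? ≠ some c

theorem IsValley.symm {x : V} {r q : List (Arrow V)} (h : IsValley x r q) : IsValley x q r :=
  ⟨fun c hc => (h.1 c hc).symm, fun c hc hr => h.2 c hr hc⟩

theorem IsValley.false_of_head {x : V} {r q p : List (Arrow V)} (h : IsValley x r q)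
    (hr : p.head? = r.head?) (hq : p.head? = q.head?) (hp : p ≠ []) : False := by
  obtain ⟨a, ha⟩ := Option.ne_none_iff_exists'.mp (mt List.head?_eq_none_iff.mp hp)
  exact h.2 a (hr ▸ ha) (hq ▸ ha)

namespace GentleQuiver

variable (G : GentleQuiver V)

/-- The path `p` cannot be prolonged at its end (the trivial path has this property by
convention). -/
def IsTerminal (p : List (Arrow V)) : Prop :=
  ∀ a, p.getLast? = some a → ∀ d : Arrow V, a.right = d.left → G.rel d a

theorem exists_maximalPath (c : Arrow V) : ∃ p, G.IsMaximalPath c p := by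
  by_contra! hno
  obtain ⟨m, hm⟩ := G.bounded
  have key : ∀ n : ℕ, ∃ p : List (Arrow V), p.head? = some c ∧
      p.IsChain (fun a b => a.right = b.left ∧ ¬ G.rel b a) ∧ p.length = n + 1 := by
    intro n
    induction n with
    | zero => exact ⟨[c], rfl, by simp, rfl⟩
    | succ n ih =>
      obtain ⟨p, h1, h2, h3⟩ := ih
      have h4 : ¬ ∀ a, p.getLast? = some a → ∀ d : Arrow V, a.right = d.left → G.rel d a :=
        fun h => hno p ⟨h1, h2, h⟩
      push Not at h4
      obtain ⟨a, ha, d, had, hr⟩ := h4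
      refine ⟨p ++ [d], by rw [List.head?_append, h1]; rfl,
        List.isChain_append.mpr ⟨h2, by simp, ?_⟩, by simp [h3]⟩
      intro x hx y hy
      rw [ha, Option.mem_some_iff] at hx
      simp only [List.head?_cons, Option.mem_some_iff] at hy
      subst hx hy
      exact ⟨had, hr⟩
  obtain ⟨p, -, h2, h3⟩ := key m
  have := hm p h2
  omega

variable {G}

theorem exists_terminal (x : V) (o : Option (Arrow V)) (ho : ∀ c, o = some c → c.left = x) :
    ∃ q, G.IsPathFrom x q ∧ G.IsTerminal q ∧ q.head? = o := by
  cases o with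
  | none => exact ⟨[], G.isPathFrom_nil x, by simp [IsTerminal], rfl⟩
  | some c =>
    obtain ⟨q, hq⟩ := G.exists_maximalPath c
    refine ⟨q, ⟨fun a ha => ?_, hq.chain⟩, hq.maximal, hq.head⟩
    rw [hq.head] at ha
    cases ha
    exact ho _ rfl

/-- Two paths that cannot be prolonged agree if they have the same first arrow. -/
theorem eq_of_terminal {p q : List (Arrow V)}
    (hp : p.IsChain (fun a b => a.right = b.left ∧ ¬ G.rel b a))
    (hq : q.IsChain (fun a b => a.right = b.left ∧ ¬ G.rel b a))
    (tp : G.IsTerminal p) (tq : G.IsTerminal q) (h : p.head? = q.head?) : p = q := by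
  have key : ∀ p r : List (Arrow V), G.IsTerminal p → p ≠ [] →
      (p ++ r).IsChain (fun a b => a.right = b.left ∧ ¬ G.rel b a) → r = [] := by
    intro p r tp hp hc
    cases r with
    | nil => rfl
    | cons b r =>
      obtain ⟨a, ha⟩ := Option.ne_none_iff_exists'.mp (mt List.getLast?_eq_none_iff.mp hp)
      have := (List.isChain_append.mp hc).2.2 a ha b rfl
      exact absurd (tp a ha b this.1) this.2
  by_cases h0 : p = []
  · subst h0
    exact (List.head?_eq_none_iff.mp h.symm).symm
  have h1 : q ≠ [] := by
    rintro rfl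
    exact h0 (List.head?_eq_none_iff.mp h)
  rcases G.prefix_or_prefix hp hq h with ⟨r, rfl⟩ | ⟨r, rfl⟩
  · rw [key p r tp h0 hq, List.append_nil]
  · rw [key q r tq h1 hp, List.append_nil]

variable (G)

/-- The first arrow of `q` is the arrow `c` that forms a relation with the last arrow of `p`, and
`q` is trivial if there is no such `c`. -/
def IsPass (p q : List (Arrow V)) : Prop :=
  ∃ b, p.getLast? = some b ∧ ∀ c, G.rel c b ↔ q.head? = some c

/-- The condition on two consecutive homotopy letters `B A` which meet at the vertex `x`, where `A`
and `B` may be virtual letters given by the legs of a projective at an end of a homotopy string. -/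
def Meet (x : V) : HLetter V → HLetter V → Prop
  | .inverse r, .direct q => IsValley x r q
  | .direct p, .direct q => G.IsPass p q
  | .inverse q, .inverse p => G.IsPass p q
  | .direct p, .inverse q => p.getLast? ≠ q.getLast?

variable {G}

theorem isValley_of_ne (G : GentleQuiver V) {x : V} {a b : Arrow V} (ha : a.left = x)
    (hb : b.left = x) (hab : a ≠ b) {r q : List (Arrow V)} (hr : r.head? = some a) (hq : q.head? = some b) :
    IsValley x r q := by
  refine ⟨fun c hc => ?_, fun c h1 h2 => hab ?_⟩
  · rw [hr, hq]
    by_contra! h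
    have h3 : ({a, b, c} : Set (Arrow V)).encard = 3 :=
      Set.encard_eq_three.mpr ⟨a, b, c, hab, fun e => h.1 (congrArg some e),
        fun e => h.2 (congrArg some e), rfl⟩
    have h4 : ({a, b, c} : Set (Arrow V)) ⊆ {a | a.left = x} := by
      rintro y (rfl | rfl | rfl)
      exacts [ha, hb, hc]
    have := (Set.encard_le_encard h4).trans (G.card_out x)
    rw [h3] at this
    exact absurd this (by decide)
  · rw [hr] at h1
    rw [hq] at h2
    exact Option.some.inj (h1.trans h2.symm)

/-- Given a path `p` starting at `x`, there is a leg of `P(x)` with a different first arrow. -/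
theorem exists_otherLeg (x : V) (p : List (Arrow V)) (hp : G.IsPathFrom x p) (hne : p ≠ []) :
    ∃ q, G.IsPathFrom x q ∧ G.IsTerminal q ∧ IsValley x q p := by
  obtain ⟨a, ha⟩ := Option.ne_none_iff_exists'.mp (mt List.head?_eq_none_iff.mp hne)
  by_cases h : ∃ b : Arrow V, b.left = x ∧ b ≠ a
  · obtain ⟨b, hb, hba⟩ := h
    obtain ⟨q, h1, h2, h3⟩ := exists_terminal (G := G) x (some b) (by rintro _ ⟨⟩; exact hb)
    exact ⟨q, h1, h2, G.isValley_of_ne hb (hp.source a ha) hba h3 ha⟩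
  · push Not at h
    exact ⟨[], G.isPathFrom_nil x, by simp [IsTerminal],
      fun c hc => Or.inr (by rw [ha, h c hc]), by simp⟩

theorem exists_legs (x : V) : ∃ r q, G.IsPathFrom x r ∧ G.IsTerminal r ∧ G.IsPathFrom x q ∧
    G.IsTerminal q ∧ IsValley x r q := by
  by_cases h : ∃ a : Arrow V, a.left = x
  · obtain ⟨a, ha⟩ := h
    obtain ⟨q, h1, h2, h3⟩ := exists_terminal (G := G) x (some a) (by rintro _ ⟨⟩; exact ha)
    obtain ⟨r, h4, h5, h6⟩ := exists_otherLeg x q h1 (by rintro rfl; simp at h3)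
    exact ⟨r, q, h4, h5, h1, h2, h6⟩
  · push Not at h
    exact ⟨[], [], G.isPathFrom_nil x, by simp [IsTerminal], G.isPathFrom_nil x,
      by simp [IsTerminal], fun c hc => absurd hc (h c), by simp⟩

theorem exists_kernelLeg {x y : V} (p : List (Arrow V)) (hp : G.IsPath x y p) :
    ∃ q, G.IsPathFrom y q ∧ G.IsTerminal q ∧ G.IsPass p q := by
  obtain ⟨b, hb⟩ := Option.ne_none_iff_exists'.mp (mt List.getLast?_eq_none_iff.mp hp.ne_nil)
  have hby : b.right = y := by simpa [hb] using hp.target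
  by_cases h : ∃ c, G.rel c b
  · obtain ⟨c, hc⟩ := h
    obtain ⟨q, h1, h2, h3⟩ := exists_terminal (G := G) y (some c)
      (by rintro _ ⟨⟩; rw [← hby]; exact (G.rel_comp hc).symm)
    refine ⟨q, h1, h2, b, hb, fun c' => ?_⟩
    rw [h3, Option.some.injEq]
    exact ⟨fun h => G.rel_after b hc h, fun h => h ▸ hc⟩
  · push Not at h
    exact ⟨[], G.isPathFrom_nil y, by simp [IsTerminal], b, hb, fun c => by simp [h c]⟩

theorem isPass_of_rel {p q : List (Arrow V)} {a b : Arrow V} (ha : p.getLast? = some a)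
    (hb : q.head? = some b) (h : G.rel b a) : G.IsPass p q :=
  ⟨a, ha, fun c => by
    rw [hb, Option.some.injEq]
    exact ⟨fun h' => G.rel_after a h h', fun h' => h' ▸ h⟩⟩

end GentleQuiver

namespace HSequence

variable {G : GentleQuiver V} {ι : Type} [CommRing ι]

/-- A completion of `σ` puts virtual homotopy letters before and after the places where `σ` ends: at
the right end an inverse letter and at the left end a direct one, in both cases given by a path
starting at the place and prolonged as far as possible. It is the leg of the projective there
which the cokernel, combined and kernel rules add to `σ`. The letter is irrelevant at indices
that do not touch a place of `σ`. -/
structure Completion (σ : HSequence G ι) where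
  L : ι → HLetter V
  eq_of_letter : ∀ i x, σ.letter i = some x → L i = x
  left_end : ∀ i, i ∈ σ.pos → i + 1 ∉ σ.pos → ∃ q, L i = .direct q ∧
    G.IsPathFrom (σ.vertex i) q ∧ G.IsTerminal q
  right_end : ∀ i, i ∉ σ.pos → i + 1 ∈ σ.pos → ∃ q, L i = .inverse q ∧
    G.IsPathFrom (σ.vertex (i + 1)) q ∧ G.IsTerminal q
  meet : ∀ i, i + 1 ∈ σ.pos → G.Meet (σ.vertex (i + 1)) (L i) (L (i + 1))

variable (σ : HSequence G ι)

/-- The letters that meet at the place `i + 1`, where an absent letter is replaced by a leg. -/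
theorem exists_meet (i : ι) : ∃ A B : HLetter V,
    (∀ x, σ.letter i = some x → A = x) ∧ (∀ x, σ.letter (i + 1) = some x → B = x) ∧
    (σ.letter i = none → ∃ q, A = .inverse q ∧ G.IsPathFrom (σ.vertex (i + 1)) q ∧
      G.IsTerminal q) ∧
    (σ.letter (i + 1) = none → ∃ q, B = .direct q ∧ G.IsPathFrom (σ.vertex (i + 1)) q ∧
      G.IsTerminal q) ∧ G.Meet (σ.vertex (i + 1)) A B := by
  rcases hA : σ.letter i with _ | A
  · rcases hB : σ.letter (i + 1) with _ | p | p
    · obtain ⟨r, q, h1, h2, h3, h4, h5⟩ := GentleQuiver.exists_legs (G := G) (σ.vertex (i + 1))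
      exact ⟨.inverse r, .direct q, by simp, by simp, fun _ => ⟨r, rfl, h1, h2⟩,
        fun _ => ⟨q, rfl, h3, h4⟩, h5⟩
    · have hp := σ.direct_path _ _ hB
      obtain ⟨q, h1, h2, h3⟩ := GentleQuiver.exists_otherLeg _ p hp.isPathFrom hp.ne_nil
      exact ⟨.inverse q, .direct p, by simp, by simp, fun _ => ⟨q, rfl, h1, h2⟩, by simp, h3⟩
    · obtain ⟨q, h1, h2, h3⟩ := GentleQuiver.exists_kernelLeg p (σ.inverse_path _ _ hB)
      exact ⟨.inverse q, .inverse p, by simp, by simp, fun _ => ⟨q, rfl, h1, h2⟩, by simp, h3⟩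
  · rcases hB : σ.letter (i + 1) with _ | B
    · rcases A with p | p
      · obtain ⟨q, h1, h2, h3⟩ := GentleQuiver.exists_kernelLeg p (σ.direct_path _ _ hA)
        exact ⟨.direct p, .direct q, by simp, by simp, by simp, fun _ => ⟨q, rfl, h1, h2⟩, h3⟩
      · have hp := σ.inverse_path _ _ hA
        obtain ⟨q, h1, h2, h3⟩ := GentleQuiver.exists_otherLeg _ p hp.isPathFrom hp.ne_nil
        exact ⟨.inverse p, .direct q, by simp, by simp, by simp, fun _ => ⟨q, rfl, h1, h2⟩,
          h3.symm⟩
    · refine ⟨A, B, by simp, by simp, by simp, by simp, ?_⟩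
      have hm := σ.mayFollow i A B hA hB
      rcases A with p | p <;> rcases B with q | q
      · obtain ⟨a, b, ha, hb, hr⟩ := hm
        exact GentleQuiver.isPass_of_rel ha hb hr
      · exact hm
      · have hp := σ.inverse_path _ _ hA
        have hq := σ.direct_path _ _ hB
        obtain ⟨a, ha⟩ := Option.ne_none_iff_exists'.mp (mt List.head?_eq_none_iff.mp hp.ne_nil)
        obtain ⟨b, hb⟩ := Option.ne_none_iff_exists'.mp (mt List.head?_eq_none_iff.mp hq.ne_nil)
        refine G.isValley_of_ne (hp.isPathFrom.source a ha) (hq.isPathFrom.source b hb)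
          ?_ ha hb
        rintro rfl
        exact hm (ha.trans hb.symm)
      · obtain ⟨a, b, ha, hb, hr⟩ := hm
        exact GentleQuiver.isPass_of_rel ha hb hr

theorem letter_eq_none_iff (i : ι) : σ.letter i = none ↔ ¬ (i ∈ σ.pos ∧ i + 1 ∈ σ.pos) := by
  rw [← σ.letter_isSome, Option.not_isSome_iff_eq_none]

theorem exists_completion : Nonempty σ.Completion := by
  classical
  choose A B h1 h2 h3 h4 h5 using σ.exists_meet
  let L : ι → HLetter V := fun i =>
    (σ.letter i).getD (if i ∈ σ.pos then B (i - 1) else A i)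
  have hL : ∀ i x, σ.letter i = some x → L i = x := fun i x h => by simp [L, h]
  have hLA : ∀ i, i + 1 ∈ σ.pos → L i = A i := by
    intro i hi
    rcases hl : σ.letter i with _ | x
    · have hi' : i ∉ σ.pos := fun h => (σ.letter_eq_none_iff i).mp hl ⟨h, hi⟩
      simp [L, hl, hi']
    · rw [hL i x hl, h1 i x hl]
  have hLB : ∀ i, i + 1 ∈ σ.pos → L (i + 1) = B i := by
    intro i hi
    rcases hl : σ.letter (i + 1) with _ | x
    · simp [L, hl, hi]
    · rw [hL _ x hl, h2 i x hl]
  refine ⟨⟨L, hL, fun i hi hi' => ?_, fun i hi hi' => ?_, fun i hi => ?_⟩⟩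
  · have hi2 : i - 1 + 1 ∈ σ.pos := by rwa [sub_add_cancel]
    have := h4 (i - 1)
    rw [← hLB (i - 1) hi2, sub_add_cancel] at this
    exact this ((σ.letter_eq_none_iff i).mpr fun h => hi' h.2)
  · rw [hLA i hi']
    exact h3 i ((σ.letter_eq_none_iff i).mpr fun h => hi h.1)
  · rw [hLA i hi, hLB i hi]
    exact h5 i

end HSequence

/-! ### The paths that represent cohomology classes -/

section Critical

namespace HSequence

variable {G : GentleQuiver V} {ι : Type} [CommRing ι] {σ : HSequence G ι}

namespace Completion

variable (E : σ.Completion)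

theorem meet' {j : ι} (hj : j ∈ σ.pos) : G.Meet (σ.vertex j) (E.L (j - 1)) (E.L j) := by
  have := E.meet (j - 1)
  rw [sub_add_cancel] at this
  exact this hj

variable {E}

theorem letter_of_direct {i : ι} {q : List (Arrow V)} (h : E.L i = .direct q)
    (hi : i + 1 ∈ σ.pos) : σ.letter i = some (.direct q) := by
  rcases hl : σ.letter i with _ | x
  · have hi' : i ∉ σ.pos := fun h => (σ.letter_eq_none_iff i).mp hl ⟨h, hi⟩
    obtain ⟨r, hr, -⟩ := E.right_end i hi' hi
    rw [h] at hr
    cases hr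
  · rw [← h, E.eq_of_letter i x hl]

theorem letter_of_inverse {i : ι} {q : List (Arrow V)} (h : E.L i = .inverse q)
    (hi : i ∈ σ.pos) : σ.letter i = some (.inverse q) := by
  rcases hl : σ.letter i with _ | x
  · have hi' : i + 1 ∉ σ.pos := fun h => (σ.letter_eq_none_iff i).mp hl ⟨hi, h⟩
    obtain ⟨r, hr, -⟩ := E.left_end i hi hi'
    rw [h] at hr
    cases hr
  · rw [← h, E.eq_of_letter i x hl]

theorem pos_of_letter {i : ι} {x : HLetter V} (h : σ.letter i = some x) :
    i ∈ σ.pos ∧ i + 1 ∈ σ.pos := (σ.letter_isSome i).mp (by rw [h]; rfl)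

theorem path_direct {i : ι} {q : List (Arrow V)} (h : E.L i = .direct q) (hi : i ∈ σ.pos) :
    G.IsPathFrom (σ.vertex i) q := by
  by_cases hi' : i + 1 ∈ σ.pos
  · exact (σ.direct_path _ _ (letter_of_direct h hi')).isPathFrom
  · obtain ⟨r, hr, hp, -⟩ := E.left_end i hi hi'
    rw [h] at hr
    cases hr
    exact hp

theorem path_inverse {i : ι} {q : List (Arrow V)} (h : E.L i = .inverse q)
    (hi : i + 1 ∈ σ.pos) : G.IsPathFrom (σ.vertex (i + 1)) q := by
  by_cases hi' : i ∈ σ.pos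
  · exact (σ.inverse_path _ _ (letter_of_inverse h hi')).isPathFrom
  · obtain ⟨r, hr, hp, -⟩ := E.right_end i hi' hi
    rw [h] at hr
    cases hr
    exact hp

theorem terminal_direct {i : ι} {q : List (Arrow V)} (h : E.L i = .direct q) (hi : i ∈ σ.pos)
    (hi' : i + 1 ∉ σ.pos) : G.IsTerminal q := by
  obtain ⟨r, hr, -, ht⟩ := E.left_end i hi hi'
  rw [h] at hr
  cases hr
  exact ht

theorem terminal_inverse {i : ι} {q : List (Arrow V)} (h : E.L i = .inverse q) (hi : i ∉ σ.pos)
    (hi' : i + 1 ∈ σ.pos) : G.IsTerminal q := by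
  obtain ⟨r, hr, -, ht⟩ := E.right_end i hi hi'
  rw [h] at hr
  cases hr
  exact ht

variable (E)

/-- The homotopy letter with index `i` of the completed sequence carries the basis vector
`b = (j, p)`, for those basis vectors whose classes form a basis of the cohomology. For a letter given
by a path `q`, these are initial pieces `p` of `q` in the summand to which the differential maps (or
would map). The path `q` itself is a coboundary unless another letter has the same source (and then it is
attributed to the direct one of the two letters), or the letter is virtual. The trivial path is
attributed to an inverse letter followed by a direct one, and it is not a cocycle at other
places. -/
def Owns (i : ι) (b : ι × List (Arrow V)) : Prop :=
  (b.1 = i ∧ i ∈ σ.pos ∧ ∃ q, E.L i = .direct q ∧ b.2 ≠ [] ∧ b.2 <+: q ∧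
      (b.2 = q → i + 1 ∈ σ.pos → ∃ p, E.L (i + 1) = .inverse p)) ∨
  (b.1 = i + 1 ∧ i + 1 ∈ σ.pos ∧ ∃ r, E.L i = .inverse r ∧ b.2 <+: r ∧
      (b.2 = r → i ∉ σ.pos) ∧ (b.2 = [] → ∃ q, E.L (i + 1) = .direct q))

variable {E}

theorem Owns.mem_pos {i : ι} {b : ι × List (Arrow V)} (h : E.Owns i b) : b.1 ∈ σ.pos := by
  rcases h with ⟨h1, h2, -⟩ | ⟨h1, h2, -⟩ <;> rwa [h1]

theorem Owns.isPathFrom {i : ι} {b : ι × List (Arrow V)} (h : E.Owns i b) :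
    G.IsPathFrom (σ.vertex b.1) b.2 := by
  rcases h with ⟨h1, h2, q, h3, -, h4, -⟩ | ⟨h1, h2, q, h3, h4, -⟩
  · rw [h1]
    exact (path_direct h3 h2).prefix h4
  · rw [h1]
    exact (path_inverse h3 h2).prefix h4

theorem head?_eq_of_prefix {p q : List (Arrow V)} (h : p <+: q) (hp : p ≠ []) :
    p.head? = q.head? := by
  obtain ⟨r, rfl⟩ := h
  cases p with
  | nil => exact absurd rfl hp
  | cons a p => rfl

end Completion

/-- The differential maps the basis vector `b'` to the summand at the next place, and `b` is its
image up to a scalar. -/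
def NextImage (σ : HSequence G ι) (b b' : ι × List (Arrow V)) : Prop :=
  ∃ q, σ.letter b'.1 = some (.inverse q) ∧ b = (b'.1 + 1, q ++ b'.2)

/-- The differential maps the basis vector `b'` to the summand at the previous place, and `b` is its
image up to a scalar. -/
def PrevImage (σ : HSequence G ι) (b b' : ι × List (Arrow V)) : Prop :=
  ∃ q, σ.letter (b'.1 - 1) = some (.direct q) ∧ b = (b'.1 - 1, q ++ b'.2)

theorem NextImage.unique {b b' b'' : ι × List (Arrow V)} (h : σ.NextImage b b')
    (h' : σ.NextImage b b'') : b' = b'' := by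
  obtain ⟨q, h1, rfl⟩ := h
  obtain ⟨q', h1', h2⟩ := h'
  obtain ⟨h2, h3⟩ := Prod.ext_iff.mp h2
  have h4 : b'.1 = b''.1 := add_right_cancel h2
  rw [h4, h1'] at h1
  cases h1
  exact Prod.ext h4 (List.append_cancel_left h3)

theorem PrevImage.unique {b b' b'' : ι × List (Arrow V)} (h : σ.PrevImage b b')
    (h' : σ.PrevImage b b'') : b' = b'' := by
  obtain ⟨q, h1, rfl⟩ := h
  obtain ⟨q', h1', h2⟩ := h'
  obtain ⟨h2, h3⟩ := Prod.ext_iff.mp h2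
  have h4 : b'.1 = b''.1 := sub_left_injective h2
  rw [h4, h1'] at h1
  cases h1
  exact Prod.ext h4 (List.append_cancel_left h3)

theorem head?_append_of_ne_nil {p q : List (Arrow V)} (hp : p ≠ []) :
    (p ++ q).head? = p.head? := by
  cases p with
  | nil => exact absurd rfl hp
  | cons a p => rfl

/-- The images of distinct basis vectors under the differential have disjoint supports. -/
theorem NextImage.not_prevImage {b b' b'' : ι × List (Arrow V)} (h : σ.NextImage b b')
    (h' : σ.PrevImage b b'') : False := by
  obtain ⟨q, h1, rfl⟩ := h
  obtain ⟨q', h1', h2⟩ := h'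
  obtain ⟨h2, h3⟩ := Prod.ext_iff.mp h2
  simp only at h2 h3
  rw [← h2] at h1'
  have hm := σ.mayFollow _ _ _ h1 h1'
  refine hm ?_
  rw [← head?_append_of_ne_nil (σ.inverse_path _ _ h1).ne_nil (q := b'.2), h3,
    head?_append_of_ne_nil (σ.direct_path _ _ h1').ne_nil]

variable {K : Type u} [Field K] [Fintype V] {c : ι → K}

open Classical in
theorem coord_vec_of_isBasic {d : ℤ} {b : ι × List (Arrow V)} (hb : σ.IsBasic d b)
    (b' : ι × List (Arrow V)) : σ.coord K d b (σ.vec K d b') = if b' = b then 1 else 0 := by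
  by_cases hb' : σ.IsBasic d b'
  · exact coord_vec hb'
  · rw [vec_eq_zero hb', map_zero, if_neg]
    rintro rfl
    exact hb' hb

open Classical in
theorem coord_diff_vec {d d' : ℤ} {b b' : ι × List (Arrow V)} (hb : σ.IsBasic d' b)
    (hb' : σ.IsBasic d b') : σ.coord K d' b (σ.diff c d d' (σ.vec K d b')) =
      (if σ.NextImage b b' then c b'.1 else 0) +
        (if σ.PrevImage b b' then c (b'.1 - 1) else 0) := by
  obtain ⟨j, p⟩ := b'
  rw [diff_vec c d' hb'.place, map_add]
  refine congrArg₂ (· + ·) ?_ ?_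
  · rcases hl : σ.letter j with _ | q | q
    · simp [nextVec, NextImage, hl]
    · simp [nextVec, NextImage, hl]
    · simp [nextVec, NextImage, hl, coord_vec_of_isBasic hb, eq_comm]
  · rcases hl : σ.letter (j - 1) with _ | q | q
    · simp [prevVec, PrevImage, hl]
    · simp [prevVec, PrevImage, hl, coord_vec_of_isBasic hb, eq_comm]
    · simp [prevVec, PrevImage, hl]

/-- A basis vector whose differential is not zero is detected by a coefficient of its
differential. -/
theorem exists_detecting (hc : ∀ i, c i ≠ 0) {d : ℤ} {b b' : ι × List (Arrow V)}
    (hb : σ.IsBasic d b) (hb' : σ.IsBasic (d + 1) b')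
    (h : σ.NextImage b' b ∨ σ.PrevImage b' b) :
    ∃ f : σ.Term K (d + 1) →ₗ[K] K, f (σ.diff c d (d + 1) (σ.vec K d b)) ≠ 0 ∧
      ∀ b', σ.IsBasic d b' → b' ≠ b → f (σ.diff c d (d + 1) (σ.vec K d b')) = 0 := by
  refine ⟨σ.coord K (d + 1) b', ?_, fun b'' hb'' hne => ?_⟩
  · rw [coord_diff_vec hb' hb]
    rcases h with h | h
    · rw [if_pos h, if_neg fun h' => h.not_prevImage h', add_zero]
      exact hc _
    · rw [if_pos h, if_neg fun h' => h'.not_prevImage h, zero_add]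
      exact hc _
  · rw [coord_diff_vec hb' hb'', if_neg, if_neg, add_zero]
    · intro h'
      rcases h with h | h
      · exact h.not_prevImage h'
      · exact hne (h'.unique h)
    · intro h'
      rcases h with h | h
      · exact hne (h'.unique h)
      · exact h'.not_prevImage h

end HSequence

end Critical

/-! ### Cocycles, independence and generation -/

section Critical

namespace GentleQuiver

variable {G : GentleQuiver V}

/-- A relation at the place where two paths are joined destroys the composite. -/
theorem not_isPathFrom_append_of_rel {x : V} {p q : List (Arrow V)} {a b : Arrow V}
    (hp : p.getLast? = some a) (hq : q.head? = some b) (h : G.rel b a) :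
    ¬ G.IsPathFrom x (p ++ q) := fun h' =>
  ((List.isChain_append.mp h'.chain).2.2 a hp b hq).2 h

theorem IsPass.not_isPathFrom {x : V} {p q u : List (Arrow V)} (h : G.IsPass p q)
    (hu : u ≠ []) (huq : u.head? = q.head?) : ¬ G.IsPathFrom x (p ++ u) := by
  obtain ⟨b, hb, hr⟩ := h
  obtain ⟨a, ha⟩ := Option.ne_none_iff_exists'.mp (mt List.head?_eq_none_iff.mp hu)
  exact not_isPathFrom_append_of_rel hb ha ((hr a).mpr (huq ▸ ha))

theorem IsPath.append {x y : V} {p u : List (Arrow V)} (hp : G.IsPath x y p)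
    (hu : G.IsPathFrom y u)
    (h : ∀ b, p.getLast? = some b → ∀ a, u.head? = some a → ¬ G.rel a b) :
    G.IsPathFrom x (p ++ u) := by
  refine ⟨fun a ha => hp.isPathFrom.source a ?_, List.isChain_append.mpr ⟨hp.chain, hu.chain, ?_⟩⟩
  · rwa [HSequence.head?_append_of_ne_nil hp.ne_nil] at ha
  · intro b hb a ha
    have hb' : b.right = y := by simpa [show p.getLast? = some b from hb] using hp.target
    exact ⟨hb'.trans (hu.source a ha).symm, h b hb a ha⟩

/-- If both of two paths with different last arrows can be prolonged by `u`, then `u` is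
trivial. -/
theorem eq_nil_of_append {x x' : V} {p q u : List (Arrow V)} (hp : p ≠ [])
    (hpq : p.getLast? ≠ q.getLast?) (h : G.IsPathFrom x (p ++ u)) (h' : G.IsPathFrom x' (q ++ u))
    (hq : q ≠ []) : u = [] := by
  cases u with
  | nil => rfl
  | cons a u =>
    obtain ⟨b, hb⟩ := Option.ne_none_iff_exists'.mp (mt List.getLast?_eq_none_iff.mp hp)
    obtain ⟨b', hb'⟩ := Option.ne_none_iff_exists'.mp (mt List.getLast?_eq_none_iff.mp hq)
    have h1 := (List.isChain_append.mp h.chain).2.2 b hb a rfl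
    have h2 := (List.isChain_append.mp h'.chain).2.2 b' hb' a rfl
    have := G.nonrel_before a h1 h2
    exact absurd (by rw [hb, hb', this]) hpq

end GentleQuiver

namespace HSequence

variable {G : GentleQuiver V} {ι : Type} [CommRing ι] {σ : HSequence G ι} {E : σ.Completion}
variable {K : Type u} [Field K] [Fintype V] {c : ι → K}

namespace Completion

/-- The paths carried by the letters are cocycles: if the differential leads away from the summand of
such a path along another letter, this letter forms a relation with the first arrow of the path. -/
theorem Owns.diff_eq_zero {d : ℤ} {i : ι} {b : ι × List (Arrow V)} (h : E.Owns i b)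
    (hd : σ.deg b.1 = d) : σ.diff c d (d + 1) (σ.vec K d b) = 0 := by
  have hb := h.mem_pos
  obtain ⟨j, u⟩ := b
  rw [diff_vec c _ ⟨hb, hd⟩]
  have hm := E.meet' hb
  simp only at hb hd
  have h1 : nextVec (σ := σ) c (d + 1) j u = 0 := by
    rcases hl : σ.letter j with _ | q | q
    · simp [nextVec, hl]
    · simp [nextVec, hl]
    · have hL := E.eq_of_letter _ _ hl
      simp only [nextVec, hl]
      rcases h with ⟨rfl, -, q', h3, -⟩ | ⟨rfl, -, r, h3, h4, -, h5⟩
      · rw [h3] at hL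
        cases hL
      · simp only at h5 h4
        rw [add_sub_cancel_right, h3, hL] at hm
        have hu : u ≠ [] := fun e => by
          obtain ⟨q', hq'⟩ := h5 e
          rw [hq'] at hL
          cases hL
        rw [vec_eq_zero, smul_zero]
        exact fun h' => GentleQuiver.IsPass.not_isPathFrom hm hu (head?_eq_of_prefix h4 hu) h'.path
  have h2 : prevVec (σ := σ) c (d + 1) j u = 0 := by
    rcases hl : σ.letter (j - 1) with _ | q | q
    · simp [prevVec, hl]
    · have hL := E.eq_of_letter _ _ hl
      simp only [prevVec, hl]
      rcases h with ⟨rfl, -, r, h3, h4, h5, -⟩ | ⟨rfl, -, r, h3, -⟩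
      · simp only at h5 h4
        rw [h3, hL] at hm
        rw [vec_eq_zero, smul_zero]
        exact fun h' => GentleQuiver.IsPass.not_isPathFrom hm h4 (head?_eq_of_prefix h5 h4) h'.path
      · rw [add_sub_cancel_right, h3] at hL
        cases hL
    · simp [prevVec, hl]
  rw [h1, h2, add_zero]

theorem append_prefix_antisymm {p q u : List (Arrow V)} (h : p <+: q) (h' : p = q ++ u) :
    u = [] ∧ p = q := by
  have h1 := h.length_le
  rw [h', List.length_append] at h1
  have h2 : u = [] := List.length_eq_zero_iff.mp (by omega)
  exact ⟨h2, by rw [h', h2, List.append_nil]⟩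

theorem Owns.not_nextImage {i : ι} {b b' : ι × List (Arrow V)} (h : E.Owns i b)
    (h' : σ.NextImage b b') : False := by
  obtain ⟨q, hl, rfl⟩ := h'
  have hL := E.eq_of_letter _ _ hl
  have hq := (σ.inverse_path _ _ hl).ne_nil
  obtain ⟨p1, p2⟩ := pos_of_letter hl
  rcases h with ⟨rfl, -, r, h3, h4, h5, -⟩ | ⟨h1, -, r, h3, h4, h5, -⟩
  · have hm := E.meet _ p2
    rw [h3, hL] at hm
    exact IsValley.false_of_head hm (head?_append_of_ne_nil hq) (head?_eq_of_prefix h5 h4) h4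
  · obtain rfl := add_right_cancel h1
    rw [h3] at hL
    cases hL
    exact h5 (append_prefix_antisymm h4 rfl).2 p1

/-- A path that represents a cohomology class is hit by the differential only if the differential
relates it to a path in a second summand. -/
theorem Owns.prevImage {i : ι} {b b' : ι × List (Arrow V)} (h : E.Owns i b)
    (h' : σ.PrevImage b b') : b' = (b.1 + 1, []) ∧ σ.letter b.1 = some (.direct b.2) ∧
      ∃ p, σ.letter (b.1 + 1) = some (.inverse p) := by
  obtain ⟨q, hl, rfl⟩ := h'
  have hL := E.eq_of_letter _ _ hl
  have hq := (σ.direct_path _ _ hl).ne_nil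
  obtain ⟨p1, p2⟩ := pos_of_letter hl
  rcases h with ⟨rfl, -, r, h3, h4, h5, h6⟩ | ⟨h1, -, r, h3, h4, h5, -⟩
  · rw [h3] at hL
    cases hL
    obtain ⟨h7, h8⟩ := append_prefix_antisymm h5 rfl
    obtain ⟨p, hp⟩ := h6 h8 p2
    simp only at h7 h8 ⊢
    refine ⟨Prod.ext (by simp) h7, by rw [hl, h8], p, letter_of_inverse hp p2⟩
  · simp only at h1
    have hm := E.meet' p1
    rw [h1, add_sub_cancel_right, h3, ← h1, hL] at hm
    exact (IsValley.false_of_head hm (head?_eq_of_prefix h4 (by simp [hq]))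
      (head?_append_of_ne_nil hq) (by simp [hq])).elim

theorem Owns.isBasic {d : ℤ} {i : ι} {b : ι × List (Arrow V)} (h : E.Owns i b)
    (hd : σ.deg b.1 = d) : σ.IsBasic d b := ⟨⟨h.mem_pos, hd⟩, h.isPathFrom⟩

/-- The paths carried by the letters are linearly independent modulo coboundaries. -/
theorem Owns.exists_functional (hc : ∀ i, c i ≠ 0) {d : ℤ} {i : ι} {b : ι × List (Arrow V)}
    (h : E.Owns i b) (hd : σ.deg b.1 = d) :
    ∃ ψ : σ.Term K d →ₗ[K] K, (∀ z, ψ (σ.diff c (d - 1) d z) = 0) ∧ ψ (σ.vec K d b) ≠ 0 ∧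
      ∀ i' b', E.Owns i' b' → b' ≠ b → ψ (σ.vec K d b') = 0 := by
  classical
  have red : ∀ ψ : σ.Term K d →ₗ[K] K,
      (∀ b', σ.IsBasic (d - 1) b' → ψ (σ.diff c (d - 1) d (σ.vec K (d - 1) b')) = 0) →
      ∀ z, ψ (σ.diff c (d - 1) d z) = 0 := by
    intro ψ hψ z
    have : ψ.comp ((σ.diff c (d - 1) d).restrictScalars K) = 0 := by
      refine (termBasis K σ (d - 1)).ext fun b' => ?_
      rw [termBasis_apply]
      exact hψ b'.1 b'.2
    exact LinearMap.congr_fun this z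
  have hb := h.isBasic hd
  -- If `b` is the path of a direct letter followed by an inverse one, the differential relates it to
  -- the path of that inverse letter, and a combination of two coefficients is needed.
  by_cases hp : σ.letter b.1 = some (.direct b.2) ∧ ∃ p, σ.letter (b.1 + 1) = some (.inverse p)
  · obtain ⟨h1, p, h2⟩ := hp
    set b₂ : ι × List (Arrow V) := (b.1 + 1 + 1, p) with hb₂
    have hdd : σ.deg b₂.1 = d := by
      have e1 := σ.direct_deg _ _ h1
      have e2 := σ.inverse_deg _ _ h2
      rw [hb₂]
      simp only
      omega
    have hbb₂ : σ.IsBasic d b₂ :=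
      ⟨⟨(pos_of_letter h2).2, hdd⟩, (σ.inverse_path _ _ h2).isPathFrom⟩
    have hno : ∀ i', ¬ E.Owns i' b₂ := by
      intro i' h'
      exact h'.not_nextImage (b' := (b.1 + 1, [])) ⟨p, h2, by simp [hb₂]⟩
    have key : ∀ b' : ι × List (Arrow V), σ.NextImage b₂ b' ↔ b' = (b.1 + 1, []) := by
      intro b'
      have h4 : σ.NextImage b₂ (b.1 + 1, []) := ⟨p, h2, by simp [hb₂]⟩
      constructor
      · exact fun h3 => h3.unique h4
      · rintro rfl
        exact h4
    have key' : ∀ b' : ι × List (Arrow V), σ.PrevImage b b' ↔ b' = (b.1 + 1, []) := by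
      intro b'
      constructor
      · exact fun h3 => (h.prevImage h3).1
      · rintro rfl
        exact ⟨b.2, by simpa using h1, by simp⟩
    refine ⟨σ.coord K d b - (c b.1 / c (b.1 + 1)) • σ.coord K d b₂, red _ fun b' hb' => ?_, ?_,
      fun i' b' hb' hne => ?_⟩
    · rw [LinearMap.sub_apply, LinearMap.smul_apply, coord_diff_vec hb hb',
        coord_diff_vec hbb₂ hb', if_neg fun h' => h.not_nextImage h',
        if_neg fun h' => ((key _).mpr rfl).not_prevImage h']
      simp only [key, key']
      by_cases he : b' = (b.1 + 1, [])
      · subst he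
        simp [hc]
      · simp [he]
    · have : b ≠ b₂ := by
        intro e
        exact hno i (e ▸ h)
      rw [LinearMap.sub_apply, LinearMap.smul_apply, coord_vec hb, coord_vec hb, if_pos rfl,
        if_neg this]
      simp
    · have : b' ≠ b₂ := by
        rintro rfl
        exact hno i' hb'
      rw [LinearMap.sub_apply, LinearMap.smul_apply, coord_vec_of_isBasic hb,
        coord_vec_of_isBasic hbb₂, if_neg this, if_neg hne]
      simp
  · refine ⟨σ.coord K d b, red _ fun b' hb' => ?_, ?_, fun i' b' hb' hne => ?_⟩
    · rw [coord_diff_vec hb hb', if_neg fun h' => h.not_nextImage h',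
        if_neg fun h' => hp (h.prevImage h').2, add_zero]
    · rw [coord_vec hb, if_pos rfl]
      exact one_ne_zero
    · rw [coord_vec_of_isBasic hb, if_neg hne]

variable (E c K) in
/-- Modulo coboundaries, the basis vector `b` is zero or a multiple of one that is carried by a
letter. -/
def Reduces (d : ℤ) (b : ι × List (Arrow V)) : Prop :=
  ∃ (k : K) (i : ι) (b' : ι × List (Arrow V)), (k = 0 ∨ E.Owns i b' ∧ σ.deg b'.1 = d) ∧
    (Submodule.Quotient.mk (σ.vec K d b) : σ.Coker c d) =
      Submodule.Quotient.mk (k • σ.vec K d b')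

theorem Owns.reduces {d : ℤ} {i : ι} {b : ι × List (Arrow V)} (h : E.Owns i b)
    (hd : σ.deg b.1 = d) : E.Reduces K c d b := ⟨1, i, b, Or.inr ⟨h, hd⟩, by rw [one_smul]⟩

/-- The two parts of a differential agree up to scalars modulo coboundaries. -/
theorem reduces_of_diff_eq {d : ℤ} {b : ι × List (Arrow V)} {z : σ.Term K (d - 1)} {t k : K}
    {i : ι} {b' : ι × List (Arrow V)} (ht : t ≠ 0)
    (hz : σ.diff c (d - 1) d z = t • σ.vec K d b + k • σ.vec K d b')
    (h : k = 0 ∨ E.Owns i b' ∧ σ.deg b'.1 = d) : E.Reduces K c d b := by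
  refine ⟨-(t⁻¹ * k), i, b', ?_, ?_⟩
  · rcases h with rfl | h
    · exact Or.inl (by simp)
    · exact Or.inr h
  · rw [Submodule.Quotient.eq]
    refine ⟨algebraMap K (GentleAlgebra K G) t⁻¹ • z, ?_⟩
    rw [map_smul, hz, algebraMap_smul, smul_add, smul_smul, smul_smul, inv_mul_cancel₀ ht,
      one_smul, sub_eq_add_neg]
    refine congrArg (_ + ·) (eq_neg_of_add_eq_zero_left ?_)
    rw [← add_smul, add_neg_cancel, zero_smul]

/-- A nontrivial path whose first arrow is that of the path `q` of a direct letter is an initial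
piece of `q` or prolongs `q`, and in the second case it occurs in a coboundary. -/
theorem reduces_of_head_direct (hc : ∀ i, c i ≠ 0) {d : ℤ} {j : ι} {u q : List (Arrow V)}
    (hb : σ.IsBasic d (j, u)) (hL : E.L j = .direct q) (hu : u ≠ []) (huq : u.head? = q.head?) :
    E.Reduces K c d (j, u) := by
  obtain ⟨⟨hj, hd⟩, hp⟩ := hb
  simp only at hj hd hp
  have hq := path_direct hL hj
  have hown : u <+: q → (u = q → j + 1 ∈ σ.pos → ∃ p, E.L (j + 1) = .inverse p) →
      E.Reduces K c d (j, u) := fun h1 h2 =>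
    Owns.reduces (i := j) (Or.inl ⟨rfl, hj, q, hL, hu, h1, h2⟩) hd
  by_cases h1 : u <+: q ∧ u ≠ q
  · exact hown h1.1 fun h => absurd h h1.2
  -- otherwise the path prolongs `q`
  have h2 : ∃ u', u = q ++ u' := by
    rcases G.prefix_or_prefix hp.chain hq.chain huq with h | ⟨u', h⟩
    · by_cases h3 : u = q
      · exact ⟨[], by simp [h3]⟩
      · exact absurd ⟨h, h3⟩ h1
    · exact ⟨u', h.symm⟩
  obtain ⟨u', rfl⟩ := h2
  by_cases hj' : j + 1 ∈ σ.pos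
  · have hl := letter_of_direct hL hj'
    have hdeg := σ.direct_deg _ _ hl
    have hqp := σ.direct_path _ _ hl
    have hz := diff_vec (K := K) (σ := σ) c d (d := d - 1) (j := j + 1) ⟨hj', by omega⟩ u'
    have hprev : prevVec (σ := σ) c d (j + 1) u' = c j • σ.vec K d (j, q ++ u') := by
      simp only [prevVec]
      rw [add_sub_cancel_right, hl]
    rw [hprev] at hz
    replace hz := hz.trans (add_comm _ _)
    -- without a contribution from the letter `j + 1`, the path is a coboundary
    have hcob : nextVec (σ := σ) c d (j + 1) u' = 0 → E.Reduces K c d (j, q ++ u') := fun h3 =>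
      reduces_of_diff_eq (z := σ.vec K (d - 1) (j + 1, u')) (i := j) (k := 0) (b' := (j, []))
        (hc j) (by rw [hz, h3]; simp) (Or.inl rfl)
    rcases hl' : σ.letter (j + 1) with _ | p | p
    · exact hcob (by simp [nextVec, hl'])
    · exact hcob (by simp [nextVec, hl'])
    · by_cases hu' : u' = []
      · subst hu'
        exact hown (by simp) fun _ _ => ⟨p, E.eq_of_letter _ _ hl'⟩
      · have hpp := σ.inverse_path _ _ hl'
        refine hcob ?_
        simp only [nextVec, hl']
        rw [vec_eq_zero, smul_zero]
        · intro h3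
          exact hu' (GentleQuiver.eq_nil_of_append hqp.ne_nil (σ.mayFollow _ _ _ hl hl') hp h3.path
            hpp.ne_nil)
  · -- the path of a virtual letter cannot be prolonged
    have ht := terminal_direct hL hj hj'
    have : q ++ u' = q := by
      refine GentleQuiver.eq_of_terminal hp.chain hq.chain ?_ ht huq
      have hq0 : q ≠ [] := by
        rintro rfl
        exact hu (List.head?_eq_none_iff.mp (by rw [huq]; rfl))
      obtain ⟨b, hbq⟩ := Option.ne_none_iff_exists'.mp (mt List.getLast?_eq_none_iff.mp hq0)
      have : u' = [] := by
        cases u' with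
        | nil => rfl
        | cons a u' =>
          have h3 := (List.isChain_append.mp hp.chain).2.2 b hbq a rfl
          exact absurd (ht b hbq a h3.1) h3.2
      rwa [this, List.append_nil]
    exact hown (by rw [this]) fun _ h => absurd h hj'

/-- The same for a path starting like that of an inverse letter, or trivial. -/
theorem reduces_of_head_inverse (hc : ∀ i, c i ≠ 0) {d : ℤ} {i : ι} {u q : List (Arrow V)}
    (hb : σ.IsBasic d (i + 1, u)) (hL : E.L i = .inverse q) (huq : u.head? = q.head? ∨ u = [])
    (hnil : u = [] → ∃ p, E.L (i + 1) = .direct p) : E.Reduces K c d (i + 1, u) := by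
  obtain ⟨⟨hj, hd⟩, hp⟩ := hb
  simp only at hj hd hp
  have hq := path_inverse hL hj
  have hown : u <+: q → (u = q → i ∉ σ.pos) → E.Reduces K c d (i + 1, u) := fun h1 h2 =>
    Owns.reduces (i := i) (Or.inr ⟨rfl, hj, q, hL, h1, h2, hnil⟩) hd
  by_cases h1 : u <+: q ∧ u ≠ q
  · exact hown h1.1 fun h => absurd h h1.2
  -- otherwise the path prolongs `q`
  have h2 : ∃ u', u = q ++ u' := by
    rcases huq with huq | rfl
    · rcases G.prefix_or_prefix hp.chain hq.chain huq with h | ⟨u', h⟩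
      · by_cases h3 : u = q
        · exact ⟨[], by simp [h3]⟩
        · exact absurd ⟨h, h3⟩ h1
      · exact ⟨u', h.symm⟩
    · refine ⟨[], ?_⟩
      by_contra h
      exact h1 ⟨List.nil_prefix, by simpa using h⟩
  obtain ⟨u', rfl⟩ := h2
  by_cases hi : i ∈ σ.pos
  · have hl := letter_of_inverse hL hi
    have hdeg := σ.inverse_deg _ _ hl
    have hqp := σ.inverse_path _ _ hl
    have hz := diff_vec (K := K) (σ := σ) c d (d := d - 1) (j := i) ⟨hi, by omega⟩ u'
    have hnext : nextVec (σ := σ) c d i u' = c i • σ.vec K d (i + 1, q ++ u') := by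
      simp only [nextVec]
      rw [hl]
    rw [hnext] at hz
    -- without a contribution from the letter `i - 1`, the path is a coboundary
    have hcob : prevVec (σ := σ) c d i u' = 0 → E.Reduces K c d (i + 1, q ++ u') := fun h3 =>
      reduces_of_diff_eq (z := σ.vec K (d - 1) (i, u')) (i := i) (k := 0) (b' := (i, []))
        (hc i) (by rw [hz, h3]; simp) (Or.inl rfl)
    rcases hl' : σ.letter (i - 1) with _ | p | p
    · exact hcob (by simp [prevVec, hl'])
    · have hpp := σ.direct_path _ _ hl'
      obtain ⟨hpi, -⟩ := pos_of_letter hl'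
      by_cases hu' : u' = []
      · subst hu'
        -- `q` has the same class, up to a scalar, as the path of the direct letter `i - 1`
        refine reduces_of_diff_eq (z := σ.vec K (d - 1) (i, [])) (i := i - 1) (k := c (i - 1))
          (b' := (i - 1, p)) (hc i) ?_
          (Or.inr ⟨Or.inl ⟨rfl, hpi, p, E.eq_of_letter _ _ hl', hpp.ne_nil, by simp, ?_⟩, ?_⟩)
        · rw [hz, prevVec, hl']
          simp
        · intro _ _
          rw [sub_add_cancel]
          exact ⟨q, hL⟩
        · have := σ.direct_deg _ _ hl'
          rw [sub_add_cancel] at this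
          simp only
          omega
      · refine hcob ?_
        simp only [prevVec, hl']
        rw [vec_eq_zero, smul_zero]
        · intro h3
          refine hu' (GentleQuiver.eq_nil_of_append hqp.ne_nil ?_ hp h3.path hpp.ne_nil)
          have := σ.mayFollow (i - 1) _ _ hl' (by rw [sub_add_cancel]; exact hl)
          exact fun e => this e.symm
    · exact hcob (by simp [prevVec, hl'])
  · -- the path of a virtual letter cannot be prolonged
    have ht := terminal_inverse hL hi hj
    have : u' = [] := by
      by_cases hq0 : q = []
      · subst hq0
        rcases huq with h | h
        · simpa using h
        · simpa using h
      · obtain ⟨b, hbq⟩ := Option.ne_none_iff_exists'.mp (mt List.getLast?_eq_none_iff.mp hq0)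
        cases u' with
        | nil => rfl
        | cons a u' =>
          have h3 := (List.isChain_append.mp hp.chain).2.2 b hbq a rfl
          exact absurd (ht b hbq a h3.1) h3.2
    subst this
    exact hown (by simp) fun _ => hi

/-- Every path has a nonzero differential, or is a coboundary, or represents the same class as a
path carried by a letter. -/
theorem reduces_or_detected (hc : ∀ i, c i ≠ 0) {d : ℤ} {b : ι × List (Arrow V)}
    (hb : σ.IsBasic d b) : E.Reduces K c d b ∨
      ∃ b', σ.IsBasic (d + 1) b' ∧ (σ.NextImage b' b ∨ σ.PrevImage b' b) := by
  obtain ⟨j, u⟩ := b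
  obtain ⟨i, rfl⟩ : ∃ i, j = i + 1 := ⟨j - 1, by simp⟩
  have hb0 := hb
  obtain ⟨⟨hj, hd⟩, hp⟩ := hb0
  simp only at hj hd hp
  have hm := E.meet i hj
  have prev : ∀ p, E.L i = .direct p → G.IsPathFrom (σ.vertex i) (p ++ u) →
      ∃ b', σ.IsBasic (d + 1) b' ∧ (σ.NextImage b' (i + 1, u) ∨ σ.PrevImage b' (i + 1, u)) := by
    intro p hL hpu
    have hl := letter_of_direct hL hj
    have hdeg := σ.direct_deg _ _ hl
    refine ⟨(i, p ++ u), ⟨⟨(pos_of_letter hl).1, ?_⟩, hpu⟩, Or.inr ⟨p, ?_, ?_⟩⟩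
    · rw [hdeg, hd]
    · simpa using hl
    · simp
  have next : ∀ p, E.L (i + 1) = .inverse p → G.IsPathFrom (σ.vertex (i + 1 + 1)) (p ++ u) →
      ∃ b', σ.IsBasic (d + 1) b' ∧ (σ.NextImage b' (i + 1, u) ∨ σ.PrevImage b' (i + 1, u)) := by
    intro p hL hpu
    have hl := letter_of_inverse hL hj
    have hdeg := σ.inverse_deg _ _ hl
    refine ⟨(i + 1 + 1, p ++ u), ⟨⟨(pos_of_letter hl).2, ?_⟩, hpu⟩, Or.inl ⟨p, hl, rfl⟩⟩
    rw [hdeg, hd]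
  rcases hA : E.L i with p | p <;> rcases hB : E.L (i + 1) with q | q <;> rw [hA, hB] at hm
  · -- the differential goes to the previous place only
    have hpp := σ.direct_path _ _ (letter_of_direct hA hj)
    obtain ⟨b, hbp, hr⟩ := hm
    by_cases hrel : ∃ a, u.head? = some a ∧ G.rel a b
    · obtain ⟨a, ha, hab⟩ := hrel
      refine Or.inl (reduces_of_head_direct hc hb hB ?_ ?_)
      · rintro rfl
        cases ha
      · rw [ha, (hr a).mp hab]
    · push Not at hrel
      refine Or.inr (prev p hA (hpp.append hp fun b' hb' a ha => ?_))
      rw [hbp] at hb'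
      cases hb'
      exact hrel a ha
  · -- the differential goes to both neighbours, and the first arrow of the path forms a relation with
    -- at most one of the two letters
    have hpp := σ.direct_path _ _ (letter_of_direct hA hj)
    have hqq := σ.inverse_path _ _ (letter_of_inverse hB hj)
    by_cases hrel : ∃ a b, u.head? = some a ∧ p.getLast? = some b ∧ G.rel a b
    · obtain ⟨a, b, ha, hbp, hab⟩ := hrel
      refine Or.inr (next q hB (hqq.append hp fun b' hb' a' ha' hr' => hm ?_))
      rw [ha] at ha'
      cases ha'
      rw [hbp, hb', G.rel_before _ hab hr']
    · push Not at hrel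
      exact Or.inr (prev p hA (hpp.append hp fun b' hb' a ha => hrel a b' ha hb'))
  · -- the differential vanishes on this summand
    left
    by_cases hu : u = []
    · exact reduces_of_head_inverse hc hb hA (Or.inr hu) fun _ => ⟨q, hB⟩
    · obtain ⟨a, ha⟩ := Option.ne_none_iff_exists'.mp (mt List.head?_eq_none_iff.mp hu)
      rcases hm.1 a (hp.source a ha) with h | h
      · exact reduces_of_head_inverse hc hb hA (Or.inl (ha.trans h.symm)) fun e => absurd e hu
      · exact reduces_of_head_direct hc hb hB hu (ha.trans h.symm)
  · -- the differential goes to the next place only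
    have hqq := σ.inverse_path _ _ (letter_of_inverse hB hj)
    obtain ⟨b, hbp, hr⟩ := hm
    by_cases hrel : ∃ a, u.head? = some a ∧ G.rel a b
    · obtain ⟨a, ha, hab⟩ := hrel
      refine Or.inl (reduces_of_head_inverse hc hb hA (Or.inl ?_) ?_)
      · rw [ha, (hr a).mp hab]
      · rintro rfl
        cases ha
    · push Not at hrel
      refine Or.inr (next q hB (hqq.append hp fun b' hb' a ha => ?_))
      rw [hbp] at hb'
      cases hb'
      exact hrel a ha

/-- The cohomology in degree `d` is determined by the action of `Λ` on the classes of the paths of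
degree `d` carried by the letters. -/
theorem homology_equiv (E : σ.Completion) (hc : ∀ i, c i ≠ 0) {d : ℤ} {N M : Type*}
    [AddCommGroup M] [Module K M] [Module (GentleAlgebra K G) M]
    [IsScalarTower K (GentleAlgebra K G) M]
    (Z : Module.Basis N K M) (φ : M →ₗ[GentleAlgebra K G] σ.Coker c d)
    (pos : N → ι × List (Arrow V)) (ε : N → K) (hε : ∀ n, ε n ≠ 0)
    (hφ : ∀ n, φ (Z n) = Submodule.Quotient.mk (ε n • σ.vec K d (pos n)))
    (hinj : Function.Injective pos)
    (hown : ∀ n, (∃ i, E.Owns i (pos n)) ∧ σ.deg (pos n).1 = d)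
    (hsurj : ∀ i b, E.Owns i b → σ.deg b.1 = d → ∃ n, pos n = b) :
    Nonempty ((σ.complex c).homology d ≃ₗ[GentleAlgebra K G] M) := by
  refine homology_equiv_of_basis Z φ pos ε hε hφ (fun n => ?_) (fun n => ?_) fun b hb => ?_
  · obtain ⟨⟨i, hi⟩, hd⟩ := hown n
    exact hi.diff_eq_zero hd
  · obtain ⟨⟨i, hi⟩, hd⟩ := hown n
    obtain ⟨ψ, h1, h2, h3⟩ := hi.exists_functional (K := K) hc hd
    refine ⟨ψ, h1, h2, fun n' hn' => ?_⟩
    obtain ⟨⟨i', hi'⟩, -⟩ := hown n'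
    exact h3 i' _ hi' fun e => hn' (hinj e)
  · rcases E.reduces_or_detected (K := K) hc hb with ⟨k, i, b', h, he⟩ | ⟨b', hb', h⟩
    · left
      rcases h with rfl | ⟨hb', hd⟩
      · exact ⟨0, by rw [he, zero_smul, map_zero]; rfl⟩
      · obtain ⟨n, rfl⟩ := hsurj i b' hb' hd
        refine ⟨(k * (ε n)⁻¹) • Z n, ?_⟩
        rw [← LinearMap.coe_restrictScalars K φ, map_smul, LinearMap.coe_restrictScalars, hφ, he,
          ← Submodule.Quotient.mk_smul, smul_smul, mul_assoc, inv_mul_cancel₀ (hε n), mul_one]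
    · exact Or.inr (exists_detecting hc hb hb' h)

end Completion

end HSequence

end Critical

/-! ### Walks in the cokernel of the differential -/

section Walks

variable {K : Type u} [Field K] [Fintype V] {G : GentleQuiver V} {ι : Type} [CommRing ι]

/-- A step of a walk whose nodes are scalar multiples of paths in the summands of a term of the
complex. -/
structure Step (K : Type u) (ι : Type) (V : Type v) [Quiver.{w} V] where
  src : K × ι × List (Arrow V)
  letter : Letter V
  tgt : K × ι × List (Arrow V)

namespace HSequence

variable (σ : HSequence G ι) (c : ι → K) (d : ℤ)

/-- The class modulo coboundaries of a multiple of a path. -/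
def cls (n : K × ι × List (Arrow V)) : σ.Coker c d :=
  Submodule.Quotient.mk (n.1 • σ.vec K d n.2)

/-- The arrow of the step `s` maps one end of `s` to the other. -/
structure IsStep (s : Step K ι V) : Prop where
  fwd : ∀ a, s.letter = .fwd a → arrowElt K G a • σ.cls c d s.src = σ.cls c d s.tgt
  bwd : ∀ a, s.letter = .bwd a → arrowElt K G a • σ.cls c d s.tgt = σ.cls c d s.src
  target : vertexElt K G s.letter.target • σ.cls c d s.tgt = σ.cls c d s.tgt

/-- The step `t` may follow the step `s`: the letters form a string, the classes agree where the
steps meet, and all arrows not in these two steps annihilate the class there. -/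
structure Follows (s t : Step K ι V) : Prop where
  comp : G.Composable s.letter t.letter
  eq : σ.cls c d s.tgt = σ.cls c d t.src
  zero : ∀ a, arrowElt K G a • σ.cls c d s.tgt ≠ 0 → s.letter = .bwd a ∨ t.letter = .fwd a

/-- The nodes `n` and the targets of the steps `S` satisfy the relations between the basis
vectors of the string module given by the letters of `S`, with start vertex `x`. -/
structure Realizes (n : K × ι × List (Arrow V)) (S : List (Step K ι V)) (x : V) : Prop where
  step : ∀ s ∈ S, σ.IsStep c d s
  chain : S.IsChain (σ.Follows c d)
  head : ∀ s ∈ S.head?, σ.cls c d n = σ.cls c d s.src ∧ s.letter.source = x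
  start : vertexElt K G x • σ.cls c d n = σ.cls c d n
  first : ∀ a, arrowElt K G a • σ.cls c d n ≠ 0 → ∃ s ∈ S.head?, s.letter = .fwd a
  last : ∀ s ∈ S.getLast?, ∀ a, arrowElt K G a • σ.cls c d s.tgt ≠ 0 → s.letter = .bwd a

variable {σ c d}

theorem Realizes.isString {n : K × ι × List (Arrow V)} {S : List (Step K ι V)} {x : V}
    (h : σ.Realizes c d n S x) : G.IsString ⟨x, S.map Step.letter⟩ where
  start l hl := by
    simp only [List.head?_map, Option.map_eq_some_iff] at hl
    obtain ⟨s, hs, rfl⟩ := hl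
    exact (h.head s hs).2
  chain := by
    rw [List.isChain_map]
    exact h.chain.imp fun _ _ h' => h'.comp

theorem Realizes.exists_hom {n : K × ι × List (Arrow V)} {S : List (Step K ι V)} {x : V}
    (h : σ.Realizes c d n S x) (w : Word V) (hw : G.IsString w) (hx : w.start = x)
    (hl : w.letters = S.map Step.letter)
    (hlen : w.letters.length + 1 = (n :: S.map Step.tgt).length) :
    ∃ φ : stringModule K w hw →ₗ[GentleAlgebra K G] σ.Coker c d,
      ∀ k, φ ((stringSchema K w hw).basis k) =
        σ.cls c d ((n :: S.map Step.tgt).get (Fin.cast hlen k)) := by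
  obtain ⟨x', ls⟩ := w
  simp only at hx hl
  subst hx hl
  have hc := List.isChain_iff_getElem.mp h.chain
  have hsrc : ∀ (k : ℕ) (hk : k < S.length),
      σ.cls c d ((n :: S.map Step.tgt)[k]'(by simp; omega)) = σ.cls c d S[k].src := by
    intro k hk
    cases k with
    | zero =>
      exact (h.head S[0] (by rw [List.head?_eq_getElem?, List.getElem?_eq_getElem hk]; rfl)).1
    | succ k =>
      simp only [List.getElem_cons_succ, List.getElem_map]
      exact (hc k hk).eq
  have htgt : ∀ (k : ℕ) (hk : k < S.length),
      (n :: S.map Step.tgt)[k + 1]'(by simp; omega) = S[k].tgt := by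
    intro k hk
    simp
  refine Schema.exists_hom _ _ (fun j => ?_) (fun k => ?_) (fun a i ha => ?_) (fun k k' h1 h2 => ?_)
  · induction j using Fin.cases with
    | zero => exact h.start
    | succ k =>
      have hk : k.val < S.length := by simpa using k.isLt
      have := (h.step S[k.val] (List.getElem_mem _)).target
      simp only [stringSchema, Fin.cases_succ, List.get_eq_getElem, List.getElem_map, Fin.val_cast,
        Fin.val_succ, List.getElem_cons_succ]
      exact this
  · have hk : k.val < S.length := by simpa using k.isLt
    have hs := h.step S[k.val] (List.getElem_mem _)
    have hget : (S.map Step.letter).get k = S[k.val].letter := by simp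
    simp only [stringSchema, hget, one_smul]
    cases hlet : S[k.val].letter with
    | fwd a =>
      simp only [Letter.arrow, List.get_eq_getElem, Fin.val_cast, Fin.val_castSucc, Fin.val_succ]
      rw [hsrc _ hk, htgt _ hk]
      exact hs.fwd a hlet
    | bwd a =>
      simp only [Letter.arrow, List.get_eq_getElem, Fin.val_cast, Fin.val_castSucc, Fin.val_succ]
      rw [hsrc _ hk, htgt _ hk]
      exact hs.bwd a hlet
  · have hfwd : ∀ (k : ℕ) (hk : k < S.length), i.val = k → S[k].letter = .fwd a →
        ∃ k, (stringSchema K _ hw).arrow k = a ∧ (stringSchema K _ hw).tail k = i := by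
      intro k hk hik hlet
      refine ⟨⟨k, by simpa using hk⟩, ?_⟩
      simp only [stringSchema, List.get_eq_getElem, List.getElem_map, hlet, Letter.arrow, true_and]
      exact Fin.ext hik.symm
    have hbwd : ∀ (k : ℕ) (hk : k < S.length), i.val = k + 1 → S[k].letter = .bwd a →
        ∃ k, (stringSchema K _ hw).arrow k = a ∧ (stringSchema K _ hw).tail k = i := by
      intro k hk hik hlet
      refine ⟨⟨k, by simpa using hk⟩, ?_⟩
      simp only [stringSchema, List.get_eq_getElem, List.getElem_map, hlet, Letter.arrow, true_and]
      exact Fin.ext hik.symm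
    induction i using Fin.cases with
    | zero =>
      obtain ⟨s, hs, hlet⟩ := h.first a ha
      rw [List.head?_eq_getElem?] at hs
      obtain ⟨hk, rfl⟩ := List.getElem?_eq_some_iff.mp hs
      exact hfwd 0 hk rfl hlet
    | succ k =>
      have hk : k.val < S.length := by simpa using k.isLt
      have ha' : arrowElt K G a • σ.cls c d S[k.val].tgt ≠ 0 := by
        simpa using ha
      by_cases hk' : k.val + 1 < S.length
      · rcases (hc k.val hk').zero a ha' with h1 | h1
        · exact hbwd _ hk rfl h1
        · exact hfwd _ hk' rfl h1
      · refine hbwd _ hk rfl (h.last _ ?_ a ha')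
        rw [List.getLast?_eq_getElem?, List.getElem?_eq_some_iff.mpr ⟨by omega, ?_⟩]
        · rfl
        · congr 1
          omega
  · have hcw := List.isChain_iff_getElem.mp hw.chain
    simp only [stringSchema, List.get_eq_getElem] at h1 h2
    cases hk : (S.map Step.letter)[k.val] with
    | fwd a =>
      cases hk' : (S.map Step.letter)[k'.val] with
      | fwd b =>
        rw [hk, hk'] at h2
        exact Fin.castSucc_injective _ h2
      | bwd b =>
        rw [hk, hk'] at h2 h1
        have e : k.val = k'.val + 1 := congrArg Fin.val h2
        have h3 := hcw k'.val (e ▸ k.isLt)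
        simp only [← e, hk, hk'] at h3
        exact absurd h1.symm h3.2
    | bwd a =>
      cases hk' : (S.map Step.letter)[k'.val] with
      | fwd b =>
        rw [hk, hk'] at h2 h1
        have e : k.val + 1 = k'.val := congrArg Fin.val h2
        have h3 := hcw k.val (e ▸ k'.isLt)
        simp only [e, hk, hk'] at h3
        exact absurd h1 h3.2
      | bwd b =>
        rw [hk, hk'] at h2
        exact Fin.succ_injective _ h2

/-- Removing the last step, if that step is direct and ends in zero or is inverse. -/
theorem last_of_dropLast {S : List (Step K ι V)} {t : Step K ι V}
    (hstep : ∀ s ∈ S ++ [t], σ.IsStep c d s) (hchain : (S ++ [t]).IsChain (σ.Follows c d))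
    (ht : ∀ a, t.letter = .fwd a → σ.cls c d t.tgt = 0) :
    ∀ s ∈ S.getLast?, ∀ a, arrowElt K G a • σ.cls c d s.tgt ≠ 0 → s.letter = .bwd a := by
  intro s hs a ha
  have hf := (List.isChain_append.mp hchain).2.2 s hs t rfl
  rcases hf.zero a ha with h | h
  · exact h
  · rw [hf.eq, (hstep t (by simp)).fwd a h, ht a h] at ha
    exact absurd rfl ha

/-- The part of a walk that remains after removing its first step, if that step is inverse and
starts in zero or is direct. -/
theorem realizes_tail {S : List (Step K ι V)} {t : Step K ι V}
    (hstep : ∀ s ∈ t :: S, σ.IsStep c d s) (hchain : (t :: S).IsChain (σ.Follows c d))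
    (ht : ∀ a, t.letter = .bwd a → σ.cls c d t.src = 0)
    (hlast : ∀ s ∈ (t :: S).getLast?, ∀ a, arrowElt K G a • σ.cls c d s.tgt ≠ 0 →
      s.letter = .bwd a) :
    σ.Realizes c d t.tgt S t.letter.target where
  step s hs := hstep s (List.mem_cons_of_mem _ hs)
  chain := hchain.tail
  head s hs := by
    cases S with
    | nil => cases hs
    | cons s' S =>
      cases hs
      have := (List.isChain_cons_cons.mp hchain).1
      exact ⟨this.eq, this.comp.1.symm⟩
  start := (hstep t (by simp)).target
  first a ha := by
    have hb : t.letter ≠ .bwd a := by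
      intro h
      rw [(hstep t (by simp)).bwd a h, ht a h] at ha
      exact ha rfl
    cases S with
    | nil => exact absurd (hlast t rfl a ha) hb
    | cons s' S =>
      have := (List.isChain_cons_cons.mp hchain).1
      exact ⟨s', rfl, (this.zero a ha).resolve_left hb⟩
  last s hs := by
    cases S with
    | nil => cases hs
    | cons s' S => exact hlast s (by rwa [List.getLast?_cons_cons])

end HSequence

end Walks

/-! ### The walk of an alternating sequence of homotopy letters -/

section Runs

variable {K : Type u} [Field K] [Fintype V] {G : GentleQuiver V} {ι : Type} [CommRing ι]

/-- The steps along the path `p` in the summand at place `j`. -/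
def fwdSteps (η : K) (j : ι) (p : List (Arrow V)) : List (Step K ι V) :=
  List.ofFn fun t : Fin p.length =>
    ⟨(η, j, p.take t), .fwd p[t], (η, j, p.take (t + 1))⟩

/-- The steps against the direction of the path `p` in the summand at place `j`. -/
def bwdSteps (η : K) (j : ι) (p : List (Arrow V)) : List (Step K ι V) :=
  (List.ofFn fun t : Fin p.length =>
    ⟨(η, j, p.take (t + 1)), .bwd p[t], (η, j, p.take t)⟩).reverse

theorem fwdSteps_map_letter (η : K) (j : ι) (p : List (Arrow V)) :
    (fwdSteps η j p).map Step.letter = p.map Letter.fwd := by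
  apply List.ext_getElem <;> simp [fwdSteps]

theorem bwdSteps_map_letter (η : K) (j : ι) (p : List (Arrow V)) :
    (bwdSteps η j p).map Step.letter = (p.map Letter.bwd).reverse := by
  rw [bwdSteps, List.map_reverse]
  congr 1
  apply List.ext_getElem <;> simp

theorem of_mem_head?_fwdSteps {η : K} {j : ι} {p : List (Arrow V)} {s : Step K ι V}
    (h : s ∈ (fwdSteps η j p).head?) :
    ∃ a, p.head? = some a ∧ s.letter = .fwd a ∧ s.src = (η, j, []) := by
  rw [List.head?_eq_getElem?] at h
  obtain ⟨hk, rfl⟩ := List.getElem?_eq_some_iff.mp h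
  simp only [fwdSteps, List.length_ofFn] at hk
  exact ⟨p[0], by rw [List.head?_eq_getElem?, List.getElem?_eq_getElem hk], by simp [fwdSteps],
    by simp [fwdSteps]⟩

theorem of_mem_getLast?_fwdSteps {η : K} {j : ι} {p : List (Arrow V)} {s : Step K ι V}
    (h : s ∈ (fwdSteps η j p).getLast?) :
    ∃ a, p.getLast? = some a ∧ s.letter = .fwd a ∧ s.tgt = (η, j, p) := by
  rw [List.getLast?_eq_getElem?] at h
  obtain ⟨hk, rfl⟩ := List.getElem?_eq_some_iff.mp h
  simp only [fwdSteps, List.length_ofFn] at hk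
  have hk' : p.length - 1 + 1 = p.length := by omega
  exact ⟨p[p.length - 1], by rw [List.getLast?_eq_getElem?, List.getElem?_eq_getElem hk],
    by simp [fwdSteps], by simp [fwdSteps, hk']⟩

theorem of_mem_head?_bwdSteps {η : K} {j : ι} {p : List (Arrow V)} {s : Step K ι V}
    (h : s ∈ (bwdSteps η j p).head?) :
    ∃ a, p.getLast? = some a ∧ s.letter = .bwd a ∧ s.src = (η, j, p) := by
  rw [bwdSteps, List.head?_reverse, List.getLast?_eq_getElem?] at h
  obtain ⟨hk, rfl⟩ := List.getElem?_eq_some_iff.mp h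
  simp only [List.length_ofFn] at hk
  have hk' : p.length - 1 + 1 = p.length := by omega
  exact ⟨p[p.length - 1], by rw [List.getLast?_eq_getElem?, List.getElem?_eq_getElem hk],
    by simp, by simp [hk']⟩

theorem of_mem_getLast?_bwdSteps {η : K} {j : ι} {p : List (Arrow V)} {s : Step K ι V}
    (h : s ∈ (bwdSteps η j p).getLast?) :
    ∃ a, p.head? = some a ∧ s.letter = .bwd a ∧ s.tgt = (η, j, []) := by
  rw [bwdSteps, List.getLast?_reverse, List.head?_eq_getElem?] at h
  obtain ⟨hk, rfl⟩ := List.getElem?_eq_some_iff.mp h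
  simp only [List.length_ofFn] at hk
  exact ⟨p[0], by rw [List.head?_eq_getElem?, List.getElem?_eq_getElem hk], by simp, by simp⟩

theorem length_fwdSteps (η : K) (j : ι) (p : List (Arrow V)) :
    (fwdSteps η j p).length = p.length := by simp [fwdSteps]

theorem length_bwdSteps (η : K) (j : ι) (p : List (Arrow V)) :
    (bwdSteps η j p).length = p.length := by simp [bwdSteps]

theorem isChain_reverse_ofFn {α : Type*} {R : α → α → Prop} {n : ℕ} {f : Fin n → α}
    (h : ∀ (t : ℕ) (ht : t + 1 < n), R (f ⟨t + 1, ht⟩) (f ⟨t, by omega⟩)) :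
    (List.ofFn f).reverse.IsChain R := by
  rw [List.isChain_reverse, List.isChain_iff_getElem]
  intro t ht
  simp only [List.length_ofFn] at ht
  simpa using h t ht

namespace HSequence

variable {σ : HSequence G ι} {c : ι → K} {d : ℤ}

theorem arrowElt_smul_cls (a : Arrow V) (η : K) (j : ι) (p : List (Arrow V)) :
    arrowElt K G a • σ.cls c d (η, j, p) = σ.cls c d (η, j, p ++ [a]) := by
  rw [cls, cls, ← Submodule.Quotient.mk_smul, smul_comm, arrowElt_smul_vec]

theorem vertexElt_smul_cls (η : K) (j : ι) (p : List (Arrow V)) {x : V}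
    (hx : pathEnd (σ.vertex j) p = x) :
    vertexElt K G x • σ.cls c d (η, j, p) = σ.cls c d (η, j, p) := by
  rw [cls, ← Submodule.Quotient.mk_smul, smul_comm, ← hx, vertexElt_smul_vec]

theorem isPathFrom_of_cls_ne_zero {η : K} {j : ι} {p : List (Arrow V)}
    (h : σ.cls c d (η, j, p) ≠ 0) : G.IsPathFrom (σ.vertex j) p := by
  by_contra hp
  refine h ?_
  rw [cls, vec_eq_zero fun h' => hp h'.path, smul_zero]
  rfl

/-- An arrow that does not annihilate the class of a path prolongs this path. -/
theorem prolongs_of_smul_ne_zero {a : Arrow V} {η : K} {j : ι} {p : List (Arrow V)}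
    (h : arrowElt K G a • σ.cls c d (η, j, p) ≠ 0) : G.IsPathFrom (σ.vertex j) p ∧
      pathEnd (σ.vertex j) p = a.left ∧ ∀ b, p.getLast? = some b → ¬ G.rel a b := by
  rw [arrowElt_smul_cls] at h
  exact GentleQuiver.isPathFrom_concat.mp (isPathFrom_of_cls_ne_zero h)

theorem smul_eq_zero_of_isTerminal {a : Arrow V} {η : K} {j : ι} {p : List (Arrow V)}
    (hp : G.IsTerminal p) (hne : p ≠ []) : arrowElt K G a • σ.cls c d (η, j, p) = 0 := by
  by_contra h
  obtain ⟨-, h1, h2⟩ := prolongs_of_smul_ne_zero h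
  obtain ⟨b, hb⟩ := Option.ne_none_iff_exists'.mp (mt List.getLast?_eq_none_iff.mp hne)
  rw [pathEnd, hb] at h1
  exact h2 b hb (hp b hb a h1)

theorem take_succ_getLast? {p : List (Arrow V)} {t : ℕ} (ht : t < p.length) :
    (p.take (t + 1)).getLast? = some p[t] := by
  rw [← List.take_append_getElem ht, List.getLast?_concat]

theorem pathEnd_take_succ (x : V) {p : List (Arrow V)} {t : ℕ} (ht : t < p.length) :
    pathEnd x (p.take (t + 1)) = p[t].right := by
  rw [pathEnd, take_succ_getLast? ht]
  rfl

theorem pathEnd_take {x : V} {p : List (Arrow V)} (hp : G.IsPathFrom x p) {t : ℕ}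
    (ht : t < p.length) : pathEnd x (p.take t) = p[t].left := by
  cases t with
  | zero =>
    refine (hp.source _ ?_).symm
    rw [List.head?_eq_getElem?, List.getElem?_eq_getElem ht]
  | succ t =>
    rw [pathEnd_take_succ _ (by omega)]
    exact ((List.isChain_iff_getElem.mp hp.chain) t ht).1

/-- Along a path, only its next arrow acts nontrivially. -/
theorem eq_getElem_of_smul_ne_zero {a : Arrow V} {η : K} {j : ι} {p : List (Arrow V)} {t : ℕ}
    (hp : G.IsPathFrom (σ.vertex j) p) (ht : t + 1 < p.length)
    (h : arrowElt K G a • σ.cls c d (η, j, p.take (t + 1)) ≠ 0) : a = p[t + 1] := by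
  obtain ⟨-, h1, h2⟩ := prolongs_of_smul_ne_zero h
  rw [pathEnd_take_succ _ (by omega)] at h1
  exact G.nonrel_after p[t] ⟨h1, h2 _ (take_succ_getLast? (by omega))⟩
    ((List.isChain_iff_getElem.mp hp.chain) t ht)

theorem isStep_fwdSteps (η : K) (j : ι) (p : List (Arrow V)) :
    ∀ s ∈ fwdSteps η j p, σ.IsStep c d s := by
  intro s hs
  obtain ⟨t, rfl⟩ := List.mem_ofFn.mp hs
  refine ⟨fun a ha => ?_, fun a ha => (by cases ha), ?_⟩
  · cases ha
    rw [arrowElt_smul_cls]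
    simp
  · exact vertexElt_smul_cls _ _ _ (pathEnd_take_succ _ t.isLt)

theorem isStep_bwdSteps (η : K) {j : ι} {p : List (Arrow V)}
    (hp : G.IsPathFrom (σ.vertex j) p) :
    ∀ s ∈ bwdSteps η j p, σ.IsStep c d s := by
  intro s hs
  obtain ⟨t, rfl⟩ := List.mem_ofFn.mp (List.mem_reverse.mp hs)
  refine ⟨fun a ha => (by cases ha), fun a ha => ?_, ?_⟩
  · cases ha
    rw [arrowElt_smul_cls]
    simp
  · exact vertexElt_smul_cls _ _ _ (pathEnd_take hp t.isLt)

theorem isChain_fwdSteps (η : K) {j : ι} {p : List (Arrow V)}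
    (hp : G.IsPathFrom (σ.vertex j) p) :
    (fwdSteps η j p).IsChain (σ.Follows c d) := by
  rw [List.isChain_iff_getElem]
  intro t ht
  simp only [fwdSteps, List.length_ofFn] at ht
  simp only [fwdSteps, List.getElem_ofFn, Fin.getElem_fin]
  refine ⟨(List.isChain_iff_getElem.mp hp.chain) t ht, rfl, fun a ha => Or.inr ?_⟩
  rw [eq_getElem_of_smul_ne_zero hp ht ha]

theorem isChain_bwdSteps (η : K) {j : ι} {p : List (Arrow V)}
    (hp : G.IsPathFrom (σ.vertex j) p) :
    (bwdSteps η j p).IsChain (σ.Follows c d) := by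
  refine isChain_reverse_ofFn fun t ht => ?_
  have h := (List.isChain_iff_getElem.mp hp.chain) t ht
  refine ⟨⟨h.1.symm, h.2⟩, rfl, fun a ha => Or.inl ?_⟩
  rw [eq_getElem_of_smul_ne_zero hp ht ha]
  rfl

/-- The steps along the homotopy letter `L` with index `i`; they lie in the summand to which the
differential maps. -/
def letterSteps (η : K) (i : ι) : HLetter V → List (Step K ι V)
  | .direct p => fwdSteps η i p
  | .inverse p => bwdSteps η (i + 1) p

theorem letterSteps_map_letter (η : K) (i : ι) (L : HLetter V) :
    (letterSteps η i L).map Step.letter = L.walk := by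
  cases L
  · exact fwdSteps_map_letter _ _ _
  · exact bwdSteps_map_letter _ _ _

theorem length_letterSteps (η : K) (i : ι) (L : HLetter V) :
    (letterSteps η i L).length = L.walk.length := by
  rw [← letterSteps_map_letter η i L, List.length_map]

/-- One of the two homotopy letters is direct and the other one inverse. -/
def Opposite : HLetter V → HLetter V → Prop
  | .direct _, .inverse _ => True
  | .inverse _, .direct _ => True
  | _, _ => False

namespace Completion

variable (E : σ.Completion)

/-- The letters with index `i, …, i + m - 1` of the completed sequence alternate. -/
structure IsAlternatingRun (i : ι) (m : ℕ) : Prop where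
  one_le : 1 ≤ m
  touches : i ∈ σ.pos ∨ i + 1 ∈ σ.pos
  inner : ∀ k : ℕ, k + 1 < m → i + k + 1 ∈ σ.pos ∧ Opposite (E.L (i + k)) (E.L (i + k + 1))

/-- The degree to which the letter with index `i` contributes. -/
def letterDeg (i : ι) : ℤ :=
  match E.L i with
  | .direct _ => σ.deg i
  | .inverse _ => σ.deg (i + 1)

/-- The scalar on the basis vectors in the `k`-th letter after the letter with index `i`, such that
the two paths with the same source give the same class modulo coboundaries. -/
def runCoef (c : ι → K) (i : ι) : ℕ → K
  | 0 => 1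
  | k + 1 =>
    match E.L (i + k) with
    | .direct _ => -(runCoef c i k * c (i + k + 1) / c (i + k))
    | .inverse _ => runCoef c i k

/-- The steps along the `m` letters from the index `i` on. -/
def runSteps (c : ι → K) (i : ι) (m : ℕ) : List (Step K ι V) :=
  (List.range m).flatMap fun k => letterSteps (E.runCoef c i k) (i + k) (E.L (i + k))

variable {E}

theorem runCoef_ne_zero (hc : ∀ i, c i ≠ 0) (i : ι) (k : ℕ) : E.runCoef c i k ≠ 0 := by
  induction k with
  | zero => exact one_ne_zero
  | succ k ih =>
    rw [runCoef]
    split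
    · exact neg_ne_zero.mpr (div_ne_zero (mul_ne_zero ih (hc _)) (hc _))
    · exact ih

theorem runSteps_succ (c : ι → K) (i : ι) (m : ℕ) : E.runSteps c i (m + 1) =
    E.runSteps c i m ++ letterSteps (E.runCoef c i m) (i + m) (E.L (i + m)) := by
  simp [runSteps, List.range_succ]

theorem mem_pos_of_direct {i : ι} {q : List (Arrow V)} (h : E.L i = .direct q)
    (hi : i ∈ σ.pos ∨ i + 1 ∈ σ.pos) : i ∈ σ.pos := by
  rcases hi with hi | hi
  · exact hi
  · exact (pos_of_letter (letter_of_direct h hi)).1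

theorem mem_pos_of_inverse {i : ι} {q : List (Arrow V)} (h : E.L i = .inverse q)
    (hi : i ∈ σ.pos ∨ i + 1 ∈ σ.pos) : i + 1 ∈ σ.pos := by
  rcases hi with hi | hi
  · exact (pos_of_letter (letter_of_inverse h hi)).2
  · exact hi

theorem letterDeg_direct {i : ι} {q : List (Arrow V)} (h : E.L i = .direct q) :
    E.letterDeg i = σ.deg i := by rw [letterDeg, h]

theorem letterDeg_inverse {i : ι} {q : List (Arrow V)} (h : E.L i = .inverse q) :
    E.letterDeg i = σ.deg (i + 1) := by rw [letterDeg, h]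

theorem letterDeg_succ {i : ι} (hi : i + 1 ∈ σ.pos) (h : Opposite (E.L i) (E.L (i + 1))) :
    E.letterDeg (i + 1) = E.letterDeg i := by
  rcases hA : E.L i with p | p <;> rcases hB : E.L (i + 1) with q | q <;> rw [hA, hB] at h
  · exact h.elim
  · rw [letterDeg_direct hA, letterDeg_inverse hB]
    have h1 := σ.direct_deg _ _ (letter_of_direct hA hi)
    have h2 := σ.inverse_deg _ _ (letter_of_inverse hB hi)
    omega
  · rw [letterDeg_inverse hA, letterDeg_direct hB]
  · exact h.elim

namespace IsAlternatingRun

variable {i : ι} {m : ℕ}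

theorem touches_add (h : E.IsAlternatingRun i m) {k : ℕ} (hk : k < m) :
    i + k ∈ σ.pos ∨ i + k + 1 ∈ σ.pos := by
  cases k with
  | zero => simpa using h.touches
  | succ k =>
    left
    have := (h.inner k hk).1
    rwa [add_assoc, ← Nat.cast_add_one] at this

theorem letterDeg_add (h : E.IsAlternatingRun i m) {k : ℕ} (hk : k < m) :
    E.letterDeg (i + k) = E.letterDeg i := by
  induction k with
  | zero => simp
  | succ k ih =>
    have h1 := h.inner k hk
    rw [← ih (by omega), Nat.cast_add_one, ← add_assoc, letterDeg_succ h1.1 h1.2]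

end IsAlternatingRun

theorem isStep_and_isChain_letterSteps (c : ι → K) {d : ℤ} (η : K) {i : ι}
    (hi : i ∈ σ.pos ∨ i + 1 ∈ σ.pos) :
    (∀ s ∈ letterSteps η i (E.L i), σ.IsStep c d s) ∧
      (letterSteps η i (E.L i)).IsChain (σ.Follows c d) := by
  rcases hL : E.L i with p | p
  · exact ⟨isStep_fwdSteps _ _ _, isChain_fwdSteps _ (path_direct hL (mem_pos_of_direct hL hi))⟩
  · have := path_inverse hL (mem_pos_of_inverse hL hi)
    exact ⟨isStep_bwdSteps _ this, isChain_bwdSteps _ this⟩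

/-- Modulo coboundaries, the two components of the differential of a path in the summand between a
direct letter and a following inverse letter agree up to a scalar. -/
theorem cls_direct_eq (hc : ∀ i, c i ≠ 0) {i : ι} {p q : List (Arrow V)}
    (hp : σ.letter i = some (.direct p)) (hq : σ.letter (i + 1) = some (.inverse q)) (η : K)
    (u : List (Arrow V)) (hd : σ.deg i = d) :
    σ.cls c d (η, i, p ++ u) =
      σ.cls c d (-(η * c (i + 1) / c i), i + 1 + 1, q ++ u) := by
  rw [cls, cls, Submodule.Quotient.eq]
  have hdeg := σ.direct_deg _ _ hp
  have hz := diff_vec (K := K) (σ := σ) c d (d := d - 1) (j := i + 1)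
    ⟨(pos_of_letter hp).2, by omega⟩ u
  rw [nextVec, prevVec, add_sub_cancel_right, hq, hp] at hz
  simp only at hz
  refine ⟨algebraMap K (GentleAlgebra K G) (η / c i) • σ.vec K (d - 1) (i + 1, u), ?_⟩
  rw [map_smul, hz, algebraMap_smul, smul_add, smul_smul, smul_smul, div_mul_cancel₀ _ (hc i),
    sub_eq_add_neg, add_comm _ (η • _)]
  refine congrArg (η • σ.vec K d (i, p ++ u) + ·) (eq_neg_of_add_eq_zero_left ?_)
  rw [← add_smul, mul_div_right_comm, add_neg_cancel, zero_smul]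

/-- The walks along two consecutive letters of opposite directions fit together. Where a direct letter
is followed by an inverse one, the change of the scalar makes the classes agree. -/
theorem follows_of_opposite (hc : ∀ i, c i ≠ 0) {i : ι} (hi : i + 1 ∈ σ.pos) {η η' : K}
    (hd : E.letterDeg i = d) (h : Opposite (E.L i) (E.L (i + 1)))
    (hη : η' = match E.L i with
      | .direct _ => -(η * c (i + 1) / c i)
      | .inverse _ => η)
    {s t : Step K ι V} (hs : s ∈ (letterSteps η i (E.L i)).getLast?)
    (ht : t ∈ (letterSteps η' (i + 1) (E.L (i + 1))).head?) : σ.Follows c d s t := by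
  have hm := E.meet i hi
  rcases hA : E.L i with p | p <;> rcases hB : E.L (i + 1) with q | q <;>
    simp only [hA, hB] at h hη hs ht hm
  · exact h.elim
  · -- two paths with the same source
    have hlA := letter_of_direct hA hi
    have hlB := letter_of_inverse hB hi
    have hpA := σ.direct_path _ _ hlA
    have hpB := σ.inverse_path _ _ hlB
    rw [letterDeg_direct hA] at hd
    obtain ⟨a, ha, hsl, hst⟩ := of_mem_getLast?_fwdSteps hs
    obtain ⟨b, hb, htl, htt⟩ := of_mem_head?_bwdSteps ht
    refine ⟨?_, ?_, fun e he => ?_⟩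
    · rw [hsl, htl]
      refine ⟨?_, ?_⟩
      · have h1 : a.right = σ.vertex (i + 1) := by simpa [ha] using hpA.target
        have h2 : b.right = σ.vertex (i + 1) := by simpa [hb] using hpB.target
        exact h1.trans h2.symm
      · rintro rfl
        exact hm (ha.trans hb.symm)
    · rw [hst, htt, hη]
      have := cls_direct_eq hc hlA hlB η [] hd
      simpa using this
    · exfalso
      rw [hst, arrowElt_smul_cls] at he
      have h1 := isPathFrom_of_cls_ne_zero he
      rw [cls_direct_eq hc hlA hlB η [e] hd] at he
      have h2 := isPathFrom_of_cls_ne_zero he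
      exact absurd (GentleQuiver.eq_nil_of_append hpA.ne_nil hm h1 h2 hpB.ne_nil) (by simp)
  · -- two paths that start at the same place
    obtain ⟨a, ha, hsl, hst⟩ := of_mem_getLast?_bwdSteps hs
    obtain ⟨b, hb, htl, htt⟩ := of_mem_head?_fwdSteps ht
    refine ⟨?_, ?_, fun e he => ?_⟩
    · rw [hsl, htl]
      refine ⟨?_, ?_⟩
      · have h1 := (path_inverse hA hi).source a ha
        have h2 := (path_direct hB hi).source b hb
        exact h1.trans h2.symm
      · rintro rfl
        exact hm.2 _ ha hb
    · rw [hst, htt, hη]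
    · rw [hst] at he
      obtain ⟨-, h1, -⟩ := prolongs_of_smul_ne_zero he
      rcases hm.1 e h1.symm with h2 | h2
      · rw [ha, Option.some.injEq] at h2
        exact Or.inl (by rw [hsl, h2])
      · rw [hb, Option.some.injEq] at h2
        exact Or.inr (by rw [htl, h2])
  · exact h.elim

/-- Only the first and the last letter of an alternating sequence can be virtual, so the other
ones are not trivial. -/
theorem letterSteps_ne_nil {i : ι} (hi : i ∈ σ.pos) (hi' : i + 1 ∈ σ.pos) (η : K) :
    letterSteps η i (E.L i) ≠ [] := by
  rw [← List.length_pos_iff]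
  rcases hL : E.L i with p | p
  · rw [letterSteps, length_fwdSteps]
    exact List.length_pos_iff.mpr (σ.direct_path _ _ (letter_of_direct hL hi')).ne_nil
  · rw [letterSteps, length_bwdSteps]
    exact List.length_pos_iff.mpr (σ.inverse_path _ _ (letter_of_inverse hL hi)).ne_nil

theorem isChain_flatMap_range {α : Type*} {R : α → α → Prop} {f : ℕ → List α} {m : ℕ}
    (h1 : ∀ k < m, (f k).IsChain R)
    (h2 : ∀ k, k + 1 < m → ∀ x ∈ (f k).getLast?, ∀ y ∈ (f (k + 1)).head?, R x y)
    (h3 : ∀ k, 0 < k → k + 1 < m → f k ≠ []) : ((List.range m).flatMap f).IsChain R := by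
  induction m with
  | zero => simp
  | succ m ih =>
    rw [List.range_succ, List.flatMap_append, List.isChain_append]
    refine ⟨ih (fun k hk => h1 k (by omega)) (fun k hk => h2 k (by omega))
      fun k hk hk' => h3 k hk (by omega), by simpa using h1 m (by omega), ?_⟩
    intro x hx y hy
    simp only [List.flatMap_cons, List.flatMap_nil, List.append_nil] at hy
    cases m with
    | zero => simp at hx
    | succ m =>
      refine h2 m (by omega) x ?_ y hy
      rw [List.range_succ, List.flatMap_append] at hx
      simp only [List.flatMap_cons, List.flatMap_nil, List.append_nil] at hx
      by_cases hf : f m = []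
      · rw [hf, List.append_nil] at hx
        cases m with
        | zero => simp at hx
        | succ m => exact absurd hf (h3 _ (by omega) (by omega))
      · rwa [List.getLast?_append_of_ne_nil _ hf] at hx

theorem IsAlternatingRun.isStep {i : ι} {m : ℕ} (h : E.IsAlternatingRun i m) (c : ι → K)
    (d : ℤ) : ∀ s ∈ E.runSteps c i m, σ.IsStep c d s := by
  intro s hs
  obtain ⟨k, hk, hs⟩ := List.mem_flatMap.mp hs
  exact (isStep_and_isChain_letterSteps c _ (h.touches_add (List.mem_range.mp hk))).1 s hs

theorem IsAlternatingRun.isChain {i : ι} {m : ℕ} (h : E.IsAlternatingRun i m)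
    (hc : ∀ i, c i ≠ 0) (hd : E.letterDeg i = d) :
    (E.runSteps c i m).IsChain (σ.Follows c d) := by
  have cast : ∀ k : ℕ, i + ((k + 1 : ℕ) : ι) = i + k + 1 := fun k => by
    rw [Nat.cast_add_one, add_assoc]
  refine isChain_flatMap_range (fun k hk => (isStep_and_isChain_letterSteps c _ (h.touches_add hk)).2)
    (fun k hk s hs t ht => ?_) fun k hk hk' => ?_
  · obtain ⟨h1, h2⟩ := h.inner k hk
    rw [cast] at ht
    exact follows_of_opposite hc h1 ((h.letterDeg_add (by omega)).trans hd) h2 rfl hs ht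
  · obtain ⟨k, rfl⟩ : ∃ k', k = k' + 1 := ⟨k - 1, by omega⟩
    rw [cast]
    have h2 := (h.inner _ hk').1
    rw [cast] at h2
    exact letterSteps_ne_nil (h.inner k (by omega)).1 h2 _

end Completion

end HSequence

end Runs

/-! ### The classes along an alternating sequence -/

section Runs

variable {K : Type u} [Field K] [Fintype V] {G : GentleQuiver V} {ι : Type} [CommRing ι]

namespace HSequence

variable {σ : HSequence G ι} {c : ι → K} {d : ℤ}

namespace Completion

variable {E : σ.Completion}

variable (E) in
/-- The basis vector `b` is an initial piece of the homotopy letter with index `i`, in the summand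
to which the differential maps; the trivial path is only counted for inverse letters. -/
def Carries (i : ι) (b : ι × List (Arrow V)) : Prop :=
  (b.1 = i ∧ i ∈ σ.pos ∧ ∃ q, E.L i = .direct q ∧ b.2 ≠ [] ∧ b.2 <+: q) ∨
  (b.1 = i + 1 ∧ i + 1 ∈ σ.pos ∧ ∃ r, E.L i = .inverse r ∧ b.2 <+: r)

theorem Owns.carries {i : ι} {b : ι × List (Arrow V)} (h : E.Owns i b) : E.Carries i b := by
  rcases h with ⟨h1, h2, q, h3, h4, h5, -⟩ | ⟨h1, h2, q, h3, h4, -⟩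
  · exact Or.inl ⟨h1, h2, q, h3, h4, h5⟩
  · exact Or.inr ⟨h1, h2, q, h3, h4⟩

/-- A basis vector is carried by at most one letter. -/
theorem Carries.index_unique {i i' : ι} {b : ι × List (Arrow V)} (h : E.Carries i b)
    (h' : E.Carries i' b) : i = i' := by
  rcases h with ⟨h1, h2, q, h3, h4, h5⟩ | ⟨h1, h2, q, h3, h5⟩ <;>
    rcases h' with ⟨h1', h2', q', h3', h4', h5'⟩ | ⟨h1', h2', q', h3', h5'⟩
  · exact h1.symm.trans h1'
  · obtain rfl : i = i' + 1 := h1.symm.trans h1'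
    have hm := E.meet i' h2
    rw [h3, h3'] at hm
    exact (IsValley.false_of_head hm (head?_eq_of_prefix h5' h4) (head?_eq_of_prefix h5 h4)
      h4).elim
  · obtain rfl : i' = i + 1 := h1'.symm.trans h1
    have hm := E.meet i h2'
    rw [h3, h3'] at hm
    exact (IsValley.false_of_head hm (head?_eq_of_prefix h5 h4') (head?_eq_of_prefix h5' h4')
      h4').elim
  · exact add_right_cancel (h1.symm.trans h1')

theorem Owns.letterDeg_eq {i : ι} {b : ι × List (Arrow V)} (h : E.Owns i b) :
    E.letterDeg i = σ.deg b.1 := by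
  rcases h with ⟨h1, -, q, h3, -⟩ | ⟨h1, -, q, h3, -⟩
  · rw [letterDeg_direct h3, h1]
  · rw [letterDeg_inverse h3, h1]

theorem mem_targets_fwdSteps {η : K} {j : ι} {p : List (Arrow V)} {b : ι × List (Arrow V)} :
    b ∈ (fwdSteps η j p).map (fun s => s.tgt.2) ↔ b.1 = j ∧ b.2 ≠ [] ∧ b.2 <+: p := by
  simp only [fwdSteps, List.mem_map, List.mem_ofFn, exists_exists_eq_and]
  constructor
  · rintro ⟨t, rfl⟩
    refine ⟨rfl, ?_, List.take_prefix _ _⟩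
    have := t.isLt
    rw [ne_eq, ← List.length_eq_zero_iff, List.length_take]
    omega
  · obtain ⟨j', u⟩ := b
    rintro ⟨rfl, hu, hp⟩
    have h1 := hp.length_le
    have h2 : 0 < u.length := List.length_pos_iff.mpr hu
    simp only at h1 h2
    refine ⟨⟨u.length - 1, by omega⟩, ?_⟩
    simp only [Nat.sub_add_cancel (show 1 ≤ u.length from h2)]
    rw [← List.prefix_iff_eq_take.mp hp]

theorem mem_targets_bwdSteps {η : K} {j : ι} {p : List (Arrow V)} {b : ι × List (Arrow V)} :
    b ∈ (bwdSteps η j p).map (fun s => s.tgt.2) ↔ b.1 = j ∧ b.2 <+: p ∧ b.2 ≠ p := by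
  simp only [bwdSteps, List.mem_map, List.mem_reverse, List.mem_ofFn, exists_exists_eq_and]
  constructor
  · rintro ⟨t, rfl⟩
    refine ⟨rfl, List.take_prefix _ _, fun h => ?_⟩
    have := t.isLt
    have h1 := congrArg List.length h
    simp only [List.length_take] at h1
    omega
  · obtain ⟨j', u⟩ := b
    rintro ⟨rfl, hp, hne⟩
    have h1 := hp.length_le
    have h2 : u.length ≠ p.length := fun h => hne (hp.eq_of_length h)
    simp only at h1 h2
    refine ⟨⟨u.length, by omega⟩, ?_⟩
    simp only
    rw [← List.prefix_iff_eq_take.mp hp]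

theorem nodup_targets_letterSteps (η : K) (i : ι) (L : HLetter V) :
    ((letterSteps η i L).map (fun s => s.tgt.2)).Nodup := by
  have take_inj : ∀ (p : List (Arrow V)) (s t : ℕ), s ≤ p.length → t ≤ p.length →
      p.take s = p.take t → s = t := by
    intro p s t hs ht h
    have := congrArg List.length h
    simp only [List.length_take] at this
    omega
  cases L with
  | direct p =>
    rw [letterSteps, fwdSteps, List.map_ofFn, List.nodup_ofFn]
    intro s t h
    have h1 := take_inj p _ _ s.isLt t.isLt (Prod.ext_iff.mp h).2
    exact Fin.ext (by omega)
  | inverse p =>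
    rw [letterSteps, bwdSteps, List.map_reverse, List.nodup_reverse, List.map_ofFn,
      List.nodup_ofFn]
    intro s t h
    exact Fin.ext (take_inj p _ _ s.isLt.le t.isLt.le (Prod.ext_iff.mp h).2)

theorem carries_of_mem_targets {η : K} {i : ι} {b : ι × List (Arrow V)}
    (hi : i ∈ σ.pos ∨ i + 1 ∈ σ.pos)
    (h : b ∈ (letterSteps η i (E.L i)).map (fun s => s.tgt.2)) : E.Carries i b := by
  rcases hL : E.L i with p | p <;> rw [hL] at h
  · obtain ⟨h1, h2, h3⟩ := mem_targets_fwdSteps.mp h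
    exact Or.inl ⟨h1, mem_pos_of_direct hL hi, p, hL, h2, h3⟩
  · obtain ⟨h1, h2, h3⟩ := mem_targets_bwdSteps.mp h
    exact Or.inr ⟨h1, mem_pos_of_inverse hL hi, p, hL, h2⟩

/-- The paths at which the steps along the letters end. -/
theorem mem_targets_runSteps {i : ι} {m : ℕ} {b : ι × List (Arrow V)} :
    b ∈ (E.runSteps c i m).map (fun s => s.tgt.2) ↔ ∃ k < m,
      b ∈ (letterSteps (E.runCoef c i k) (i + k) (E.L (i + k))).map (fun s => s.tgt.2) := by
  simp only [runSteps, List.map_flatMap, List.mem_flatMap, List.mem_range]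

theorem IsAlternatingRun.nodup_targets {i : ι} {m : ℕ} (h : E.IsAlternatingRun i m)
    (hinj : ∀ k k' : ℕ, k < k' → k' < m → i + (k : ι) ≠ i + k') :
    ((E.runSteps c i m).map (fun s => s.tgt.2)).Nodup := by
  rw [runSteps, List.map_flatMap, List.nodup_flatMap]
  refine ⟨fun k _ => nodup_targets_letterSteps _ _ _, ?_⟩
  refine List.Pairwise.imp_of_mem ?_ List.pairwise_lt_range
  intro k k' hk hk' hlt b hb hb'
  have h1 := carries_of_mem_targets (h.touches_add (List.mem_range.mp hk)) hb
  have h2 := carries_of_mem_targets (h.touches_add (List.mem_range.mp hk')) hb'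
  exact hinj k k' hlt (List.mem_range.mp hk') (h1.index_unique h2)

variable (E) in
/-- A maximal alternating sequence of letters of the completed sequence, which contributes a summand
to the cohomology. It is bounded on each side by a virtual letter or by a place at which the directions
of the letters agree. -/
structure IsRun (i : ι) (m : ℕ) : Prop extends E.IsAlternatingRun i m where
  right : i ∈ σ.pos → ¬ Opposite (E.L (i - 1)) (E.L i)
  left : ∀ k : ℕ, k + 1 = m → i + k + 1 ∈ σ.pos → ¬ Opposite (E.L (i + k)) (E.L (i + k + 1))
  ne_nil : m = 1 → (E.L i).walk ≠ []
  two_le : m = 1 → i ∈ σ.pos → i + 1 ∈ σ.pos → 2 ≤ (E.L i).walk.length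

theorem IsRun.index_ne {i : ι} {m : ℕ} (h : E.IsRun i m) (k k' : ℕ) (hk : k < k') (hk' : k' < m) :
    i + (k : ι) ≠ i + k' := by
  intro he
  obtain ⟨δ, rfl⟩ : ∃ δ, k' = k + (δ + 1) := ⟨k' - k - 1, by omega⟩
  have h0 : ((δ : ι) + 1) = 0 := by
    have := add_left_cancel he
    push_cast at this
    simpa using this
  obtain ⟨h1, h2⟩ := h.inner δ (by omega)
  rw [add_assoc, h0, add_zero] at h1 h2
  have h3 : i + (δ : ι) = i - 1 := by
    rw [eq_sub_iff_add_eq, add_assoc, h0, add_zero]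
  rw [h3] at h2
  exact h.right h1 h2

variable (E) in
/-- The node at which the walk along the letters from the index `i` on starts. -/
def startNode (K : Type u) [Field K] (i : ι) : K × ι × List (Arrow V) :=
  match E.L i with
  | .direct _ => (1, i, [])
  | .inverse p => (1, i + 1, p)

variable (E) in
open Classical in
/-- The nodes of the walk along the `m` letters from the index `i` on whose classes span the summand
of the cohomology. The first node is omitted if the first letter is not virtual, and likewise for
the last one. -/
def runNodes (c : ι → K) (i : ι) (m : ℕ) : List (K × ι × List (Arrow V)) :=
  let l := if i ∈ σ.pos then (E.runSteps c i m).map Step.tgt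
    else E.startNode K i :: (E.runSteps c i m).map Step.tgt
  if i + m ∈ σ.pos then l.dropLast else l

theorem mem_dropLast_of_nodup {α : Type*} {l l' : List α} {a : α} (hl : l = l' ++ [a])
    (hn : l.Nodup) (b : α) : b ∈ l.dropLast ↔ b ∈ l ∧ b ≠ a := by
  subst hl
  rw [List.dropLast_concat]
  rw [List.nodup_append] at hn
  constructor
  · exact fun h => ⟨List.mem_append_left _ h, hn.2.2 b h a (by simp)⟩
  · rintro ⟨h1, h2⟩
    rcases List.mem_append.mp h1 with h | h
    · exact h
    · exact absurd (List.mem_singleton.mp h) h2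

variable (E) in
/-- The path at which the walk along the letter with index `i` ends. -/
def lastPath (i : ι) : ι × List (Arrow V) :=
  match E.L i with
  | .direct p => (i, p)
  | .inverse _ => (i + 1, [])

theorem tgt_of_mem_getLast? {η : K} {i : ι} {s : Step K ι V}
    (h : s ∈ (letterSteps η i (E.L i)).getLast?) : s.tgt = (η, E.lastPath i) := by
  rw [lastPath]
  rcases hL : E.L i with p | p <;> rw [hL] at h
  · obtain ⟨a, -, -, h3⟩ := of_mem_getLast?_fwdSteps h
    exact h3
  · obtain ⟨a, -, -, h3⟩ := of_mem_getLast?_bwdSteps h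
    exact h3

/-- The last letter of a maximal alternating sequence that is bounded by a place is not
trivial. -/
theorem IsRun.last_ne_nil {i : ι} {n : ℕ} (h : E.IsRun i (n + 1)) (hp : i + n + 1 ∈ σ.pos)
    (η : K) : letterSteps η (i + n) (E.L (i + n)) ≠ [] := by
  cases n with
  | zero =>
    rw [← List.length_pos_iff, length_letterSteps]
    simpa [List.length_pos_iff] using h.ne_nil rfl
  | succ n =>
    refine letterSteps_ne_nil ?_ hp _
    have := (h.inner n (by omega)).1
    rwa [Nat.cast_add_one, ← add_assoc]

theorem IsRun.first_ne_nil {i : ι} {n : ℕ} (h : E.IsRun i (n + 1)) (hp : i ∈ σ.pos)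
    (η : K) : letterSteps η i (E.L i) ≠ [] := by
  cases n with
  | zero =>
    rw [← List.length_pos_iff, length_letterSteps]
    exact List.length_pos_iff.mpr (h.ne_nil rfl)
  | succ n =>
    refine letterSteps_ne_nil hp ?_ _
    simpa using (h.inner 0 (by omega)).1

open Classical in
theorem IsRun.nodup_nodes_aux {i : ι} {m : ℕ} (h : E.IsRun i m) :
    ((if i ∈ σ.pos then (E.runSteps c i m).map Step.tgt
      else E.startNode K i :: (E.runSteps c i m).map Step.tgt).map Prod.snd).Nodup := by
  classical
  have h0 := h.nodup_targets (c := c) h.index_ne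
  split_ifs with hi
  · rw [List.map_map]
    exact h0
  · rw [List.map_cons, List.map_map, List.nodup_cons]
    refine ⟨fun hmem => ?_, h0⟩
    have hi' := h.touches.resolve_left hi
    obtain ⟨r, hr, -⟩ := E.right_end i hi hi'
    have hst : (E.startNode K i).2 = (i + 1, r) := by rw [startNode, hr]
    rw [hst] at hmem
    obtain ⟨k, hk, hb⟩ := mem_targets_runSteps.mp hmem
    have h1 := carries_of_mem_targets (h.touches_add hk) hb
    have h2 : E.Carries i (i + 1, r) := Or.inr ⟨rfl, hi', r, hr, List.prefix_refl _⟩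
    have hk0 : k = 0 := by
      by_contra hk0
      exact h.index_ne 0 k (by omega) hk (by simpa using h2.index_unique h1)
    subst hk0
    simp only [Nat.cast_zero, add_zero, hr] at hb
    exact (mem_targets_bwdSteps.mp hb).2.2 rfl

theorem IsRun.nodup_runNodes {i : ι} {m : ℕ} (h : E.IsRun i m) :
    ((E.runNodes c i m).map Prod.snd).Nodup := by
  have h0 := h.nodup_nodes_aux (c := c)
  rw [runNodes]
  split_ifs with h1 h2 h2
  · rw [if_pos h2] at h0
    rw [List.map_dropLast]
    exact h0.sublist (List.dropLast_sublist _)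
  · rw [if_neg h2] at h0
    rw [List.map_dropLast]
    exact h0.sublist (List.dropLast_sublist _)
  · rwa [if_pos h2] at h0
  · rwa [if_neg h2] at h0

open Classical in
theorem mem_nodes_aux {i : ι} {m : ℕ} {b : ι × List (Arrow V)} :
    b ∈ (if i ∈ σ.pos then (E.runSteps c i m).map Step.tgt
      else E.startNode K i :: (E.runSteps c i m).map Step.tgt).map Prod.snd ↔
      (i ∉ σ.pos ∧ b = (E.startNode K i).2) ∨ b ∈ (E.runSteps c i m).map fun s => s.tgt.2 := by
  classical
  split_ifs with h
  · simp [h]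
  · simp [h]

/-- The nodes of a maximal alternating sequence are the paths which represent cohomology classes and
are carried by its letters. -/
theorem IsRun.mem_runNodes {i : ι} {m : ℕ} (h : E.IsRun i m) (b : ι × List (Arrow V)) :
    b ∈ (E.runNodes c i m).map Prod.snd ↔ ∃ k < m, E.Owns (i + k) b := by
  classical
  obtain ⟨n, rfl⟩ : ∃ n, m = n + 1 := ⟨m - 1, by have := h.one_le; omega⟩
  have cast : i + ((n + 1 : ℕ) : ι) = i + n + 1 := by push_cast; ring
  have hn := h.nodup_nodes_aux (c := c)
  -- the last node is omitted exactly if the last letter is not virtual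
  have hmem : b ∈ (E.runNodes c i (n + 1)).map Prod.snd ↔
      ((i ∉ σ.pos ∧ b = (E.startNode K i).2) ∨
        b ∈ (E.runSteps c i (n + 1)).map fun s => s.tgt.2) ∧
      (i + n + 1 ∈ σ.pos → b ≠ E.lastPath (i + n)) := by
    rw [← mem_nodes_aux]
    rw [runNodes, cast]
    by_cases h1 : i + n + 1 ∈ σ.pos
    · rw [if_pos h1, List.map_dropLast]
      simp only [h1, true_imp_iff]
      have hne := h.last_ne_nil h1 (E.runCoef c i n)
      obtain ⟨s, hs⟩ := Option.ne_none_iff_exists'.mp (mt List.getLast?_eq_none_iff.mp hne)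
      obtain ⟨l, hl⟩ := List.getLast?_eq_some_iff.mp hs
      have htgt := tgt_of_mem_getLast? hs
      have hS : ∃ l', (E.runSteps c i (n + 1)).map Step.tgt =
          l' ++ [(E.runCoef c i n, E.lastPath (i + n))] :=
        ⟨(E.runSteps c i n ++ l).map Step.tgt, by rw [runSteps_succ, hl]; simp [htgt]⟩
      obtain ⟨l', hl'⟩ := hS
      have : ∃ l'', (if i ∈ σ.pos then (E.runSteps c i (n + 1)).map Step.tgt
          else E.startNode K i :: (E.runSteps c i (n + 1)).map Step.tgt).map Prod.snd =
          l'' ++ [E.lastPath (i + n)] := by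
        rw [hl']
        split_ifs
        · exact ⟨l'.map Prod.snd, by simp⟩
        · exact ⟨(E.startNode K i).2 :: l'.map Prod.snd, by simp⟩
      obtain ⟨l'', hl''⟩ := this
      exact mem_dropLast_of_nodup hl'' hn b
    · rw [if_neg h1]
      simp only [h1, false_imp_iff, and_true]
  rw [hmem, mem_targets_runSteps]
  have opp : ∀ k, k + 1 < n + 1 → Opposite (E.L (i + k)) (E.L (i + k + 1)) :=
    fun k hk => (h.inner k hk).2
  constructor
  · rintro ⟨h1 | h1, h2⟩
    · -- the start of a walk whose first letter is virtual
      obtain ⟨hi, rfl⟩ := h1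
      have hi' := h.touches.resolve_left hi
      obtain ⟨r, hr, -⟩ := E.right_end i hi hi'
      have hst : (E.startNode K i).2 = (i + 1, r) := by rw [startNode, hr]
      rw [hst] at h2 ⊢
      refine ⟨0, by omega, Or.inr ⟨by simp, by simpa using hi', r, by simpa using hr,
        List.prefix_refl _, fun _ => by simpa using hi, fun hr0 => ?_⟩⟩
      simp only [Nat.cast_zero, add_zero]
      cases n with
      | zero =>
        exfalso
        simp only [Nat.cast_zero, add_zero, lastPath, hr] at h2
        simp only at hr0
        exact h2 hi' (by rw [hr0])
      | succ n =>
        have := opp 0 (by omega)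
        simp only [Nat.cast_zero, add_zero, hr] at this
        rcases hB : E.L (i + 1) with q | q
        · exact ⟨q, rfl⟩
        · rw [hB] at this
          exact this.elim
    · obtain ⟨k, hk, hb⟩ := h1
      refine ⟨k, hk, ?_⟩
      have ht := h.touches_add hk
      rcases hA : E.L (i + k) with p | p <;> rw [hA] at hb
      · obtain ⟨h3, h4, h5⟩ := mem_targets_fwdSteps.mp hb
        refine Or.inl ⟨h3, mem_pos_of_direct hA ht, p, hA, h4, h5, fun h6 h7 => ?_⟩
        by_cases hkn : k = n
        · subst hkn
          exact absurd (Prod.ext h3 h6) (by simpa [lastPath, hA] using h2 h7)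
        · have := opp k (by omega)
          rcases hB : E.L (i + k + 1) with q | q
          · rw [hA, hB] at this
            exact this.elim
          · exact ⟨q, rfl⟩
      · obtain ⟨h3, h4, h5⟩ := mem_targets_bwdSteps.mp hb
        have hpos := mem_pos_of_inverse hA ht
        refine Or.inr ⟨h3, hpos, p, hA, h4, fun h6 => absurd h6 h5, fun h6 => ?_⟩
        by_cases hkn : k = n
        · subst hkn
          exact absurd (Prod.ext h3 h6) (by simpa [lastPath, hA] using h2 hpos)
        · have := opp k (by omega)
          rcases hB : E.L (i + k + 1) with q | q
          · exact ⟨q, rfl⟩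
          · rw [hA, hB] at this
            exact this.elim
  · rintro ⟨k, hk, hb⟩
    refine ⟨?_, fun hpos he => ?_⟩
    · rcases hb with ⟨h1, h2, q, h3, h4, h5, -⟩ | ⟨h1, h2, q, h3, h4, h5, h6⟩
      · refine Or.inr ⟨k, hk, ?_⟩
        rw [h3]
        exact mem_targets_fwdSteps.mpr ⟨h1, h4, h5⟩
      · by_cases hbq : b.2 = q
        · -- the full path of an inverse letter is only carried if that letter is virtual
          have hk0 : k = 0 := by
            by_contra hk0
            obtain ⟨k', rfl⟩ : ∃ k', k = k' + 1 := ⟨k - 1, by omega⟩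
            apply h5 hbq
            have := (h.inner k' (by omega)).1
            rwa [Nat.cast_add_one, ← add_assoc]
          subst hk0
          simp only [Nat.cast_zero, add_zero] at h1 h3 h5
          refine Or.inl ⟨h5 hbq, ?_⟩
          rw [startNode, h3]
          exact Prod.ext h1 hbq
        · refine Or.inr ⟨k, hk, ?_⟩
          rw [h3]
          exact mem_targets_bwdSteps.mpr ⟨h1, h4, hbq⟩
    · -- the omitted end of the walk is not carried, as the next letter has the same direction
      have hlast : E.Carries (i + n) b := by
        have ht := h.touches_add (show n < n + 1 by omega)
        rw [he, lastPath]
        rcases hL : E.L (i + n) with p | p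
        · have hp := (σ.direct_path _ _ (letter_of_direct hL hpos)).ne_nil
          exact Or.inl ⟨rfl, mem_pos_of_direct hL ht, p, hL, hp, List.prefix_refl _⟩
        · exact Or.inr ⟨rfl, hpos, p, hL, List.nil_prefix⟩
      have hidx := hb.carries.index_unique hlast
      rw [hidx] at hb
      have hl := h.left n rfl hpos
      rcases hb with ⟨h1, h2, q, h3, h4, h5, h6⟩ | ⟨h1, h2, q, h3, h4, h5, h6⟩
      · rw [lastPath, h3] at he
        obtain ⟨p, hp⟩ := h6 (by rw [he]) hpos
        rw [h3, hp] at hl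
        exact hl trivial
      · rw [lastPath, h3] at he
        obtain ⟨p, hp⟩ := h6 (by rw [he])
        rw [h3, hp] at hl
        exact hl trivial

theorem coef_ne_zero_of_mem_runSteps (hc : ∀ i, c i ≠ 0) {i : ι} {m : ℕ} {s : Step K ι V}
    (hs : s ∈ E.runSteps c i m) : s.tgt.1 ≠ 0 := by
  obtain ⟨k, -, hs⟩ := List.mem_flatMap.mp hs
  have : s.tgt.1 = E.runCoef c i k := by
    rcases hL : E.L (i + k) with p | p <;> rw [hL] at hs
    · obtain ⟨t, rfl⟩ := List.mem_ofFn.mp hs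
      rfl
    · obtain ⟨t, rfl⟩ := List.mem_ofFn.mp (List.mem_reverse.mp hs)
      rfl
  rw [this]
  exact runCoef_ne_zero hc i k

theorem coef_ne_zero_of_mem_runNodes (hc : ∀ i, c i ≠ 0) {i : ι} {m : ℕ}
    {n : K × ι × List (Arrow V)} (h : n ∈ E.runNodes c i m) : n.1 ≠ 0 := by
  classical
  have h1 : ∀ n ∈ (E.runSteps c i m).map Step.tgt, n.1 ≠ 0 := by
    intro n hn
    obtain ⟨s, hs, rfl⟩ := List.mem_map.mp hn
    exact coef_ne_zero_of_mem_runSteps hc hs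
  have h2 : (E.startNode K i).1 ≠ 0 := by
    rw [startNode]
    split <;> exact one_ne_zero
  have h3 : n ∈ (if i ∈ σ.pos then (E.runSteps c i m).map Step.tgt
      else E.startNode K i :: (E.runSteps c i m).map Step.tgt) := by
    rw [runNodes] at h
    split_ifs at h with h4 h5 h5
    · rw [if_pos h5]
      exact List.dropLast_subset _ h
    · rw [if_neg h5]
      exact List.dropLast_subset _ h
    · rwa [if_pos h5]
    · rwa [if_neg h5]
  split_ifs at h3
  · exact h1 n h3
  · rcases List.mem_cons.mp h3 with rfl | h3
    · exact h2
    · exact h1 n h3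

end Completion

end HSequence

end Runs

/-! ### The word of a maximal alternating sequence -/

section RunWords

variable {K : Type u} [Field K] [Fintype V] {G : GentleQuiver V} {ι : Type} [CommRing ι]

namespace HSequence

variable {σ : HSequence G ι} {c : ι → K} {d : ℤ}

namespace Completion

variable {E : σ.Completion}

variable (E) in
/-- The vertex at which the walk along the letters from the index `i` on starts. -/
def startVertex (i : ι) : V :=
  match E.L i with
  | .direct _ => σ.vertex i
  | .inverse p => pathEnd (σ.vertex (i + 1)) p

variable (E) in
/-- The letters of the walk along the `m` homotopy letters from the index `i` on. -/
def runLetters (i : ι) (m : ℕ) : List (Letter V) :=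
  (List.range m).flatMap fun k : ℕ => (E.L (i + k)).walk

variable (E) in
open Classical in
/-- The walk along the `m` homotopy letters from the index `i` on, without its first letter if the
first homotopy letter is not virtual, and likewise for the last one. -/
def runWord (i : ι) (m : ℕ) : Word V :=
  let w : Word V := ⟨E.startVertex i, E.runLetters i m⟩
  let w' := if i ∈ σ.pos then w.dropFirst else w
  if i + m ∈ σ.pos then w'.dropLast else w'

theorem runSteps_map_letter (c : ι → K) (i : ι) (m : ℕ) :
    (E.runSteps c i m).map Step.letter = E.runLetters i m := by
  rw [runSteps, runLetters, List.map_flatMap]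
  simp only [letterSteps_map_letter]

theorem runSteps_prefix (c : ι → K) (i : ι) {m m' : ℕ} (h : m ≤ m') :
    E.runSteps c i m <+: E.runSteps c i m' := by
  induction m', h using Nat.le_induction with
  | base => exact List.prefix_refl _
  | succ k _ ih =>
    rw [runSteps_succ]
    exact ih.trans (List.prefix_append _ _)

theorem cls_eq_zero_of_direct (hc : ∀ i, c i ≠ 0) {i : ι} {p : List (Arrow V)}
    (hp : σ.letter i = some (.direct p)) (hn : ∀ q, σ.letter (i + 1) ≠ some (.inverse q)) (η : K)
    (hd : σ.deg i = d) : σ.cls c d (η, i, p) = 0 := by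
  have hdeg := σ.direct_deg _ _ hp
  have hz := diff_vec (K := K) (σ := σ) c d (d := d - 1) (j := i + 1)
    ⟨(pos_of_letter hp).2, by omega⟩ []
  have hnext : σ.nextVec c d (i + 1) [] = 0 := by
    rw [nextVec]
    split
    · exact absurd (by assumption) (hn _)
    · rfl
  rw [hnext, zero_add, prevVec, add_sub_cancel_right, hp] at hz
  simp only [List.append_nil] at hz
  rw [cls]
  refine (Submodule.Quotient.mk_eq_zero _).mpr
    ⟨algebraMap K (GentleAlgebra K G) (η / c i) • σ.vec K (d - 1) (i + 1, []), ?_⟩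
  rw [map_smul, hz, algebraMap_smul, smul_smul, div_mul_cancel₀ _ (hc i)]

theorem cls_eq_zero_of_inverse (hc : ∀ i, c i ≠ 0) {i : ι} {p : List (Arrow V)}
    (hp : σ.letter i = some (.inverse p)) (hn : ∀ q, σ.letter (i - 1) ≠ some (.direct q)) (η : K)
    (hd : σ.deg (i + 1) = d) : σ.cls c d (η, i + 1, p) = 0 := by
  have hdeg := σ.inverse_deg _ _ hp
  have hz := diff_vec (K := K) (σ := σ) c d (d := d - 1) (j := i)
    ⟨(pos_of_letter hp).1, by omega⟩ []
  have hprev : σ.prevVec c d i [] = 0 := by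
    rw [prevVec]
    split
    · exact absurd (by assumption) (hn _)
    · rfl
  rw [hprev, add_zero, nextVec, hp] at hz
  simp only [List.append_nil] at hz
  rw [cls]
  refine (Submodule.Quotient.mk_eq_zero _).mpr
    ⟨algebraMap K (GentleAlgebra K G) (η / c i) • σ.vec K (d - 1) (i, []), ?_⟩
  rw [map_smul, hz, algebraMap_smul, smul_smul, div_mul_cancel₀ _ (hc i)]

/-- A walk that ends at a place which is not a valley ends in a coboundary, if its last letter is
direct. -/
theorem IsRun.cls_last_eq_zero {i : ι} {n : ℕ} (h : E.IsRun i (n + 1)) (hc : ∀ i, c i ≠ 0)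
    (hd : E.letterDeg i = d) (hp : i + n + 1 ∈ σ.pos) {η : K} {t : Step K ι V}
    (ht : t ∈ (letterSteps η (i + n) (E.L (i + n))).getLast?) (a : Arrow V)
    (ha : t.letter = .fwd a) : σ.cls c d t.tgt = 0 := by
  have hd' := (h.letterDeg_add (Nat.lt_succ_self n)).trans hd
  have hl := h.left n rfl hp
  rcases hL : E.L (i + n) with p | p <;> rw [hL] at ht
  · obtain ⟨_, -, -, htgt⟩ := of_mem_getLast?_fwdSteps ht
    rw [letterDeg_direct hL] at hd'
    rw [htgt]
    refine cls_eq_zero_of_direct hc (letter_of_direct hL hp) (fun q hq => hl ?_) η hd'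
    rw [hL, E.eq_of_letter _ _ hq]
    trivial
  · obtain ⟨_, -, hlet, -⟩ := of_mem_getLast?_bwdSteps ht
    rw [hlet] at ha
    cases ha

theorem IsRun.cls_first_eq_zero {i : ι} {m : ℕ} (h : E.IsRun i m) (hc : ∀ i, c i ≠ 0)
    (hd : E.letterDeg i = d) (hp : i ∈ σ.pos) {η : K} {t : Step K ι V}
    (ht : t ∈ (letterSteps η i (E.L i)).head?) (a : Arrow V)
    (ha : t.letter = .bwd a) : σ.cls c d t.src = 0 := by
  have hr := h.right hp
  rcases hL : E.L i with p | p <;> rw [hL] at ht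
  · obtain ⟨_, -, hlet, -⟩ := of_mem_head?_fwdSteps ht
    rw [hlet] at ha
    cases ha
  · obtain ⟨_, -, -, hsrc⟩ := of_mem_head?_bwdSteps ht
    rw [letterDeg_inverse hL] at hd
    rw [hsrc]
    refine cls_eq_zero_of_inverse hc (letter_of_inverse hL hp) (fun q hq => hr ?_) η hd
    rw [hL, E.eq_of_letter _ _ hq]
    trivial

/-- The end of a walk whose last letter is virtual. -/
theorem IsRun.last_virtual {i : ι} {n : ℕ} (h : E.IsRun i (n + 1)) (hp : i + n + 1 ∉ σ.pos)
    {s : Step K ι V} (hs : s ∈ (E.runSteps c i (n + 1)).getLast?) (a : Arrow V)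
    (ha : arrowElt K G a • σ.cls c d s.tgt ≠ 0) : s.letter = .bwd a := by
  have hpos := (h.touches_add (Nat.lt_succ_self n)).resolve_right hp
  obtain ⟨q, hq, hpath, hterm⟩ := E.left_end _ hpos hp
  rw [runSteps_succ, hq, letterSteps] at hs
  by_cases hq0 : q = []
  · -- the virtual letter contributes no step, so the walk ends with the letter before it
    subst hq0
    have hf : ∀ η : K, fwdSteps η (i + (n : ι)) ([] : List (Arrow V)) = [] := fun η =>
      List.length_eq_zero_iff.mp (length_fwdSteps _ _ _)
    rw [hf, List.append_nil] at hs
    cases n with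
    | zero => simp [runSteps] at hs
    | succ n =>
      obtain ⟨h1, h2⟩ := h.inner n (by omega)
      have cast : i + ((n + 1 : ℕ) : ι) = i + n + 1 := by push_cast; ring
      rw [cast] at hq
      rw [hq] at h2
      rcases hL : E.L (i + n) with r | r
      · rw [hL] at h2
        exact h2.elim
      · rw [runSteps_succ, hL, letterSteps] at hs
        by_cases hr0 : r = []
        · have hn0 : n = 0 := by
            by_contra hn0
            obtain ⟨n', rfl⟩ : ∃ n', n = n' + 1 := ⟨n - 1, by omega⟩
            have h3 := (h.inner n' (by omega)).1
            have h4 : i + ((n' + 1 : ℕ) : ι) ∈ σ.pos := by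
              rwa [Nat.cast_add_one, ← add_assoc]
            exact (σ.inverse_path _ _ (letter_of_inverse hL h4)).ne_nil hr0
          subst hn0 hr0
          simp [runSteps, bwdSteps] at hs
        · rw [List.getLast?_append_of_ne_nil _ (by
            rw [← List.length_pos_iff, length_bwdSteps]
            exact List.length_pos_iff.mpr hr0)] at hs
          obtain ⟨b, hb, hlet, htgt⟩ := of_mem_getLast?_bwdSteps hs
          rw [htgt] at ha
          obtain ⟨-, h3, -⟩ := prolongs_of_smul_ne_zero ha
          have hm := E.meet _ h1
          rw [hL, hq] at hm
          rcases hm.1 a h3.symm with h4 | h4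
          · rw [hb, Option.some.injEq] at h4
            rw [hlet, h4]
          · cases h4
  · rw [List.getLast?_append_of_ne_nil _ (by
      rw [← List.length_pos_iff, length_fwdSteps]
      exact List.length_pos_iff.mpr hq0)] at hs
    obtain ⟨b, hb, hlet, htgt⟩ := of_mem_getLast?_fwdSteps hs
    rw [htgt] at ha
    exact absurd (smul_eq_zero_of_isTerminal hterm hq0) ha

theorem startNode_eq_of_inverse {i : ι} {r : List (Arrow V)} (h : E.L i = .inverse r) :
    E.startNode K i = (1, i + 1, r) := by rw [startNode, h]

/-- The start of a walk whose first letter is virtual. -/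
theorem IsRun.first_virtual {i : ι} {m : ℕ} (h : E.IsRun i m) (hp : i ∉ σ.pos) :
    (∀ s ∈ (E.runSteps c i m).head?, σ.cls c d (E.startNode K i) = σ.cls c d s.src ∧
      s.letter.source = E.startVertex i) ∧
    ∀ a, arrowElt K G a • σ.cls c d (E.startNode K i) ≠ 0 →
      ∃ s ∈ (E.runSteps c i m).head?, s.letter = .fwd a := by
  have hpos := h.touches.resolve_left hp
  obtain ⟨r, hr, hpath, hterm⟩ := E.right_end _ hp hpos
  have hone : E.runSteps c i 1 = bwdSteps 1 (i + 1) r := by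
    simp [runSteps, hr, letterSteps, runCoef]
  have hv : E.startVertex i = pathEnd (σ.vertex (i + 1)) r := by rw [startVertex, hr]
  rw [startNode_eq_of_inverse hr, hv]
  by_cases hr0 : r = []
  · -- the virtual letter contributes no step, so the walk starts with the letter after it
    subst hr0
    have h2 : 2 ≤ m := by
      have := h.one_le
      by_contra hm
      exact h.ne_nil (by omega) (by rw [hr]; rfl)
    obtain ⟨-, hop⟩ := h.inner 0 (by omega)
    simp only [Nat.cast_zero, add_zero] at hop
    rw [hr] at hop
    rcases hq : E.L (i + 1) with q | q
    · have hm := E.meet _ hpos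
      rw [hr, hq] at hm
      have htwo : E.runSteps c i 2 = fwdSteps 1 (i + 1) q := by
        rw [runSteps_succ, hone, Nat.cast_one, hq]
        simp [bwdSteps, letterSteps, runCoef, hr]
      obtain ⟨S, hS⟩ := E.runSteps_prefix c i h2
      rw [htwo] at hS
      have key : ∀ s ∈ (E.runSteps c i m).head?, s ∈ (fwdSteps 1 (i + 1) q).head? := by
        intro s hs
        by_cases hq0 : q = []
        · exfalso
          have hm2 : m = 2 := by
            by_contra hm2
            have h3 := (h.inner 1 (by omega)).1
            rw [Nat.cast_one] at h3
            exact (σ.direct_path _ _ (letter_of_direct hq h3)).ne_nil hq0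
          rw [hm2, htwo, hq0] at hs
          simp [fwdSteps] at hs
        · rw [← hS, List.head?_append_of_ne_nil _ (by
            rw [← List.length_pos_iff, length_fwdSteps]
            exact List.length_pos_iff.mpr hq0)] at hs
          exact hs
      refine ⟨fun s hs => ?_, fun a ha => ?_⟩
      · obtain ⟨b, hb, hlet, hsrc⟩ := of_mem_head?_fwdSteps (key s hs)
        rw [hsrc, hlet]
        exact ⟨rfl, (path_direct hq hpos).source b hb⟩
      · obtain ⟨-, h3, -⟩ := prolongs_of_smul_ne_zero ha
        rcases hm.1 a h3.symm with h4 | h4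
        · cases h4
        · have hq0 : q ≠ [] := by
            rintro rfl
            cases h4
          obtain ⟨s, hs⟩ := Option.ne_none_iff_exists'.mp
            (mt List.head?_eq_none_iff.mp (show fwdSteps (1 : K) (i + 1) q ≠ [] by
              rw [← List.length_pos_iff, length_fwdSteps]
              exact List.length_pos_iff.mpr hq0))
          obtain ⟨b, hb, hlet, hsrc⟩ := of_mem_head?_fwdSteps hs
          rw [hb, Option.some.injEq] at h4
          refine ⟨s, ?_, by rw [hlet, h4]⟩
          rw [← hS, List.head?_append, hs]
          rfl
    · rw [hq] at hop
      exact hop.elim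
  · obtain ⟨S, hS⟩ := E.runSteps_prefix c i h.one_le
    rw [hone] at hS
    rw [← hS, List.head?_append_of_ne_nil _ (by
      rw [← List.length_pos_iff, length_bwdSteps]
      exact List.length_pos_iff.mpr hr0)]
    refine ⟨fun s hs => ?_, fun a ha => absurd (smul_eq_zero_of_isTerminal hterm hr0) ha⟩
    obtain ⟨b, hb, hlet, hsrc⟩ := of_mem_head?_bwdSteps hs
    rw [hsrc, hlet]
    refine ⟨rfl, ?_⟩
    rw [pathEnd, hb]
    rfl

/-- The walk along a maximal alternating sequence of letters is realized by its nodes in the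
cokernel of the differential. -/
theorem IsRun.exists_realizes {i : ι} {m : ℕ} (h : E.IsRun i m) (hc : ∀ i, c i ≠ 0)
    (hd : E.letterDeg i = d) : ∃ n S x, σ.Realizes c d n S x ∧
      n :: S.map Step.tgt = E.runNodes c i m ∧
        (⟨x, S.map Step.letter⟩ : Word V) = E.runWord i m := by
  classical
  obtain ⟨n, rfl⟩ : ∃ n, m = n + 1 := ⟨m - 1, by have := h.one_le; omega⟩
  have cast : i + ((n + 1 : ℕ) : ι) = i + n + 1 := by push_cast; ring
  have hstep := h.isStep c d
  have hchain := h.isChain hc hd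
  have hlet := runSteps_map_letter (E := E) c i (n + 1)
  -- the steps that remain after removing the last one if necessary
  obtain ⟨S, hS, hstepS, hchainS, hlastS, hfirstS⟩ : ∃ S,
      S = (if i + n + 1 ∈ σ.pos then (E.runSteps c i (n + 1)).dropLast
        else E.runSteps c i (n + 1)) ∧
      (∀ s ∈ S, σ.IsStep c d s) ∧ S.IsChain (σ.Follows c d) ∧
      (∀ s ∈ S.getLast?, ∀ a, arrowElt K G a • σ.cls c d s.tgt ≠ 0 → s.letter = .bwd a) ∧
      (∀ s ∈ (E.runSteps c i (n + 1)).head?, s ∈ S.head? ∨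
        ∀ a, s.letter = .fwd a → σ.cls c d s.tgt = 0) := by
    by_cases hp : i + n + 1 ∈ σ.pos
    · obtain ⟨t, ht⟩ := Option.ne_none_iff_exists'.mp
        (mt List.getLast?_eq_none_iff.mp (h.last_ne_nil hp (E.runCoef c i n)))
      obtain ⟨l, hl⟩ := List.getLast?_eq_some_iff.mp ht
      have hS : E.runSteps c i (n + 1) = (E.runSteps c i n ++ l) ++ [t] := by
        rw [runSteps_succ, hl, List.append_assoc]
      have ht0 := h.cls_last_eq_zero hc hd hp ht
      rw [hS] at hstep hchain ⊢
      refine ⟨E.runSteps c i n ++ l, by rw [if_pos hp, List.dropLast_concat],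
        fun s hs => hstep s (List.mem_append_left _ hs), (List.isChain_append.mp hchain).1,
        last_of_dropLast hstep hchain ht0, fun s hs => ?_⟩
      cases hl' : E.runSteps c i n ++ l with
      | nil =>
        rw [hl'] at hs
        cases hs
        exact Or.inr ht0
      | cons s' l' =>
        rw [hl'] at hs
        exact Or.inl hs
    · exact ⟨_, by rw [if_neg hp], hstep, hchain, fun s hs a => h.last_virtual hp hs a,
        fun s hs => Or.inl hs⟩
  by_cases hi : i ∈ σ.pos
  · -- the first letter is not virtual, and the first step is removed, too
    obtain ⟨t, ht⟩ := Option.ne_none_iff_exists'.mp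
      (mt List.head?_eq_none_iff.mp (h.first_ne_nil hi (E.runCoef c i 0)))
    have ht0 := h.cls_first_eq_zero hc hd hi ht
    obtain ⟨l, hl⟩ := List.head?_eq_some_iff.mp ht
    obtain ⟨l', hl'⟩ := E.runSteps_prefix c i h.one_le
    have hfull : E.runSteps c i (n + 1) = t :: (l ++ l') := by
      rw [← hl']
      simp only [runSteps, List.range_one, List.flatMap_cons, List.flatMap_nil, Nat.cast_zero,
        add_zero, List.append_nil, hl, List.cons_append]
    have hne : i + n + 1 ∈ σ.pos → l ++ l' ≠ [] := by
      intro hp h0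
      have hlen : (E.runSteps c i (n + 1)).length = 1 := by rw [hfull, h0]; rfl
      cases n with
      | zero =>
        have h2 := h.two_le rfl hi (by simpa using hp)
        rw [← List.length_map (f := Step.letter), hlet] at hlen
        simp only [runLetters, zero_add, List.range_one, List.flatMap_cons, List.flatMap_nil,
          Nat.cast_zero, add_zero, List.append_nil] at hlen
        omega
      | succ n =>
        have h1 := List.length_pos_iff.mpr (h.last_ne_nil hp (E.runCoef c i (n + 1)))
        have h2 := (E.runSteps_prefix c i (show 1 ≤ n + 1 by omega)).length_le
        have h3 : 0 < (E.runSteps c i 1).length := by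
          simp [runSteps, hl]
        rw [runSteps_succ, List.length_append] at hlen
        omega
    obtain ⟨S', hS'⟩ : ∃ S', S = t :: S' := by
      rw [hS, hfull]
      split_ifs with hp
      · rw [List.dropLast_cons_of_ne_nil (hne hp)]
        exact ⟨_, rfl⟩
      · exact ⟨_, rfl⟩
    subst hS'
    refine ⟨t.tgt, S', t.letter.target, realizes_tail hstepS hchainS ht0 hlastS, ?_, ?_⟩
    · rw [runNodes, cast, if_pos hi, ← List.map_cons, hS]
      split_ifs
      · rw [List.map_dropLast]
      · rfl
    · have hwl : E.runLetters i (n + 1) = t.letter :: (l ++ l').map Step.letter := by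
        rw [← hlet, hfull]
        rfl
      rw [runWord, cast, if_pos hi, Word.dropFirst, hwl]
      simp only
      rw [hfull] at hS
      split_ifs at hS ⊢ with hp
      · rw [List.dropLast_cons_of_ne_nil (hne hp)] at hS
        rw [Word.dropLast, (List.cons_eq_cons.mp hS).2, List.map_dropLast]
      · rw [(List.cons_eq_cons.mp hS).2]
  · obtain ⟨hf1, hf2⟩ := h.first_virtual (c := c) (d := d) hi
    have hsub : ∀ s ∈ S.head?, s ∈ (E.runSteps c i (n + 1)).head? := by
      intro s hs
      rw [hS] at hs
      split_ifs at hs with hp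
      · rw [List.head?_dropLast] at hs
        split_ifs at hs
        · exact hs
        · cases hs
      · exact hs
    refine ⟨E.startNode K i, S, E.startVertex i, ⟨hstepS, hchainS,
      fun s hs => hf1 s (hsub s hs), ?_, fun a ha => ?_, hlastS⟩, ?_, ?_⟩
    · obtain ⟨r, hr, -⟩ := E.right_end _ hi (h.touches.resolve_left hi)
      rw [startNode_eq_of_inverse hr, startVertex, hr]
      exact vertexElt_smul_cls _ _ _ rfl
    · obtain ⟨s, hs, hsl⟩ := hf2 a ha
      rcases hfirstS s hs with h1 | h1
      · exact ⟨s, h1, hsl⟩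
      · exfalso
        have hmem : s ∈ E.runSteps c i (n + 1) := List.mem_of_mem_head? hs
        rw [(hf1 s hs).1, (hstep s hmem).fwd a hsl, h1 a hsl] at ha
        exact ha rfl
    · rw [runNodes, cast, if_neg hi, hS]
      split_ifs with hp
      · have hne : E.runSteps c i (n + 1) ≠ [] := by
          rw [runSteps_succ]
          exact List.append_ne_nil_of_right_ne_nil _ (h.last_ne_nil hp _)
        rw [List.dropLast_cons_of_ne_nil (by simpa using hne), List.map_dropLast]
      · rfl
    · rw [runWord, cast, if_neg hi, hS]
      split_ifs with hp
      · rw [Word.dropLast, List.map_dropLast, hlet]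
      · rw [hlet]

end Completion

end HSequence

end RunWords

/-! ### The rules and the maximal alternating sequences of letters -/

section Rules

variable {G : GentleQuiver V} {ι : Type} [CommRing ι]

namespace GentleQuiver

theorem isOtherLeg_of_isValley {x : V} {p q : List (Arrow V)} (hq : G.IsPathFrom x q)
    (tq : G.IsTerminal q) (h : IsValley x q p) : G.IsOtherLeg x p q := by
  rcases hc : q.head? with _ | c
  · refine Or.inl ⟨List.head?_eq_none_iff.mp hc, fun e he => (h.1 e he).resolve_left ?_⟩
    rw [hc]
    exact Option.some_ne_none e ∘ Eq.symm
  · exact Or.inr ⟨c, hq.source c hc, h.2 c hc, hc, hq.chain, tq⟩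

theorem IsOtherLeg.eq_of_isValley {x : V} {p q q' : List (Arrow V)} (h' : G.IsOtherLeg x p q')
    (hq : G.IsPathFrom x q) (tq : G.IsTerminal q) (h : IsValley x q p) : q' = q := by
  rcases h' with ⟨rfl, h'⟩ | ⟨c, hc, hpc, hm⟩
  · rcases hc : q.head? with _ | c
    · exact (List.head?_eq_none_iff.mp hc).symm
    · exact absurd (h' c (hq.source c hc)) (h.2 c hc)
  · exact G.eq_of_terminal hm.chain hq.chain hm.maximal tq
      (hm.head.trans ((h.1 c hc).resolve_right hpc).symm)

theorem isKernelLeg_of_isPass {x : V} {p q : List (Arrow V)} (hq : G.IsPathFrom x q)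
    (tq : G.IsTerminal q) (h : G.IsPass p q) (hne : q ≠ []) : G.IsKernelLeg p q := by
  obtain ⟨c, hc⟩ := Option.ne_none_iff_exists'.mp (mt List.head?_eq_none_iff.mp hne)
  obtain ⟨b, hb, h⟩ := h
  exact ⟨b, c, hb, (h c).mpr hc, hc, hq.chain, tq⟩

theorem IsKernelLeg.eq_of_isPass {x : V} {p q q' : List (Arrow V)} (h' : G.IsKernelLeg p q')
    (hq : G.IsPathFrom x q) (tq : G.IsTerminal q) (h : G.IsPass p q) : q' = q := by
  obtain ⟨b, c, hb, hr, hm⟩ := h'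
  obtain ⟨b', hb', h⟩ := h
  rw [hb] at hb'
  cases hb'
  exact G.eq_of_terminal hm.chain hq.chain hm.maximal tq (hm.head.trans ((h c).mp hr).symm)

end GentleQuiver

namespace HSequence

variable {σ : HSequence G ι}

theorem subword_letters (i : ι) (m : ℕ) : (σ.subword i m).letters =
    (List.range m).flatMap fun k : ℕ => ((σ.letter (i + k)).map HLetter.walk).getD [] := by
  simp [subword, List.flatMap_assoc]

namespace Completion

variable (E : σ.Completion)

/-- The letters that meet at the place `j` alternate, virtual letters included. -/
def Joint (j : ι) : Prop := j ∈ σ.pos ∧ Opposite (E.L (j - 1)) (E.L j)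

variable {E}

theorem letter_none_of_not_mem {i : ι} (h : i ∉ σ.pos) : σ.letter i = none :=
  (σ.letter_eq_none_iff i).mpr fun h' => h h'.1

theorem letter_none_of_succ_not_mem {i : ι} (h : i + 1 ∉ σ.pos) : σ.letter i = none :=
  (σ.letter_eq_none_iff i).mpr fun h' => h h'.2

theorem letter_eq_L {i : ι} (h : i ∈ σ.pos) (h' : i + 1 ∈ σ.pos) : σ.letter i = some (E.L i) := by
  obtain ⟨x, hx⟩ := Option.isSome_iff_exists.mp ((σ.letter_isSome i).mpr ⟨h, h'⟩)
  rw [hx, E.eq_of_letter i x hx]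

/-- The right end of `σ`. -/
theorem right_of_none {i : ι} {x : HLetter V} (h : σ.letter (i - 1) = none)
    (hx : σ.letter i = some x) : i - 1 ∉ σ.pos ∧ i ∈ σ.pos ∧ i + 1 ∈ σ.pos ∧
      ∃ q, E.L (i - 1) = .inverse q ∧ G.IsPathFrom (σ.vertex i) q ∧ G.IsTerminal q := by
  obtain ⟨h1, h2⟩ := pos_of_letter hx
  have h3 : i - 1 ∉ σ.pos := fun h3 =>
    (σ.letter_eq_none_iff _).mp h ⟨h3, by rwa [sub_add_cancel]⟩
  have := E.right_end (i - 1) h3 (by rwa [sub_add_cancel])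
  rw [sub_add_cancel] at this
  exact ⟨h3, h1, h2, this⟩

/-- The left end of `σ`. -/
theorem left_of_none {j : ι} {x : HLetter V} (h : σ.letter j = none)
    (hx : σ.letter (j - 1) = some x) : j - 1 ∈ σ.pos ∧ j ∈ σ.pos ∧ j + 1 ∉ σ.pos ∧
      ∃ q, E.L j = .direct q ∧ G.IsPathFrom (σ.vertex j) q ∧ G.IsTerminal q := by
  obtain ⟨h1, h2⟩ := pos_of_letter hx
  rw [sub_add_cancel] at h2
  have h3 : j + 1 ∉ σ.pos := fun h3 => (σ.letter_eq_none_iff _).mp h ⟨h2, h3⟩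
  exact ⟨h1, h2, h3, E.left_end j h2 h3⟩

theorem joint_of_alternate {j : ι} (h : Alternate (σ.letter (j - 1)) (σ.letter j)) :
    E.Joint j := by
  rcases h with ⟨p, q, h1, h2⟩ | ⟨p, q, h1, h2⟩ <;>
  · refine ⟨(pos_of_letter h2).1, ?_⟩
    rw [E.eq_of_letter _ _ h1, E.eq_of_letter _ _ h2]
    trivial

theorem joint_of_startsDirect {j : ι} {p : List (Arrow V)} (h : σ.StartsDirect j p) :
    E.Joint j := by
  obtain ⟨-, h1, -, q, hq, -⟩ := E.right_of_none h.1 h.2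
  refine ⟨h1, ?_⟩
  rw [hq, E.eq_of_letter _ _ h.2]
  trivial

theorem joint_of_endsInverse {j : ι} {p : List (Arrow V)} (h : σ.EndsInverse j p) :
    E.Joint j := by
  obtain ⟨-, h1, -, q, hq, -⟩ := E.left_of_none h.1 h.2
  refine ⟨h1, ?_⟩
  rw [hq, E.eq_of_letter _ _ h.2]
  trivial

/-- Three kinds of places at which the letters of the completed sequence alternate. -/
theorem Joint.cases {j : ι} (h : E.Joint j) (hn : j - 1 ∈ σ.pos ∨ j + 1 ∈ σ.pos) :
    (j - 1 ∈ σ.pos ∧ j + 1 ∈ σ.pos ∧ Alternate (σ.letter (j - 1)) (σ.letter j)) ∨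
      (j - 1 ∉ σ.pos ∧ ∃ p, σ.StartsDirect j p) ∨ (j + 1 ∉ σ.pos ∧ ∃ p, σ.EndsInverse j p) := by
  obtain ⟨hj, ho⟩ := h
  have hj' : j - 1 + 1 ∈ σ.pos := by rwa [sub_add_cancel]
  by_cases h1 : j - 1 ∈ σ.pos
  · have e1 := letter_eq_L (E := E) h1 hj'
    by_cases h2 : j + 1 ∈ σ.pos
    · refine Or.inl ⟨h1, h2, ?_⟩
      have e2 := letter_eq_L (E := E) hj h2
      rw [e1, e2]
      rcases hp : E.L (j - 1) with p | p <;> rcases hq : E.L j with q | q <;> rw [hp, hq] at ho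
      · exact ho.elim
      · exact Or.inl ⟨p, q, rfl, rfl⟩
      · exact Or.inr ⟨p, q, rfl, rfl⟩
      · exact ho.elim
    · obtain ⟨q, hq, -⟩ := E.left_end j hj h2
      rw [hq] at ho
      refine Or.inr (Or.inr ⟨h2, ?_⟩)
      rcases hp : E.L (j - 1) with p | p
      · rw [hp] at ho
        exact ho.elim
      · exact ⟨p, letter_none_of_succ_not_mem h2, by rw [e1, hp]⟩
  · have h2 := hn.resolve_left h1
    obtain ⟨q, hq, -⟩ := E.right_end _ h1 hj'
    rw [hq] at ho
    refine Or.inr (Or.inl ⟨h1, ?_⟩)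
    rcases hp : E.L j with p | p
    · exact ⟨p, letter_none_of_not_mem h1, by rw [letter_eq_L (E := E) hj h2, hp]⟩
    · rw [hp] at ho
      exact ho.elim

/-- A maximal alternating sequence in terms of joints. -/
theorem isRun_of_joints {i : ι} {m : ℕ} (h1 : 1 ≤ m) (ht : i ∈ σ.pos ∨ i + 1 ∈ σ.pos)
    (hi : ∀ k : ℕ, k + 1 < m → E.Joint (i + k + 1)) (hr : ¬ E.Joint i) (hl : ¬ E.Joint (i + m))
    (hm : m = 1 → (E.L i).walk ≠ [] ∧
      (i ∈ σ.pos → i + 1 ∈ σ.pos → 2 ≤ (E.L i).walk.length)) : E.IsRun i m where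
  one_le := h1
  touches := ht
  inner k hk := by
    have := hi k hk
    rw [Joint, add_sub_cancel_right] at this
    exact this
  right h ho := hr ⟨h, ho⟩
  left k hk h ho := hl (by
    rw [← hk, Joint, Nat.cast_add_one, ← add_assoc, add_sub_cancel_right]
    exact ⟨h, ho⟩)
  ne_nil h := (hm h).1
  two_le h := (hm h).2

theorem IsRun.joint {i : ι} {m : ℕ} (h : E.IsRun i m) (k : ℕ) (hk : k + 1 < m) :
    E.Joint (i + k + 1) := by
  rw [Joint, add_sub_cancel_right]
  exact h.inner k hk

theorem IsRun.not_joint_right {i : ι} {m : ℕ} (h : E.IsRun i m) : ¬ E.Joint i :=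
  fun h' => h.right h'.1 h'.2

theorem IsRun.not_joint_left {i : ι} {m : ℕ} (h : E.IsRun i m) : ¬ E.Joint (i + m) := by
  obtain ⟨n, rfl⟩ : ∃ n, m = n + 1 := ⟨m - 1, by have := h.one_le; omega⟩
  rw [Joint, Nat.cast_add_one, ← add_assoc, add_sub_cancel_right]
  exact fun h' => h.left n rfl h'.1 h'.2

/-- Two maximal alternating sequences with a common letter are equal. -/
theorem IsRun.eq_of_index_eq {i i' : ι} {m m' : ℕ} (h : E.IsRun i m) (h' : E.IsRun i' m')
    {k k' : ℕ} (hk : k < m) (hk' : k' < m') (he : i + (k : ι) = i' + k') : i = i' ∧ m = m' := by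
  have aux : ∀ {i i' : ι} {m m' : ℕ}, E.IsRun i m → E.IsRun i' m' → ∀ {k k' : ℕ}, k < m →
      k' < m' → i + (k : ι) = i' + k' → ¬ k < k' := by
    intro i i' m m' h h' k k' hk hk' he hlt
    obtain ⟨δ, rfl⟩ : ∃ δ, k' = k + (δ + 1) := ⟨k' - k - 1, by omega⟩
    have hi : i = i' + δ + 1 := by
      push_cast at he
      linear_combination he
    exact h.not_joint_right (hi ▸ h'.joint δ (by omega))
  obtain rfl : k = k' := by
    have h1 := aux h h' hk hk' he
    have h2 := aux h' h hk' hk he.symm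
    omega
  obtain rfl : i = i' := add_right_cancel he
  have aux' : ∀ {m m' : ℕ}, E.IsRun i m → E.IsRun i m' → ¬ m < m' := by
    intro m m' h h' hlt
    obtain ⟨n, rfl⟩ : ∃ n, m = n + 1 := ⟨m - 1, by have := h.one_le; omega⟩
    apply h.not_joint_left
    rw [Nat.cast_add_one, ← add_assoc]
    exact h'.joint n (by omega)
  have h1 := aux' h h'
  have h2 := aux' h' h
  exact ⟨rfl, by omega⟩

/-- Every path that represents a cohomology class is carried by a letter of a maximal alternating
sequence. -/
theorem Owns.exists_isRun {l : ι} {b : ι × List (Arrow V)} (h : E.Owns l b)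
    (hleft : ∃ k : ℕ, ¬ E.Joint (l + k + 1)) (hright : ∃ k : ℕ, ¬ E.Joint (l - k)) :
    ∃ i m, E.IsRun i m ∧ ∃ k < m, i + (k : ι) = l := by
  classical
  set s := Nat.find hright with hs
  set t := Nat.find hleft with ht
  have hs1 : ¬ E.Joint (l - s) := Nat.find_spec hright
  have ht1 : ¬ E.Joint (l + t + 1) := Nat.find_spec hleft
  have hs2 : ∀ k < s, E.Joint (l - k) := fun k hk => not_not.mp (Nat.find_min hright hk)
  have ht2 : ∀ k < t, E.Joint (l + k + 1) := fun k hk => not_not.mp (Nat.find_min hleft hk)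
  -- the sequence reaches from the last place before `l` to the first place after `l` which is not a
  -- joint
  refine ⟨l - s, s + t + 1, isRun_of_joints (by omega) ?_ (fun k hk => ?_) hs1 ?_ (fun hm => ?_),
    s, by omega, by ring⟩
  · rcases Nat.eq_zero_or_pos s with h0 | h0
    · rw [h0, Nat.cast_zero, sub_zero]
      rcases h with ⟨-, h2, -⟩ | ⟨-, h2, -⟩
      exacts [Or.inl h2, Or.inr h2]
    · right
      have := (hs2 (s - 1) (by omega)).1
      rw [Nat.cast_sub h0, Nat.cast_one] at this
      rwa [show l - (s : ι) + 1 = l - (s - 1) by ring]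
  · rcases lt_or_ge k s with h0 | h0
    · have := hs2 (s - (k + 1)) (by omega)
      rw [Nat.cast_sub (by omega), Nat.cast_add_one] at this
      rwa [show l - (s : ι) + k + 1 = l - (s - (k + 1)) by ring]
    · have := ht2 (k - s) (by omega)
      rw [Nat.cast_sub h0] at this
      rwa [show l - (s : ι) + k + 1 = l + (k - s) + 1 by ring]
  · push_cast
    rwa [show l - (s : ι) + (s + t + 1) = l + t + 1 by ring]
  · -- a single letter carries a path only if its own path is long enough
    have hs0 : s = 0 := by omega
    have ht0 : t = 0 := by omega
    rw [ht0] at ht1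
    rw [hs0]
    simp only [Nat.cast_zero, sub_zero, add_zero] at ht1 ⊢
    have hjoint : l + 1 ∈ σ.pos → ¬ Opposite (E.L l) (E.L (l + 1)) := fun h1 h2 =>
      ht1 ⟨h1, by rwa [add_sub_cancel_right]⟩
    rcases h with ⟨-, h2, q, h3, h4, h5, h6⟩ | ⟨-, h2, q, h3, h4, h5, h6⟩
    · rw [h3] at hjoint ⊢
      have hlen := h5.length_le
      have hpos := List.length_pos_iff.mpr h4
      simp only [HLetter.walk, List.length_map]
      refine ⟨List.ne_nil_of_length_pos (by rw [List.length_map]; omega), fun _ h8 => ?_⟩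
      have hne : b.2 ≠ q := fun hq => by
        obtain ⟨p, hp⟩ := h6 hq h8
        rw [hp] at hjoint
        exact hjoint h8 trivial
      have : b.2.length ≠ q.length := fun hl => hne (h5.eq_of_length hl)
      omega
    · rw [h3] at hjoint ⊢
      have hlen := h4.length_le
      have hne : b.2 ≠ [] := fun hq => by
        obtain ⟨p, hp⟩ := h6 hq
        rw [hp] at hjoint
        exact hjoint h2 trivial
      have hpos := List.length_pos_iff.mpr hne
      simp only [HLetter.walk, List.length_reverse, List.length_map]
      refine ⟨List.ne_nil_of_length_pos (by
        rw [List.length_reverse, List.length_map]; omega), fun h7 _ => ?_⟩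
      have : b.2.length ≠ q.length := fun hl => h5 (h4.eq_of_length hl) h7
      omega

end Completion

end HSequence

end Rules

/-! ### The maximal alternating sequence of a rule -/

section Summands

variable {G : GentleQuiver V} {ι : Type} [CommRing ι]

namespace HSequence

variable {σ : HSequence G ι}

namespace IsMaxAlternating

variable {i : ι} {m : ℕ}

theorem mem_pos (h : σ.IsMaxAlternating i m) {k : ℕ} (hk : k < m) :
    i + k ∈ σ.pos ∧ i + k + 1 ∈ σ.pos := by
  have h2 := h.two_le
  by_cases hk' : k + 1 < m
  · rcases h.alternate k hk' with ⟨p, q, h1, -⟩ | ⟨p, q, h1, -⟩ <;>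
      exact Completion.pos_of_letter h1
  · obtain ⟨l, rfl⟩ : ∃ l, k = l + 1 := ⟨k - 1, by omega⟩
    rw [Nat.cast_add_one, ← add_assoc]
    rcases h.alternate l hk with ⟨p, q, -, h1⟩ | ⟨p, q, -, h1⟩ <;>
      exact Completion.pos_of_letter h1

theorem mem_first (h : σ.IsMaxAlternating i m) : i ∈ σ.pos ∧ i + 1 ∈ σ.pos := by
  have := h.two_le
  simpa using h.mem_pos (k := 0) (by omega)

theorem mem_last (h : σ.IsMaxAlternating i m) : i + m - 1 ∈ σ.pos ∧ i + m ∈ σ.pos := by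
  have h2 := h.two_le
  have := h.mem_pos (k := m - 1) (by omega)
  rw [Nat.cast_sub (by omega), Nat.cast_one] at this
  rwa [show i + ((m : ι) - 1) = i + m - 1 by ring, sub_add_cancel] at this

variable {E : σ.Completion}

theorem joint (h : σ.IsMaxAlternating i m) {k : ℕ} (hk : k + 1 < m) : E.Joint (i + k + 1) :=
  Completion.joint_of_alternate (by rw [add_sub_cancel_right]; exact h.alternate k hk)

theorem not_joint_right (h : σ.IsMaxAlternating i m) (hr : ∀ p, ¬ σ.StartsDirect i p) :
    ¬ E.Joint i := by
  intro hj
  rcases hj.cases (Or.inr h.mem_first.2) with ⟨-, -, h1⟩ | ⟨-, p, h1⟩ | ⟨h1, -⟩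
  · exact h.right h1
  · exact hr p h1
  · exact h1 h.mem_first.2

theorem not_joint_left (h : σ.IsMaxAlternating i m) (hl : ∀ p, ¬ σ.EndsInverse (i + m) p) :
    ¬ E.Joint (i + m) := by
  intro hj
  rcases hj.cases (Or.inl h.mem_last.1) with ⟨-, -, h1⟩ | ⟨h1, -⟩ | ⟨-, p, h1⟩
  · exact h.left h1
  · exact h1 h.mem_last.1
  · exact hl p h1

end IsMaxAlternating

namespace Summand

/-- The index of the first letter of the maximal alternating sequence that belongs to the
summand. -/
def runIndex : σ.Summand → ι
  | maxAlternating i _ _ _ _ => i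
  | cokernel i _ _ _ _ _ => i - 1
  | cokernelDual j _ _ _ _ _ => j - 1
  | combined i _ _ _ _ _ _ _ => i - 1
  | combinedDual i _ _ _ _ _ _ _ => i
  | combinedBoth i _ _ _ _ _ _ _ _ _ _ => i - 1
  | kernel j _ _ _ _ => j
  | kernelDual i _ _ _ _ => i - 1
  | homotopyLetter i _ _ _ _ _ _ => i
  | homotopyLetterDual i _ _ _ _ _ _ => i

/-- The number of letters of the maximal alternating sequence that belongs to the summand, virtual
letters included. -/
def runLength : σ.Summand → ℕ
  | maxAlternating _ m _ _ _ => m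
  | cokernel _ _ _ _ _ _ => 2
  | cokernelDual _ _ _ _ _ _ => 2
  | combined _ m _ _ _ _ _ _ => m + 1
  | combinedDual _ m _ _ _ _ _ _ => m + 1
  | combinedBoth _ m _ _ _ _ _ _ _ _ _ => m + 2
  | kernel _ _ _ _ _ => 1
  | kernelDual _ _ _ _ _ => 1
  | homotopyLetter _ _ _ _ _ _ _ => 1
  | homotopyLetterDual _ _ _ _ _ _ _ => 1

end Summand

namespace Completion

variable {E : σ.Completion}

theorem not_joint_of_not_mem {j : ι} (h : j ∉ σ.pos) : ¬ E.Joint j := fun h' => h h'.1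

/-- The virtual letter before a direct letter at the right end. -/
theorem exists_of_startsDirect {i : ι} {p : List (Arrow V)} (h : σ.StartsDirect i p) :
    i - 1 ∉ σ.pos ∧ i ∈ σ.pos ∧ i + 1 ∈ σ.pos ∧ E.L i = .direct p ∧
      ∃ q, E.L (i - 1) = .inverse q ∧ ∀ q', G.IsOtherLeg (σ.vertex i) p q' ↔ q' = q := by
  obtain ⟨h1, h2, h3, q, hq, hp, ht⟩ := E.right_of_none h.1 h.2
  have hL := E.eq_of_letter _ _ h.2
  have hm := E.meet' h2
  rw [hq, hL] at hm
  exact ⟨h1, h2, h3, hL, q, hq, fun q' => ⟨fun h' => h'.eq_of_isValley hp ht hm,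
    fun h' => h' ▸ GentleQuiver.isOtherLeg_of_isValley hp ht hm⟩⟩

theorem exists_of_endsInverse {j : ι} {p : List (Arrow V)} (h : σ.EndsInverse j p) :
    j - 1 ∈ σ.pos ∧ j ∈ σ.pos ∧ j + 1 ∉ σ.pos ∧ E.L (j - 1) = .inverse p ∧
      ∃ q, E.L j = .direct q ∧ ∀ q', G.IsOtherLeg (σ.vertex j) p q' ↔ q' = q := by
  obtain ⟨h1, h2, h3, q, hq, hp, ht⟩ := E.left_of_none h.1 h.2
  have hL := E.eq_of_letter _ _ h.2
  have hm := E.meet' h2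
  rw [hq, hL] at hm
  have hm' := IsValley.symm hm
  exact ⟨h1, h2, h3, hL, q, hq, fun q' => ⟨fun h' => h'.eq_of_isValley hp ht hm',
    fun h' => h' ▸ GentleQuiver.isOtherLeg_of_isValley hp ht hm'⟩⟩

theorem exists_of_startsInverse {i : ι} {p : List (Arrow V)} (h : σ.StartsInverse i p) :
    i - 1 ∉ σ.pos ∧ i ∈ σ.pos ∧ i + 1 ∈ σ.pos ∧ E.L i = .inverse p ∧
      ∃ q, E.L (i - 1) = .inverse q ∧ ∀ q', G.IsKernelLeg p q' ↔ q' = q ∧ q ≠ [] := by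
  obtain ⟨h1, h2, h3, q, hq, hp, ht⟩ := E.right_of_none h.1 h.2
  have hL := E.eq_of_letter _ _ h.2
  have hm := E.meet' h2
  rw [hq, hL] at hm
  refine ⟨h1, h2, h3, hL, q, hq, fun q' => ⟨fun h' => ?_, fun h' =>
    h'.1 ▸ GentleQuiver.isKernelLeg_of_isPass hp ht hm h'.2⟩⟩
  obtain rfl := h'.eq_of_isPass hp ht hm
  obtain ⟨b, c, -, -, hc⟩ := h'
  exact ⟨rfl, fun h0 => by simpa [h0] using hc.head⟩

theorem exists_of_endsDirect {j : ι} {p : List (Arrow V)} (h : σ.EndsDirect j p) :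
    j - 1 ∈ σ.pos ∧ j ∈ σ.pos ∧ j + 1 ∉ σ.pos ∧ E.L (j - 1) = .direct p ∧
      ∃ q, E.L j = .direct q ∧ ∀ q', G.IsKernelLeg p q' ↔ q' = q ∧ q ≠ [] := by
  obtain ⟨h1, h2, h3, q, hq, hp, ht⟩ := E.left_of_none h.1 h.2
  have hL := E.eq_of_letter _ _ h.2
  have hm := E.meet' h2
  rw [hq, hL] at hm
  refine ⟨h1, h2, h3, hL, q, hq, fun q' => ⟨fun h' => ?_, fun h' =>
    h'.1 ▸ GentleQuiver.isKernelLeg_of_isPass hp ht hm h'.2⟩⟩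
  obtain rfl := h'.eq_of_isPass hp ht hm
  obtain ⟨b, c, -, -, hc⟩ := h'
  exact ⟨rfl, fun h0 => by simpa [h0] using hc.head⟩

theorem isRun_kernel {i : ι} (ht : i ∈ σ.pos ∨ i + 1 ∈ σ.pos) (hr : ¬ E.Joint i)
    (hl : ¬ E.Joint (i + 1)) (hn : (E.L i).walk ≠ [])
    (hm : i ∈ σ.pos → i + 1 ∈ σ.pos → 2 ≤ (E.L i).walk.length) : E.IsRun i 1 :=
  isRun_of_joints le_rfl ht (fun k hk => by omega) hr (by rwa [Nat.cast_one]) fun _ => ⟨hn, hm⟩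

theorem not_joint_of_direct {j : ι} {p q : List (Arrow V)} (h : E.L (j - 1) = .direct p)
    (h' : E.L j = .direct q) : ¬ E.Joint j := by
  rintro ⟨-, ho⟩
  rw [h, h'] at ho
  exact ho

theorem not_joint_of_inverse {j : ι} {p q : List (Arrow V)} (h : E.L (j - 1) = .inverse p)
    (h' : E.L j = .inverse q) : ¬ E.Joint j := by
  rintro ⟨-, ho⟩
  rw [h, h'] at ho
  exact ho

theorem walk_ne_nil {i : ι} {x : HLetter V} (h : σ.letter i = some x) : x.walk ≠ [] := by
  rcases x with p | p
  · simpa [HLetter.walk] using (σ.direct_path _ _ h).ne_nil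
  · simpa [HLetter.walk] using (σ.inverse_path _ _ h).ne_nil

variable (E) in
/-- Each application of a rule belongs to a maximal alternating sequence of letters. -/
theorem isRun_summand (s : σ.Summand) : E.IsRun s.runIndex s.runLength := by
  cases s with
  | maxAlternating i m h hr hl =>
    exact isRun_of_joints (by have := h.two_le; simp only [Summand.runLength]; omega)
      (Or.inl h.mem_first.1) (fun k hk => h.joint hk) (h.not_joint_right hr) (h.not_joint_left hl)
      fun hm => by have := h.two_le; simp only [Summand.runLength] at hm; omega
  | cokernel i p q h hl hq =>
    obtain ⟨h1, h2, h3, -⟩ := E.exists_of_startsDirect h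
    refine isRun_of_joints (by simp [Summand.runLength]) (Or.inr (by simpa [Summand.runIndex]))
      (fun k hk => ?_) (not_joint_of_not_mem h1) ?_ (by simp [Summand.runLength])
    · obtain rfl : k = 0 := by simp only [Summand.runLength] at hk; omega
      simpa [Summand.runIndex] using joint_of_startsDirect (E := E) h
    · simp only [Summand.runIndex, Summand.runLength, Nat.cast_ofNat]
      rw [show i - 1 + 2 = i + 1 by ring]
      intro hj
      rcases hj.cases (Or.inl (by rwa [add_sub_cancel_right]))
        with ⟨-, -, h4⟩ | ⟨h4, -⟩ | ⟨-, p', h4⟩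
      · rw [add_sub_cancel_right] at h4
        exact hl h4
      · rw [add_sub_cancel_right] at h4
        exact h4 h2
      · have h5 := h4.2
        rw [add_sub_cancel_right, h.2] at h5
        cases h5
  | cokernelDual j p q h hr hq =>
    obtain ⟨h1, h2, h3, -⟩ := E.exists_of_endsInverse h
    refine isRun_of_joints (by simp [Summand.runLength]) (Or.inl h1)
      (fun k hk => ?_) ?_ ?_ (by simp [Summand.runLength])
    · obtain rfl : k = 0 := by simp only [Summand.runLength] at hk; omega
      simpa [Summand.runIndex] using joint_of_endsInverse (E := E) h
    · intro hj
      simp only [Summand.runIndex] at hj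
      rcases hj.cases (Or.inr (by rwa [sub_add_cancel])) with ⟨-, -, h4⟩ | ⟨-, p', h4⟩ | ⟨h4, -⟩
      · rw [show j - 1 - 1 = j - 2 by ring] at h4
        exact hr h4
      · have h5 := h4.2
        rw [h.2] at h5
        cases h5
      · rw [sub_add_cancel] at h4
        exact h4 h2
    · simp only [Summand.runIndex, Summand.runLength, Nat.cast_ofNat]
      rw [show j - 1 + 2 = j + 1 by ring]
      exact not_joint_of_not_mem h3
  | combined i m p q h hr hl hq =>
    obtain ⟨h1, h2, h3, -⟩ := E.exists_of_startsDirect hr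
    have hm := h.two_le
    refine isRun_of_joints (by simp [Summand.runLength]) (Or.inr (by simpa [Summand.runIndex]))
      (fun k hk => ?_) (not_joint_of_not_mem h1) ?_
      (by simp only [Summand.runLength]; omega)
    · simp only [Summand.runIndex, Summand.runLength] at hk ⊢
      cases k with
      | zero => simpa using joint_of_startsDirect (E := E) hr
      | succ k =>
        rw [Nat.cast_add_one, show i - 1 + ((k : ι) + 1) + 1 = i + k + 1 by ring]
        exact h.joint (by omega)
    · simp only [Summand.runIndex, Summand.runLength]
      rw [Nat.cast_add_one, show i - 1 + ((m : ι) + 1) = i + m by ring]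
      exact h.not_joint_left hl
  | combinedDual i m p q h hr hl hq =>
    obtain ⟨h1, h2, h3, -⟩ := E.exists_of_endsInverse hl
    have hm := h.two_le
    refine isRun_of_joints (by simp [Summand.runLength]) (Or.inl h.mem_first.1)
      (fun k hk => ?_) (h.not_joint_right hr) ?_ (by simp only [Summand.runLength]; omega)
    · simp only [Summand.runIndex, Summand.runLength] at hk ⊢
      by_cases hk' : k + 1 < m
      · exact h.joint hk'
      · obtain rfl : m = k + 1 := by omega
        have := joint_of_endsInverse (E := E) hl
        rwa [Nat.cast_add_one, ← add_assoc] at this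
    · simp only [Summand.runIndex, Summand.runLength]
      rw [Nat.cast_add_one, ← add_assoc]
      exact not_joint_of_not_mem h3
  | combinedBoth i m p q p' q' h hr hq hl hq' =>
    obtain ⟨h1, h2, -⟩ := E.exists_of_startsDirect hr
    obtain ⟨-, -, h3, -⟩ := E.exists_of_endsInverse hl
    have hm := h.two_le
    refine isRun_of_joints (by simp [Summand.runLength]) (Or.inr (by simpa [Summand.runIndex]))
      (fun k hk => ?_) (not_joint_of_not_mem h1) ?_
      (by simp only [Summand.runLength]; omega)
    · simp only [Summand.runIndex, Summand.runLength] at hk ⊢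
      cases k with
      | zero => simpa using joint_of_startsDirect (E := E) hr
      | succ k =>
        rw [Nat.cast_add_one, show i - 1 + ((k : ι) + 1) + 1 = i + k + 1 by ring]
        by_cases hk' : k + 1 < m
        · exact h.joint hk'
        · obtain rfl : m = k + 1 := by omega
          have := joint_of_endsInverse (E := E) hl
          rwa [Nat.cast_add_one, ← add_assoc] at this
    · simp only [Summand.runIndex, Summand.runLength]
      rw [Nat.cast_add, Nat.cast_ofNat, show i - 1 + ((m : ι) + 2) = i + m + 1 by ring]
      exact not_joint_of_not_mem h3
  | kernel j p q h hq =>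
    obtain ⟨h1, h2, h3, hp, q', hq', hu⟩ := E.exists_of_endsDirect h
    obtain ⟨rfl, hne⟩ := (hu q).mp hq
    refine isRun_kernel (Or.inl h2) (not_joint_of_direct hp hq') (not_joint_of_not_mem h3) ?_
      fun _ h4 => absurd h4 h3
    simpa [Summand.runIndex, hq', HLetter.walk] using hne
  | kernelDual i p q h hq =>
    obtain ⟨h1, h2, h3, hp, q', hq', hu⟩ := E.exists_of_startsInverse h
    obtain ⟨rfl, hne⟩ := (hu q).mp hq
    refine isRun_kernel (Or.inr (by simpa [Summand.runIndex])) (not_joint_of_not_mem h1) ?_ ?_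
      fun h4 => absurd h4 h1
    · simpa [Summand.runIndex] using not_joint_of_inverse hq' hp
    · simpa [Summand.runIndex, hq', HLetter.walk] using hne
  | homotopyLetter i p p' h hp hr hl =>
    obtain ⟨h1, h2⟩ := pos_of_letter h
    have hL := E.eq_of_letter _ _ h
    refine isRun_kernel (Or.inl h1) (not_joint_of_direct (E.eq_of_letter _ _ hr) hL) ?_ ?_ ?_
    · intro hj
      simp only [Summand.runIndex] at hj
      rcases hj.cases (Or.inl (by rwa [add_sub_cancel_right]))
        with ⟨-, -, h4⟩ | ⟨h4, -⟩ | ⟨-, p', h4⟩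
      · rw [add_sub_cancel_right] at h4
        exact hl h4
      · rw [add_sub_cancel_right] at h4
        exact h4 h1
      · have h5 := h4.2
        rw [add_sub_cancel_right, h] at h5
        cases h5
    · simp only [Summand.runIndex, hL]
      exact walk_ne_nil h
    · simpa [Summand.runIndex, hL, HLetter.walk] using fun _ _ => hp
  | homotopyLetterDual i p p' h hp hl hr =>
    obtain ⟨h1, h2⟩ := pos_of_letter h
    have hL := E.eq_of_letter _ _ h
    refine isRun_kernel (Or.inl h1) ?_ (not_joint_of_inverse (p := p) (q := p')
      (by simpa [Summand.runIndex] using hL) (E.eq_of_letter _ _ hl)) ?_ ?_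
    · intro hj
      simp only [Summand.runIndex] at hj
      rcases hj.cases (Or.inr h2) with ⟨-, -, h4⟩ | ⟨-, p', h4⟩ | ⟨h4, -⟩
      · exact hr h4
      · have h5 := h4.2
        rw [h] at h5
        cases h5
      · exact h4 h2
    · simp only [Summand.runIndex, hL]
      exact walk_ne_nil h
    · simpa [Summand.runIndex, hL, HLetter.walk] using fun _ _ => hp

variable (E) in
theorem degree_summand [Fintype V] (s : σ.Summand) : s.degree = E.letterDeg s.runIndex := by
  cases s with
  | maxAlternating i m h hr hl =>
    have e := letter_eq_L (E := E) h.mem_first.1 h.mem_first.2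
    simp only [Summand.degree, Summand.runIndex]
    rcases hL : E.L i with p | p <;> rw [hL] at e
    · rw [letterDeg_direct hL]
      have := σ.direct_deg _ _ e
      omega
    · rw [letterDeg_inverse hL]
      have := σ.inverse_deg _ _ e
      omega
  | cokernel i p q h hl hq =>
    obtain ⟨-, -, -, -, q', hq', -⟩ := E.exists_of_startsDirect h
    simp only [Summand.degree, Summand.runIndex]
    rw [letterDeg_inverse hq', sub_add_cancel]
  | cokernelDual j p q h hr hq =>
    obtain ⟨-, -, -, hp, -⟩ := E.exists_of_endsInverse h
    simp only [Summand.degree, Summand.runIndex]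
    rw [letterDeg_inverse hp, sub_add_cancel]
  | combined i m p q h hr hl hq =>
    obtain ⟨-, -, -, -, q', hq', -⟩ := E.exists_of_startsDirect hr
    simp only [Summand.degree, Summand.runIndex]
    rw [letterDeg_inverse hq', sub_add_cancel]
  | combinedDual i m p q h hr hl hq =>
    obtain ⟨-, -, -, -, q', hq', -⟩ := E.exists_of_endsInverse hl
    have := (E.isRun_summand (.combinedDual i m p q h hr hl hq)).letterDeg_add (Nat.lt_succ_self m)
    simp only [Summand.runIndex] at this
    simp only [Summand.degree, Summand.runIndex]
    rw [← this, letterDeg_direct hq']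
  | combinedBoth i m p q p' q' h hr hq hl hq' =>
    obtain ⟨-, -, -, -, q', hq', -⟩ := E.exists_of_startsDirect hr
    simp only [Summand.degree, Summand.runIndex]
    rw [letterDeg_inverse hq', sub_add_cancel]
  | kernel j p q h hq =>
    obtain ⟨h1, h2, h3, hp, q', hq', hu⟩ := E.exists_of_endsDirect h
    exact (letterDeg_direct hq').symm
  | kernelDual i p q h hq =>
    obtain ⟨h1, h2, h3, hp, q', hq', hu⟩ := E.exists_of_startsInverse h
    simp only [Summand.degree, Summand.runIndex]
    rw [letterDeg_inverse hq', sub_add_cancel]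
  | homotopyLetter i p p' h hp hr hl => exact (letterDeg_direct (E.eq_of_letter _ _ h)).symm
  | homotopyLetterDual i p p' h hp hl hr => exact (letterDeg_inverse (E.eq_of_letter _ _ h)).symm

end Completion

end HSequence

end Summands

/-! ### The words of the rules -/

section Summands

variable {G : GentleQuiver V} {ι : Type} [CommRing ι]

namespace Word

theorem dropFirst_of_ne_nil (x y : V) {l : List (Letter V)} (h : l ≠ []) :
    (⟨x, l⟩ : Word V).dropFirst = (⟨y, l⟩ : Word V).dropFirst := by
  cases l with
  | nil => exact absurd rfl h
  | cons a l => rfl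

theorem dropFirst_append (x y : V) {l : List (Letter V)} (h : l ≠ []) (q : List (Arrow V)) :
    (⟨x, l ++ q.map Letter.fwd⟩ : Word V).dropFirst = (⟨y, l⟩ : Word V).dropFirst.extendLeft q := by
  cases l with
  | nil => exact absurd rfl h
  | cons a l => rfl

end Word

namespace HSequence

variable {σ : HSequence G ι}

namespace Completion

variable {E : σ.Completion}

theorem runLetters_succ (i : ι) (m : ℕ) :
    E.runLetters i (m + 1) = E.runLetters i m ++ (E.L (i + m)).walk := by
  simp [runLetters, List.range_succ]

theorem runLetters_succ' (i : ι) (m : ℕ) :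
    E.runLetters i (m + 1) = (E.L i).walk ++ E.runLetters (i + 1) m := by
  simp only [runLetters, List.range_succ_eq_map, List.flatMap_cons, List.flatMap_map,
    Nat.cast_zero, add_zero]
  congr 2
  funext k
  rw [Nat.cast_succ, show i + ((k : ι) + 1) = i + 1 + k by ring]

theorem runLetters_one (i : ι) : E.runLetters i 1 = (E.L i).walk := by
  simp [runLetters]

theorem runLetters_eq_subword {i : ι} {m : ℕ}
    (h : ∀ k < m, i + (k : ι) ∈ σ.pos ∧ i + (k : ι) + 1 ∈ σ.pos) :
    E.runLetters i m = (σ.subword i m).letters := by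
  rw [subword_letters, runLetters]
  refine List.flatMap_congr fun k hk => ?_
  obtain ⟨h1, h2⟩ := h k (List.mem_range.mp hk)
  rw [letter_eq_L (E := E) h1 h2]
  rfl

theorem subword_ne_nil {i : ι} {m : ℕ} (hm : m ≠ 0) (h1 : i ∈ σ.pos) (h2 : i + 1 ∈ σ.pos) :
    (σ.subword i m).letters ≠ [] := by
  obtain ⟨x, hx⟩ := Option.isSome_iff_exists.mp ((σ.letter_isSome i).mpr ⟨h1, h2⟩)
  rw [subword_letters]
  intro h
  rw [List.flatMap_eq_nil_iff] at h
  have := h 0 (List.mem_range.mpr (by omega))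
  rw [Nat.cast_zero, add_zero, hx] at this
  exact walk_ne_nil hx this

theorem runWord_of_mem {i : ι} {m : ℕ} (h : i ∈ σ.pos) (h' : i + m ∈ σ.pos) :
    E.runWord i m = (⟨E.startVertex i, E.runLetters i m⟩ : Word V).dropFirst.dropLast := by
  rw [runWord, if_pos h, if_pos h']

theorem runWord_of_mem_of_not_mem {i : ι} {m : ℕ} (h : i ∈ σ.pos) (h' : i + m ∉ σ.pos) :
    E.runWord i m = (⟨E.startVertex i, E.runLetters i m⟩ : Word V).dropFirst := by
  rw [runWord, if_pos h, if_neg h']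

theorem runWord_of_not_mem_of_mem {i : ι} {m : ℕ} (h : i ∉ σ.pos) (h' : i + m ∈ σ.pos) :
    E.runWord i m = (⟨E.startVertex i, E.runLetters i m⟩ : Word V).dropLast := by
  rw [runWord, if_neg h, if_pos h']

theorem runWord_of_not_mem {i : ι} {m : ℕ} (h : i ∉ σ.pos) (h' : i + m ∉ σ.pos) :
    E.runWord i m = (⟨E.startVertex i, E.runLetters i m⟩ : Word V) := by
  rw [runWord, if_neg h, if_neg h']

/-- The word of a summand is the word of its maximal alternating sequence. The dual of the kernel
rule is an exception: there these two words are inverse to each other. -/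
theorem word_summand (s : σ.Summand) (hs : ∀ i p q h hq, s ≠ .kernelDual i p q h hq) :
    s.word = E.runWord s.runIndex s.runLength := by
  cases s with
  | maxAlternating i m h hr hl =>
    have hne := subword_ne_nil (m := m) (by have := h.two_le; omega) h.mem_first.1 h.mem_first.2
    simp only [Summand.word, Summand.runIndex, Summand.runLength]
    rw [runWord_of_mem h.mem_first.1 h.mem_last.2, runLetters_eq_subword fun k hk => h.mem_pos hk]
    exact congrArg Word.dropLast (Word.dropFirst_of_ne_nil _ _ hne)
  | cokernel i p q h hl hq =>
    obtain ⟨h1, h2, h3, hp, q', hq', hu⟩ := E.exists_of_startsDirect h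
    obtain rfl := (hu q).mp hq
    have hne := subword_ne_nil one_ne_zero h2 h3
    simp only [Summand.word, Summand.runIndex, Summand.runLength]
    rw [runWord_of_not_mem_of_mem h1 (by
      rw [Nat.cast_ofNat, show i - 1 + 2 = i + 1 by ring]; exact h3), startVertex, hq',
      runLetters_succ', hq', sub_add_cancel, runLetters_eq_subword (by simpa using ⟨h2, h3⟩)]
    simp only [Word.dropLast, HLetter.walk, List.dropLast_append_of_ne_nil hne]
    rfl
  | cokernelDual j p q h hr hq =>
    obtain ⟨h1, h2, h3, hp, q', hq', hu⟩ := E.exists_of_endsInverse h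
    obtain rfl := (hu q).mp hq
    have h2' : j - 1 + 1 ∈ σ.pos := by rwa [sub_add_cancel]
    have hne := subword_ne_nil one_ne_zero h1 h2'
    simp only [Summand.word, Summand.runIndex, Summand.runLength]
    rw [runWord_of_mem_of_not_mem h1 (by
      rw [Nat.cast_ofNat, show j - 1 + 2 = j + 1 by ring]; exact h3),
      runLetters_succ, Nat.cast_one, sub_add_cancel, hq',
      runLetters_eq_subword (by simpa using ⟨h1, h2⟩)]
    exact (Word.dropFirst_append _ _ hne _).symm
  | combined i m p q h hr hl hq =>
    obtain ⟨h1, h2, h3, hp, q', hq', hu⟩ := E.exists_of_startsDirect hr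
    obtain rfl := (hu q).mp hq
    have hne := subword_ne_nil (m := m) (by have := h.two_le; omega) h.mem_first.1 h.mem_first.2
    simp only [Summand.word, Summand.runIndex, Summand.runLength]
    rw [runWord_of_not_mem_of_mem h1 (by
      rw [Nat.cast_add_one, show i - 1 + ((m : ι) + 1) = i + m by ring]; exact h.mem_last.2),
      startVertex, hq', runLetters_succ', hq', sub_add_cancel,
      runLetters_eq_subword fun k hk => h.mem_pos hk]
    simp only [Word.dropLast, HLetter.walk, List.dropLast_append_of_ne_nil hne]
    rfl
  | combinedDual i m p q h hr hl hq =>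
    obtain ⟨h1, h2, h3, hp, q', hq', hu⟩ := E.exists_of_endsInverse hl
    obtain rfl := (hu q).mp hq
    have hne := subword_ne_nil (m := m) (by have := h.two_le; omega) h.mem_first.1 h.mem_first.2
    simp only [Summand.word, Summand.runIndex, Summand.runLength]
    rw [runWord_of_mem_of_not_mem h.mem_first.1 (by
      rw [Nat.cast_add_one, ← add_assoc]; exact h3),
      runLetters_succ, hq', runLetters_eq_subword fun k hk => h.mem_pos hk]
    exact (Word.dropFirst_append _ _ hne _).symm
  | combinedBoth i m p q p' q' h hr hq hl hq' =>
    obtain ⟨h1, h2, -, hp, r, hr', hu⟩ := E.exists_of_startsDirect hr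
    obtain ⟨-, -, h3, hp', r', hr'', hu'⟩ := E.exists_of_endsInverse hl
    obtain rfl := (hu q).mp hq
    obtain rfl := (hu' q').mp hq'
    simp only [Summand.word, Summand.runIndex, Summand.runLength]
    rw [runWord_of_not_mem h1 (by
      rw [Nat.cast_add, Nat.cast_ofNat, show i - 1 + ((m : ι) + 2) = i + m + 1 by ring]
      exact h3), startVertex, hr', runLetters_succ', hr', sub_add_cancel, runLetters_succ, hr'',
      runLetters_eq_subword fun k hk => h.mem_pos hk]
    rfl
  | kernel j p q h hq =>
    obtain ⟨h1, h2, h3, hp, q', hq', hu⟩ := E.exists_of_endsDirect h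
    obtain ⟨rfl, hne⟩ := (hu q).mp hq
    simp only [Summand.word, Summand.runIndex, Summand.runLength]
    rw [runWord_of_mem_of_not_mem h2 (by rwa [Nat.cast_one]), runLetters_one, startVertex, hq']
    rfl
  | kernelDual i p q h hq => exact absurd rfl (hs _ _ _ _ _)
  | homotopyLetter i p p' h hp hr hl =>
    obtain ⟨h1, h2⟩ := pos_of_letter h
    have hne := subword_ne_nil one_ne_zero h1 h2
    simp only [Summand.word, Summand.runIndex, Summand.runLength]
    rw [runWord_of_mem h1 (by rwa [Nat.cast_one]), runLetters_eq_subword (by simpa using ⟨h1, h2⟩)]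
    exact congrArg Word.dropLast (Word.dropFirst_of_ne_nil _ _ hne)
  | homotopyLetterDual i p p' h hp hl hr =>
    obtain ⟨h1, h2⟩ := pos_of_letter h
    have hne := subword_ne_nil one_ne_zero h1 h2
    simp only [Summand.word, Summand.runIndex, Summand.runLength]
    rw [runWord_of_mem h1 (by rwa [Nat.cast_one]), runLetters_eq_subword (by simpa using ⟨h1, h2⟩)]
    exact congrArg Word.dropLast (Word.dropFirst_of_ne_nil _ _ hne)

end Completion

namespace Summand

/-- The number of the rule that contributes the summand. -/
def rule : σ.Summand → ℕ
  | maxAlternating _ _ _ _ _ => 0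
  | cokernel _ _ _ _ _ _ => 1
  | cokernelDual _ _ _ _ _ _ => 2
  | combined _ _ _ _ _ _ _ _ => 3
  | combinedDual _ _ _ _ _ _ _ _ => 4
  | combinedBoth _ _ _ _ _ _ _ _ _ _ _ => 5
  | kernel _ _ _ _ _ => 6
  | kernelDual _ _ _ _ _ => 7
  | homotopyLetter _ _ _ _ _ _ _ => 8
  | homotopyLetterDual _ _ _ _ _ _ _ => 9

end Summand

namespace Completion

variable (E : σ.Completion)

open Classical in
/-- The number of the rule that belongs to the maximal alternating sequence of `m` letters from the
index `i` on. -/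
def runRule (i : ι) (m : ℕ) : ℕ :=
  if i ∈ σ.pos then
    if i + m ∈ σ.pos then
      if m = 1 then
        match E.L i with
        | .direct _ => 8
        | .inverse _ => 9
      else 0
    else if m = 1 then 6 else if m = 2 then 2 else 4
  else
    if i + m ∈ σ.pos then
      if m = 1 then 7 else if m = 2 then 1 else 3
    else 5

theorem rule_summand (s : σ.Summand) : s.rule = E.runRule s.runIndex s.runLength := by
  cases s with
  | maxAlternating i m h hr hl =>
    have := h.two_le
    simp only [Summand.rule, Summand.runIndex, Summand.runLength]
    rw [runRule, if_pos h.mem_first.1, if_pos h.mem_last.2, if_neg (by omega)]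
  | cokernel i p q h hl hq =>
    obtain ⟨h1, h2, h3, -⟩ := E.exists_of_startsDirect h
    simp only [Summand.rule, Summand.runIndex, Summand.runLength]
    rw [runRule, if_neg h1, if_pos (by
      rw [Nat.cast_ofNat, show i - 1 + 2 = i + 1 by ring]; exact h3)]
    rfl
  | cokernelDual j p q h hr hq =>
    obtain ⟨h1, h2, h3, -⟩ := E.exists_of_endsInverse h
    simp only [Summand.rule, Summand.runIndex, Summand.runLength]
    rw [runRule, if_pos h1, if_neg (by
      rw [Nat.cast_ofNat, show j - 1 + 2 = j + 1 by ring]; exact h3)]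
    rfl
  | combined i m p q h hr hl hq =>
    obtain ⟨h1, -⟩ := E.exists_of_startsDirect hr
    have := h.two_le
    simp only [Summand.rule, Summand.runIndex, Summand.runLength]
    rw [runRule, if_neg h1, if_pos (by
      rw [Nat.cast_add_one, show i - 1 + ((m : ι) + 1) = i + m by ring]; exact h.mem_last.2),
      if_neg (by omega), if_neg (by omega)]
  | combinedDual i m p q h hr hl hq =>
    obtain ⟨-, -, h3, -⟩ := E.exists_of_endsInverse hl
    have := h.two_le
    simp only [Summand.rule, Summand.runIndex, Summand.runLength]
    rw [runRule, if_pos h.mem_first.1, if_neg (by rw [Nat.cast_add_one, ← add_assoc]; exact h3),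
      if_neg (by omega), if_neg (by omega)]
  | combinedBoth i m p q p' q' h hr hq hl hq' =>
    obtain ⟨h1, -⟩ := E.exists_of_startsDirect hr
    obtain ⟨-, -, h3, -⟩ := E.exists_of_endsInverse hl
    simp only [Summand.rule, Summand.runIndex, Summand.runLength]
    rw [runRule, if_neg h1, if_neg (by
      rw [Nat.cast_add, Nat.cast_ofNat, show i - 1 + ((m : ι) + 2) = i + m + 1 by ring]
      exact h3)]
  | kernel j p q h hq =>
    obtain ⟨h1, h2, h3, -⟩ := E.exists_of_endsDirect h
    simp only [Summand.rule, Summand.runIndex, Summand.runLength]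
    rw [runRule, if_pos h2, if_neg (by rwa [Nat.cast_one])]
    rfl
  | kernelDual i p q h hq =>
    obtain ⟨h1, h2, -⟩ := E.exists_of_startsInverse h
    simp only [Summand.rule, Summand.runIndex, Summand.runLength]
    rw [runRule, if_neg h1, if_pos (by rwa [Nat.cast_one, sub_add_cancel])]
    rfl
  | homotopyLetter i p p' h hp hr hl =>
    obtain ⟨h1, h2⟩ := pos_of_letter h
    simp only [Summand.rule, Summand.runIndex, Summand.runLength]
    rw [runRule, if_pos h1, if_pos (by rwa [Nat.cast_one]), if_pos rfl, E.eq_of_letter _ _ h]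
  | homotopyLetterDual i p p' h hp hl hr =>
    obtain ⟨h1, h2⟩ := pos_of_letter h
    simp only [Summand.rule, Summand.runIndex, Summand.runLength]
    rw [runRule, if_pos h1, if_pos (by rwa [Nat.cast_one]), if_pos rfl, E.eq_of_letter _ _ h]

theorem startsDirect_unique {i : ι} {p p' q q' : List (Arrow V)} (E : σ.Completion)
    (h : σ.StartsDirect i p)
    (h' : σ.StartsDirect i p') (hq : G.IsOtherLeg (σ.vertex i) p q)
    (hq' : G.IsOtherLeg (σ.vertex i) p' q') : p = p' ∧ q = q' := by
  have e := h.2.symm.trans h'.2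
  cases e
  obtain ⟨-, -, -, -, r, -, hu⟩ := E.exists_of_startsDirect h
  exact ⟨rfl, ((hu q).mp hq).trans ((hu q').mp hq').symm⟩

theorem endsInverse_unique {i : ι} {p p' q q' : List (Arrow V)} (E : σ.Completion)
    (h : σ.EndsInverse i p)
    (h' : σ.EndsInverse i p') (hq : G.IsOtherLeg (σ.vertex i) p q)
    (hq' : G.IsOtherLeg (σ.vertex i) p' q') : p = p' ∧ q = q' := by
  have e := h.2.symm.trans h'.2
  cases e
  obtain ⟨-, -, -, -, r, -, hu⟩ := E.exists_of_endsInverse h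
  exact ⟨rfl, ((hu q).mp hq).trans ((hu q').mp hq').symm⟩

/-- A summand is determined by its maximal alternating sequence. -/
theorem summand_injective (E : σ.Completion) {s s' : σ.Summand} (hi : s.runIndex = s'.runIndex)
    (hm : s.runLength = s'.runLength) : s = s' := by
  have hr : s.rule = s'.rule := by rw [E.rule_summand, E.rule_summand, hi, hm]
  cases s <;> cases s' <;> simp only [Summand.rule] at hr <;>
    (try exact absurd hr (by decide)) <;>
    simp only [Summand.runIndex, Summand.runLength, sub_left_inj, add_left_inj] at hi hm
  · subst hi hm
    rfl
  · next i p q h hl hq i' p' q' h' hl' hq' =>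
    subst hi
    obtain ⟨rfl, rfl⟩ := startsDirect_unique E h h' hq hq'
    rfl
  · next i p q h hl hq i' p' q' h' hl' hq' =>
    subst hi
    obtain ⟨rfl, rfl⟩ := endsInverse_unique E h h' hq hq'
    rfl
  · next i m p q h hs hl hq i' m' p' q' h' hs' hl' hq' =>
    subst hi hm
    obtain ⟨rfl, rfl⟩ := startsDirect_unique E hs hs' hq hq'
    rfl
  · next i m p q h hs hl hq i' m' p' q' h' hs' hl' hq' =>
    subst hi hm
    obtain ⟨rfl, rfl⟩ := endsInverse_unique E hl hl' hq hq'
    rfl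
  · next i m p q r t h hs hq hl ht i' m' p' q' r' t' h' hs' hq' hl' ht' =>
    subst hi hm
    obtain ⟨rfl, rfl⟩ := startsDirect_unique E hs hs' hq hq'
    obtain ⟨rfl, rfl⟩ := endsInverse_unique E hl hl' ht ht'
    rfl
  · next i p q h hq i' p' q' h' hq' =>
    subst hi
    have e := h.2.symm.trans h'.2
    cases e
    obtain ⟨-, -, -, -, r, -, hu⟩ := E.exists_of_endsDirect h
    obtain rfl := ((hu q).mp hq).1.trans ((hu q').mp hq').1.symm
    rfl
  · next i p q h hq i' p' q' h' hq' =>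
    subst hi
    have e := h.2.symm.trans h'.2
    cases e
    obtain ⟨-, -, -, -, r, -, hu⟩ := E.exists_of_startsInverse h
    obtain rfl := ((hu q).mp hq).1.trans ((hu q').mp hq').1.symm
    rfl
  · next i p p' h hp hs hl i' r r' h' hr hs' hl' =>
    subst hi
    have e := h.symm.trans h'
    cases e
    have e := hs.symm.trans hs'
    cases e
    rfl
  · next i p p' h hp hs hl i' r r' h' hr hs' hl' =>
    subst hi
    have e := h.symm.trans h'
    cases e
    have e := hs.symm.trans hs'
    cases e
    rfl

end Completion

end HSequence

end Summands

/-! ### The rule of a maximal alternating sequence -/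

section Exhaustion

variable {G : GentleQuiver V} {ι : Type} [CommRing ι]

namespace HSequence

variable {σ : HSequence G ι}

namespace Completion

variable {E : σ.Completion}

theorem not_alternate_of_none_left {x y : Option (HLetter V)} (h : x = none) : ¬ Alternate x y := by
  rintro (⟨p, q, h1, -⟩ | ⟨p, q, h1, -⟩) <;>
  · rw [h] at h1
    cases h1

theorem not_alternate_of_none_right {x y : Option (HLetter V)} (h : y = none) :
    ¬ Alternate x y := by
  rintro (⟨p, q, -, h1⟩ | ⟨p, q, -, h1⟩) <;>
  · rw [h] at h1
    cases h1

theorem not_alternate_of_not_joint {j : ι} (h : ¬ E.Joint j) :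
    ¬ Alternate (σ.letter (j - 1)) (σ.letter j) := fun h' => h (joint_of_alternate h')

theorem isMaxAlternating_of_joints {i : ι} {m : ℕ} (hm : 2 ≤ m) (h1 : i ∈ σ.pos)
    (h2 : i + m ∈ σ.pos) (hj : ∀ k : ℕ, k + 1 < m → E.Joint (i + k + 1))
    (hr : ¬ Alternate (σ.letter (i - 1)) (σ.letter i))
    (hl : ¬ Alternate (σ.letter (i + m - 1)) (σ.letter (i + m))) : σ.IsMaxAlternating i m where
  two_le := hm
  right := hr
  left := hl
  alternate k hk := by
    have hk1 : i + (k : ι) ∈ σ.pos := by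
      cases k with
      | zero => simpa using h1
      | succ k =>
        rw [Nat.cast_add_one, ← add_assoc]
        exact (hj k (by omega)).1
    have hk2 : i + (k : ι) + 1 + 1 ∈ σ.pos := by
      by_cases hk' : k + 2 < m
      · have := (hj (k + 1) hk').1
        rwa [Nat.cast_add_one, ← add_assoc] at this
      · obtain rfl : m = k + 2 := by omega
        rwa [Nat.cast_add, Nat.cast_ofNat, ← add_assoc,
          show i + (k : ι) + 2 = i + k + 1 + 1 by ring] at h2
    have e : i + (k : ι) + 1 - 1 = i + k := add_sub_cancel_right _ _
    rcases (hj k hk).cases (Or.inl (by rwa [e])) with ⟨-, -, h⟩ | ⟨h, -⟩ | ⟨h, -⟩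
    · rwa [e] at h
    · exact absurd (by rwa [e]) h
    · exact absurd hk2 h

/-- A joint at the right end. -/
theorem Joint.startsDirect {j : ι} (h : E.Joint j) (h1 : j - 1 ∉ σ.pos) (h2 : j + 1 ∈ σ.pos) :
    ∃ p q, σ.StartsDirect j p ∧ G.IsOtherLeg (σ.vertex j) p q := by
  rcases h.cases (Or.inr h2) with ⟨h', -⟩ | ⟨-, p, hp⟩ | ⟨h', -⟩
  · exact absurd h' h1
  · obtain ⟨-, -, -, -, q, -, hu⟩ := E.exists_of_startsDirect hp
    exact ⟨p, q, hp, (hu q).mpr rfl⟩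
  · exact absurd h2 h'

theorem Joint.endsInverse {j : ι} (h : E.Joint j) (h1 : j + 1 ∉ σ.pos) (h2 : j - 1 ∈ σ.pos) :
    ∃ p q, σ.EndsInverse j p ∧ G.IsOtherLeg (σ.vertex j) p q := by
  rcases h.cases (Or.inl h2) with ⟨-, h', -⟩ | ⟨h', -⟩ | ⟨-, p, hp⟩
  · exact absurd h' h1
  · exact absurd h2 h'
  · obtain ⟨-, -, -, -, q, -, hu⟩ := E.exists_of_endsInverse hp
    exact ⟨p, q, hp, (hu q).mpr rfl⟩

theorem not_startsDirect {j : ι} (h : ¬ E.Joint j) (p : List (Arrow V)) :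
    ¬ σ.StartsDirect j p := fun h' => h (joint_of_startsDirect h')

theorem not_endsInverse {j : ι} (h : ¬ E.Joint j) (p : List (Arrow V)) :
    ¬ σ.EndsInverse j p := fun h' => h (joint_of_endsInverse h')

/-- A maximal alternating sequence belongs to a rule, provided that `σ` is not trivial. -/
theorem IsRun.exists_summand {i : ι} {m : ℕ} (h : E.IsRun i m)
    (hn : ∀ j ∈ σ.pos, j - 1 ∈ σ.pos ∨ j + 1 ∈ σ.pos) :
    ∃ s : σ.Summand, s.runIndex = i ∧ s.runLength = m := by
  have hone := h.one_le
  have hr := h.not_joint_right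
  have hl := h.not_joint_left
  by_cases h1 : i ∈ σ.pos <;> by_cases h2 : i + (m : ι) ∈ σ.pos
  · -- no virtual letters
    by_cases hm : m = 1
    · subst hm
      rw [Nat.cast_one] at h2 hl
      have e := letter_eq_L (E := E) h1 h2
      have hlen := h.two_le rfl h1 h2
      have hr' := h.right h1
      have hl' := h.left 0 rfl (by simpa using h2)
      simp only [Nat.cast_zero, add_zero] at hl'
      rcases hL : E.L i with p | p <;> rw [hL] at e hlen hr' hl'
      · rcases hp : E.L (i - 1) with p' | p'
        · refine ⟨.homotopyLetter i p p' e (by simpa [HLetter.walk] using hlen)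
            (letter_of_direct hp (by rwa [sub_add_cancel])) ?_, rfl, rfl⟩
          have := not_alternate_of_not_joint hl
          rwa [add_sub_cancel_right] at this
        · rw [hp] at hr'
          exact absurd trivial hr'
      · rcases hp : E.L (i + 1) with p' | p'
        · rw [hp] at hl'
          exact absurd trivial hl'
        · exact ⟨.homotopyLetterDual i p p' e (by simpa [HLetter.walk] using hlen)
            (letter_of_inverse hp h2) (not_alternate_of_not_joint hr), rfl, rfl⟩
    · exact ⟨.maxAlternating i m (isMaxAlternating_of_joints (by omega) h1 h2 h.joint
        (not_alternate_of_not_joint hr) (not_alternate_of_not_joint hl)) (not_startsDirect hr)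
        (not_endsInverse hl), rfl, rfl⟩
  · -- the last letter is virtual
    by_cases hm : m = 1
    · subst hm
      rw [Nat.cast_one] at h2 hl
      have h3 := (hn i h1).resolve_right h2
      obtain ⟨q, hq, hpath, hterm⟩ := E.left_end i h1 h2
      have hr' := h.right h1
      rcases hp : E.L (i - 1) with p | p
      · have hm := E.meet' h1
        rw [hp, hq] at hm
        refine ⟨.kernel i p q ⟨letter_none_of_succ_not_mem h2, ?_⟩
          (GentleQuiver.isKernelLeg_of_isPass hpath hterm hm ?_), rfl, rfl⟩
        · exact letter_of_direct hp (by rwa [sub_add_cancel])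
        · have := h.ne_nil rfl
          rw [hq] at this
          simpa [HLetter.walk] using this
      · rw [hp, hq] at hr'
        exact absurd trivial hr'
    · obtain ⟨n, rfl⟩ : ∃ n, m = n + 2 := ⟨m - 2, by omega⟩
      have hj := h.joint n (by omega)
      have e : i + ((n + 2 : ℕ) : ι) = i + n + 1 + 1 := by push_cast; ring
      rw [e] at h2
      have h3 : i + (n : ι) + 1 - 1 ∈ σ.pos := by
        rw [add_sub_cancel_right]
        cases n with
        | zero => simpa using h1
        | succ n =>
          rw [Nat.cast_add_one, ← add_assoc]
          exact (h.joint n (by omega)).1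
      obtain ⟨p, q, hp, hq⟩ := hj.endsInverse h2 h3
      cases n with
      | zero =>
        simp only [Nat.cast_zero, add_zero] at hp hq
        refine ⟨.cokernelDual (i + 1) p q hp ?_ hq, by simp [Summand.runIndex], rfl⟩
        rw [show i + 1 - 2 = i - 1 by ring, add_sub_cancel_right]
        exact not_alternate_of_not_joint hr
      | succ n =>
        have e' : i + ((n + 1 : ℕ) : ι) + 1 = i + ((n + 2 : ℕ) : ι) := by push_cast; ring
        rw [e'] at hp hq h2 h3 hj
        exact ⟨.combinedDual i (n + 2) p q (isMaxAlternating_of_joints (by omega) h1 hj.1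
          (fun k hk => h.joint k (by omega)) (not_alternate_of_not_joint hr)
          (not_alternate_of_none_right hp.1)) (not_startsDirect hr) hp hq, rfl, rfl⟩
  · -- the first letter is virtual
    have h3 := h.touches.resolve_left h1
    obtain ⟨j, rfl⟩ : ∃ j, i = j - 1 := ⟨i + 1, by ring⟩
    rw [sub_add_cancel] at h3
    by_cases hm : m = 1
    · subst hm
      rw [Nat.cast_one, sub_add_cancel] at hl
      have h4 := (hn j h3).resolve_left h1
      obtain ⟨q, hq, hpath, hterm⟩ := E.right_end (j - 1) h1 (by rwa [sub_add_cancel])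
      rw [sub_add_cancel] at hpath
      have hm := E.meet' h3
      rcases hp : E.L j with p | p
      · exact absurd ⟨h3, by rw [hq, hp]; trivial⟩ hl
      · rw [hp, hq] at hm
        refine ⟨.kernelDual j p q ⟨letter_none_of_not_mem h1, letter_of_inverse hp h3⟩
          (GentleQuiver.isKernelLeg_of_isPass hpath hterm hm ?_), rfl, rfl⟩
        have := h.ne_nil rfl
        rw [hq] at this
        simpa [HLetter.walk] using this
    · obtain ⟨n, rfl⟩ : ∃ n, m = n + 2 := ⟨m - 2, by omega⟩
      have hj := h.joint 0 (by omega)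
      rw [Nat.cast_zero, add_zero, sub_add_cancel] at hj
      have h4 : j + 1 ∈ σ.pos := by
        cases n with
        | zero =>
          rwa [zero_add, Nat.cast_ofNat, show j - 1 + 2 = j + 1 by ring] at h2
        | succ n =>
          have := (h.joint 1 (by omega)).1
          rwa [Nat.cast_one, sub_add_cancel] at this
      obtain ⟨p, q, hp, hq⟩ := hj.startsDirect h1 h4
      have e : j - 1 + ((n + 2 : ℕ) : ι) = j + ((n + 1 : ℕ) : ι) := by push_cast; ring
      rw [e] at h2 hl
      cases n with
      | zero =>
        refine ⟨.cokernel j p q hp ?_ hq, rfl, rfl⟩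
        rw [zero_add, Nat.cast_one] at hl
        have := not_alternate_of_not_joint hl
        rwa [add_sub_cancel_right] at this
      | succ n =>
        have hall : ∀ k : ℕ, k + 1 < n + 2 → E.Joint (j + k + 1) := by
          intro k hk
          have := h.joint (k + 1) (by omega)
          rwa [Nat.cast_add_one, show j - 1 + ((k : ι) + 1) = j + k by ring] at this
        exact ⟨.combined j (n + 2) p q (isMaxAlternating_of_joints (by omega) h3 h2 hall
          (not_alternate_of_none_left hp.1) (not_alternate_of_not_joint hl)) hp
          (not_endsInverse hl) hq, rfl, rfl⟩
  · -- both end letters are virtual, and at least two letters lie in between: `σ` is not trivial, and a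
    -- single letter is not both direct and inverse
    have h3 := h.touches.resolve_left h1
    obtain ⟨j, rfl⟩ : ∃ j, i = j - 1 := ⟨i + 1, by ring⟩
    rw [sub_add_cancel] at h3
    have h4 := (hn j h3).resolve_left h1
    have hm1 : m ≠ 1 := by
      rintro rfl
      rw [Nat.cast_one, sub_add_cancel] at h2
      exact h2 h3
    have hm2 : m ≠ 2 := by
      rintro rfl
      rw [Nat.cast_ofNat, show j - 1 + 2 = j + 1 by ring] at h2
      exact h2 h4
    obtain ⟨n, rfl⟩ : ∃ n, m = n + 3 := ⟨m - 3, by omega⟩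
    have hj := h.joint 0 (by omega)
    rw [Nat.cast_zero, add_zero, sub_add_cancel] at hj
    obtain ⟨p, q, hp, hq⟩ := hj.startsDirect h1 h4
    have hj' := h.joint (n + 1) (by omega)
    have e : j - 1 + ((n + 1 : ℕ) : ι) + 1 = j + ((n + 1 : ℕ) : ι) := by push_cast; ring
    have e2 : j - 1 + ((n + 3 : ℕ) : ι) = j + ((n + 1 : ℕ) : ι) + 1 := by push_cast; ring
    rw [e] at hj'
    rw [e2] at h2
    have h5 : j + ((n + 1 : ℕ) : ι) - 1 ∈ σ.pos := by
      have := (h.joint n (by omega)).1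
      rwa [show j - 1 + (n : ι) + 1 = j + ((n + 1 : ℕ) : ι) - 1 by push_cast; ring] at this
    obtain ⟨p', q', hp', hq'⟩ := hj'.endsInverse h2 h5
    cases n with
    | zero =>
      have h6 := hp'.2
      rw [zero_add, Nat.cast_one, add_sub_cancel_right, hp.2] at h6
      cases h6
    | succ n =>
      have hall : ∀ k : ℕ, k + 1 < n + 2 → E.Joint (j + k + 1) := by
        intro k hk
        have := h.joint (k + 1) (by omega)
        rwa [Nat.cast_add_one, show j - 1 + ((k : ι) + 1) = j + k by ring] at this
      exact ⟨.combinedBoth j (n + 2) p q p' q' (isMaxAlternating_of_joints (by omega) h3 hj'.1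
        hall (not_alternate_of_none_left hp.1) (not_alternate_of_none_right hp'.1))
        hp hq hp' hq', rfl, rfl⟩

end Completion

end HSequence

end Exhaustion

/-! ### The cohomology as a sum of string modules -/

section Cohomology

variable {K : Type u} [Field K] [Fintype V] {G : GentleQuiver V} {ι : Type} [CommRing ι]

instance (w : Word V) (hw : G.IsString w) : Module K (stringModule K w hw) :=
  inferInstanceAs (Module K (stringSchema K w hw).module)

instance (w : Word V) (hw : G.IsString w) :
    IsScalarTower K (GentleAlgebra K G) (stringModule K w hw) :=
  inferInstanceAs (IsScalarTower K (GentleAlgebra K G) (stringSchema K w hw).module)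

/-- The basis of a string module given by the vertices of its word. -/
def stringBasis (w : Word V) (hw : G.IsString w) :
    Module.Basis (Fin (w.letters.length + 1)) K (stringModule K w hw) :=
  (stringSchema K w hw).basis

theorem dfinsuppBasis_apply {T : Type*} {M : T → Type*} [DecidableEq T] [∀ s, AddCommGroup (M s)]
    [∀ s, Module K (M s)] {η : T → Type*} (b : ∀ s, Module.Basis (η s) K (M s))
    (x : (s : T) × η s) : DFinsupp.basis b x = DFinsupp.single x.1 (b x.1 x.2) := by
  classical
  rw [Module.Basis.apply_eq_iff, DFinsupp.basis]
  simp only [LinearEquiv.trans_apply, DFinsupp.mapRange.linearEquiv_apply,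
    DFinsupp.mapRange_single, Module.Basis.repr_self]
  rw [LinearEquiv.symm_apply_eq]
  exact (sigmaFinsuppEquivDFinsupp_single x 1).symm

namespace HSequence

variable {σ : HSequence G ι} {c : ι → K} {d : ℤ}

namespace Completion

variable {E : σ.Completion}

/-- The nodes `n :: S.map tgt` of a walk with word `w` are nonzero multiples of the paths that
represent cohomology classes and are carried by the `m` letters from the index `i` on. -/
structure Spans (E : σ.Completion) (c : ι → K) (d : ℤ) (w : Word V) (i : ι) (m : ℕ)
    (n : K × ι × List (Arrow V)) (S : List (Step K ι V)) : Prop where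
  realizes : σ.Realizes c d n S w.start
  letters : w.letters = S.map Step.letter
  nodup : ((n :: S.map Step.tgt).map Prod.snd).Nodup
  mem_iff : ∀ b, b ∈ (n :: S.map Step.tgt).map Prod.snd ↔ ∃ k < m, E.Owns (i + k) b
  ne_zero : ∀ x ∈ n :: S.map Step.tgt, x.1 ≠ 0

theorem IsRun.exists_spans {i : ι} {m : ℕ} (h : E.IsRun i m) (hc : ∀ i, c i ≠ 0)
    (hd : E.letterDeg i = d) : ∃ n S, E.Spans c d (E.runWord i m) i m n S := by
  obtain ⟨n, S, x, h1, h2, h3⟩ := h.exists_realizes hc hd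
  refine ⟨n, S, ?_, ?_, ?_, ?_, ?_⟩
  · rw [← h3]
    exact h1
  · rw [← h3]
  · rw [h2]
    exact h.nodup_runNodes
  · rw [h2]
    exact h.mem_runNodes
  · rw [h2]
    exact fun x => coef_ne_zero_of_mem_runNodes hc

/-- The dual of the kernel rule contributes the word read along the virtual letter, not against
it. -/
theorem exists_spans_kernelDual {i : ι} {p q : List (Arrow V)}
    (h : σ.StartsInverse i p) (hq : G.IsKernelLeg p q) :
    ∃ n S, E.Spans c d ((⟨σ.vertex i, q.map Letter.fwd⟩ : Word V).dropFirst) (i - 1) 1 n S := by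
  obtain ⟨h1, h2, h3, hp, q', hq', hu⟩ := E.exists_of_startsInverse h
  obtain ⟨rfl, hne⟩ := (hu q).mp hq
  have hpath : G.IsPathFrom (σ.vertex i) q := by
    have := path_inverse hq' (by rwa [sub_add_cancel])
    rwa [sub_add_cancel] at this
  have hterm := terminal_inverse hq' h1 (by rwa [sub_add_cancel])
  obtain ⟨t, S, hS⟩ : ∃ t S, fwdSteps (1 : K) i q = t :: S := by
    rw [← List.ne_nil_iff_exists_cons, ← List.length_pos_iff, length_fwdSteps]
    exact List.length_pos_iff.mpr hne
  have hlet : q.map Letter.fwd = t.letter :: S.map Step.letter := by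
    rw [← fwdSteps_map_letter (1 : K) i q, hS]
    rfl
  have htgt : (t.tgt :: S.map Step.tgt).map Prod.snd =
      (fwdSteps (1 : K) i q).map fun s => s.tgt.2 := by
    rw [hS]
    simp
  obtain ⟨a, ha, hta, -⟩ := of_mem_head?_fwdSteps (η := (1 : K)) (j := i) (p := q) (s := t)
    (by rw [hS]; rfl)
  refine ⟨t.tgt, S, ?_, ?_, ?_, fun b => ?_, fun x hx => ?_⟩
  · rw [hlet]
    refine realizes_tail (by rw [← hS]; exact isStep_fwdSteps _ _ _)
      (by rw [← hS]; exact isChain_fwdSteps _ hpath) (fun a' ha' => ?_) fun s hs b hb => ?_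
    · rw [hta] at ha'
      cases ha'
    · rw [← hS] at hs
      obtain ⟨-, -, -, hst⟩ := of_mem_getLast?_fwdSteps hs
      rw [hst] at hb
      exact absurd (smul_eq_zero_of_isTerminal hterm hne) hb
  · rw [hlet]
    rfl
  · rw [htgt]
    exact nodup_targets_letterSteps (1 : K) i (.direct q)
  · rw [htgt, mem_targets_fwdSteps]
    constructor
    · rintro ⟨h4, h5, h6⟩
      refine ⟨0, one_pos, Or.inr ?_⟩
      rw [Nat.cast_zero, add_zero, sub_add_cancel]
      exact ⟨h4, h2, q, hq', h6, fun _ => h1, fun h7 => absurd h7 h5⟩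
    · rintro ⟨k, hk, h4⟩
      obtain rfl : k = 0 := by omega
      rw [Nat.cast_zero, add_zero] at h4
      rcases h4 with ⟨-, -, r, h5, -⟩ | ⟨h4, -, r, h5, h6, -, h7⟩
      · rw [hq'] at h5
        cases h5
      · rw [hq'] at h5
        cases h5
        rw [sub_add_cancel] at h4 h7
        refine ⟨h4, fun h8 => ?_, h6⟩
        obtain ⟨r, hr⟩ := h7 h8
        rw [hp] at hr
        cases hr
  · rw [← List.map_cons, ← hS] at hx
    obtain ⟨s, hs, rfl⟩ := List.mem_map.mp hx
    obtain ⟨k, rfl⟩ := List.mem_ofFn.mp hs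
    exact one_ne_zero

theorem exists_spans_summand (E : σ.Completion) (hc : ∀ i, c i ≠ 0) (s : σ.Summand)
    (hd : s.degree = d) : ∃ n S, E.Spans c d s.word s.runIndex s.runLength n S := by
  by_cases hs : ∀ i p q h hq, s ≠ .kernelDual i p q h hq
  · rw [word_summand (E := E) s hs]
    exact (E.isRun_summand s).exists_spans hc ((E.degree_summand s).symm.trans hd)
  · push Not at hs
    obtain ⟨i, p, q, h, hq, rfl⟩ := hs
    exact exists_spans_kernelDual h hq

/-- The cohomology is the sum of the string modules of words whose walks span classes carried by
disjoint sets of letters that exhaust all classes. -/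
theorem homology_equiv_directSum (E : σ.Completion) (hc : ∀ i, c i ≠ 0) {T : Type*}
    (w : T → Word V) (i : T → ι) (m : T → ℕ) (hw : ∀ s, G.IsString (w s))
    (hspan : ∀ s, ∃ n S, E.Spans c d (w s) (i s) (m s) n S)
    (hdeg : ∀ s, ∀ k < m s, E.letterDeg (i s + k) = d)
    (hinj : ∀ s s', ∀ k < m s, ∀ k' < m s', i s + (k : ι) = i s' + k' → s = s')
    (hsurj : ∀ l b, E.Owns l b → σ.deg b.1 = d → ∃ s, ∃ k < m s, i s + (k : ι) = l) :
    Nonempty ((σ.complex c).homology d ≃ₗ[GentleAlgebra K G]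
      ⨁ s, stringModule K (w s) (hw s)) := by
  classical
  choose n S hS using hspan
  have hlen : ∀ s, (w s).letters.length + 1 = (n s :: (S s).map Step.tgt).length := fun s => by
    rw [(hS s).letters]
    simp
  have hom : ∀ s, ∃ φ : stringModule K (w s) (hw s) →ₗ[GentleAlgebra K G] σ.Coker c d,
      ∀ k, φ (stringBasis (w s) (hw s) k) =
        σ.cls c d ((n s :: (S s).map Step.tgt).get (Fin.cast (hlen s) k)) := fun s =>
    (hS s).realizes.exists_hom (w s) (hw s) rfl (hS s).letters (hlen s)
  choose φ hφ using hom
  let node : (s : T) × Fin ((w s).letters.length + 1) → K × ι × List (Arrow V) := fun x =>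
    (n x.1 :: (S x.1).map Step.tgt).get (Fin.cast (hlen x.1) x.2)
  have hmem : ∀ x, ∃ k < m x.1, E.Owns (i x.1 + k) (node x).2 := fun x =>
    ((hS x.1).mem_iff _).mp (List.mem_map_of_mem (List.get_mem _ _))
  let Z : Module.Basis ((s : T) × Fin ((w s).letters.length + 1)) K
      (⨁ s, stringModule K (w s) (hw s)) :=
    DFinsupp.basis fun s => stringBasis (w s) (hw s)
  refine E.homology_equiv hc Z (DirectSum.toModule _ _ _ φ) (fun x => (node x).2)
    (fun x => (node x).1) (fun x => (hS x.1).ne_zero _ (List.get_mem _ _)) (fun x => ?_) ?_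
    (fun x => ?_) fun l b hb hd => ?_
  · have hZ : Z x = DirectSum.lof (GentleAlgebra K G) T (fun s => stringModule K (w s) (hw s)) x.1
        (stringBasis (w x.1) (hw x.1) x.2) := dfinsuppBasis_apply _ x
    rw [hZ, DirectSum.toModule_lof, hφ]
    rfl
  · intro x y hxy
    obtain ⟨k, hk, h1⟩ := hmem x
    obtain ⟨k', hk', h2⟩ := hmem y
    obtain ⟨s, x⟩ := x
    obtain ⟨s', y⟩ := y
    obtain rfl : s = s' := hinj s s' k hk k' hk' (h1.carries.index_unique (by
      simp only at hxy
      rw [hxy]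
      exact h2.carries))
    congr 1
    have := (hS s).nodup
    rw [List.nodup_iff_injective_get] at this
    have h3 := @this (Fin.cast (by simp [hlen]) x) (Fin.cast (by simp [hlen]) y) (by
      rw [List.get_eq_getElem, List.get_eq_getElem, List.getElem_map, List.getElem_map]
      exact hxy)
    simpa [Fin.ext_iff] using h3
  · obtain ⟨k, hk, h1⟩ := hmem x
    exact ⟨⟨_, h1⟩, by rw [← h1.letterDeg_eq, hdeg _ _ hk]⟩
  · obtain ⟨s, k, hk, rfl⟩ := hsurj l b hb hd
    obtain ⟨x, hx, rfl⟩ := List.mem_map.mp (((hS s).mem_iff b).mpr ⟨k, hk, hb⟩)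
    obtain ⟨j, rfl⟩ := List.mem_iff_get.mp hx
    exact ⟨⟨s, Fin.cast (hlen s).symm j⟩, rfl⟩

/-- The cohomology of a sequence in which every maximal alternating subsequence is bounded. -/
theorem homology_equiv_summands (E : σ.Completion) (hc : ∀ i, c i ≠ 0)
    (hn : ∀ j ∈ σ.pos, j - 1 ∈ σ.pos ∨ j + 1 ∈ σ.pos)
    (hleft : ∀ l, ∃ k : ℕ, ¬ E.Joint (l + k + 1)) (hright : ∀ l, ∃ k : ℕ, ¬ E.Joint (l - k)) :
    ∃ h : ∀ s : σ.Summand, G.IsString s.word, ∀ d : ℤ,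
      Nonempty ((σ.complex c).homology d ≃ₗ[GentleAlgebra K G]
        ⨁ s : {s : σ.Summand // s.degree = d}, stringModule K s.1.word (h s.1)) := by
  refine ⟨fun s => ?_, fun d => ?_⟩
  · obtain ⟨n, S, h⟩ := E.exists_spans_summand hc s rfl
    have := h.realizes.isString
    rwa [← h.letters] at this
  · refine E.homology_equiv_directSum hc (T := {s : σ.Summand // s.degree = d}) (fun s => s.1.word)
      (fun s => s.1.runIndex) (fun s => s.1.runLength) _ (fun s => E.exists_spans_summand hc s.1 s.2)
      (fun s k hk => ?_) (fun s s' k hk k' hk' he => ?_) fun l b hb hd => ?_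
    · rw [(E.isRun_summand s.1).letterDeg_add hk, ← E.degree_summand, s.2]
    · obtain ⟨h1, h2⟩ := (E.isRun_summand s.1).eq_of_index_eq (E.isRun_summand s'.1) hk hk' he
      exact Subtype.ext (E.summand_injective h1 h2)
    · obtain ⟨i, m, h, k, hk, rfl⟩ := hb.exists_isRun (hleft l) (hright l)
      obtain ⟨s, rfl, rfl⟩ := h.exists_summand hn
      refine ⟨⟨s, ?_⟩, k, hk, rfl⟩
      rw [E.degree_summand, ← h.letterDeg_add hk, hb.letterDeg_eq, hd]

end Completion

end HSequence

end Cohomology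

/-! ### Homotopy strings and bands that do not alternate -/

section Strings

variable {K : Type u} [Field K] [Fintype V] {G : GentleQuiver V}

namespace HSequence

variable {ι : Type} [CommRing ι] {σ : HSequence G ι} {c : ι → K} {d : ℤ}

theorem Completion.isZero_homology (E : σ.Completion) (hc : ∀ i, c i ≠ 0)
    (h : ∀ l b, E.Owns l b → σ.deg b.1 ≠ d) : Limits.IsZero ((σ.complex c).homology d) := by
  obtain ⟨e⟩ := E.homology_equiv_directSum (K := K) hc (d := d) (T := PEmpty.{1}) (fun s => s.elim)
    (fun s => s.elim) (fun s => s.elim) (fun s => s.elim) (fun s => s.elim) (fun s => s.elim)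
    (fun s => s.elim) fun l b hb hd => absurd hd (h l b hb)
  have := e.toEquiv.subsingleton
  exact ModuleCat.isZero_of_subsingleton _

end HSequence

namespace HomotopyString

variable (σ : HomotopyString G)

theorem mem_pos_of_mem_of_mem {i j k : ℤ} (hi : i ∈ σ.pos) (hk : k ∈ σ.pos) (h1 : i ≤ j)
    (h2 : j ≤ k) : j ∈ σ.pos := σ.interval.out hi hk ⟨h1, h2⟩

/-- A homotopy string has no infinite alternating part. -/
theorem exists_not_joint (E : σ.Completion) (l : ℤ) :
    (∃ k : ℕ, ¬ E.Joint (l + k + 1)) ∧ ∃ k : ℕ, ¬ E.Joint (l - k) := by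
  constructor
  · by_contra! h
    have hb : ¬ BddAbove σ.pos := by
      rintro ⟨B, hB⟩
      have h1 := hB (h (B - l).toNat).1
      omega
    obtain ⟨m, hm⟩ := σ.left_tail hb
    obtain ⟨-, ho⟩ := h (m - l).toNat
    obtain ⟨a, ha⟩ := hm (l + (m - l).toNat) (by omega)
    obtain ⟨b, hb⟩ := hm (l + (m - l).toNat + 1) (by omega)
    rw [add_sub_cancel_right, E.eq_of_letter _ _ ha, E.eq_of_letter _ _ hb] at ho
    exact ho
  · by_contra! h
    have hb : ¬ BddBelow σ.pos := by
      rintro ⟨B, hB⟩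
      have h1 := hB (h (l - B + 1).toNat).1
      omega
    obtain ⟨m, hm⟩ := σ.right_tail hb
    obtain ⟨-, ho⟩ := h (l - m).toNat
    obtain ⟨a, ha⟩ := hm (l - (l - m).toNat - 1) (by omega)
    obtain ⟨b, hb⟩ := hm (l - (l - m).toNat) (by omega)
    rw [E.eq_of_letter _ _ ha, E.eq_of_letter _ _ hb] at ho
    exact ho

theorem homology_equiv_summands (hσ : ∃ i, σ.letter i ≠ none) :
    ∃ h : ∀ s : σ.Summand, G.IsString s.word, ∀ d : ℤ,
      Nonempty ((σ.stringComplex K).homology d ≃ₗ[GentleAlgebra K G]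
        ⨁ s : {s : σ.Summand // s.degree = d}, stringModule K s.1.word (h s.1)) := by
  obtain ⟨E⟩ := σ.exists_completion
  obtain ⟨i, hi⟩ := hσ
  have hpos : i ∈ σ.pos ∧ i + 1 ∈ σ.pos := by
    rw [← σ.letter_isSome, Option.isSome_iff_ne_none]
    exact hi
  refine E.homology_equiv_summands (fun _ => one_ne_zero) (fun j hj => ?_)
    (fun l => (σ.exists_not_joint E l).1) fun l => (σ.exists_not_joint E l).2
  rcases le_or_gt j i with h | h
  · exact Or.inr (σ.mem_pos_of_mem_of_mem hj hpos.2 (by omega) (by omega))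
  · exact Or.inl (σ.mem_pos_of_mem_of_mem hpos.1 hj (by omega) (by omega))

/-- The completion of a trivial homotopy string consists of two virtual letters, given by the legs of
the projective, and these form the only maximal alternating sequence. -/
theorem homology_of_trivial {i : ℤ} (hi : σ.pos = {i}) :
    ∃ q q' : List (Arrow V), G.IsOtherLeg (σ.vertex i) q' q ∧ G.IsOtherLeg (σ.vertex i) q q' ∧
      ∃ h : G.IsString (((⟨σ.vertex i, []⟩ : Word V).extendLeft q').extendRight q),
        Nonempty ((σ.stringComplex K).homology (σ.deg i) ≃ₗ[GentleAlgebra K G]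
          stringModule K _ h) ∧
        ∀ d : ℤ, d ≠ σ.deg i → Limits.IsZero ((σ.stringComplex K).homology d) := by
  obtain ⟨E⟩ := σ.exists_completion
  have hmem : ∀ j, j ∈ σ.pos ↔ j = i := fun j => by rw [hi]; rfl
  have h1 : i - 1 ∉ σ.pos := by
    rw [hmem]
    omega
  have h2 : i ∈ σ.pos := (hmem i).mpr rfl
  have h3 : i + 1 ∉ σ.pos := by
    rw [hmem]
    omega
  obtain ⟨q, hq, pq, tq⟩ := E.right_end (i - 1) h1 (by rwa [sub_add_cancel])
  rw [sub_add_cancel] at pq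
  obtain ⟨q', hq', pq', tq'⟩ := E.left_end i h2 h3
  have hm := E.meet' h2
  rw [hq, hq'] at hm
  have hj : E.Joint i := ⟨h2, by rw [hq, hq']; trivial⟩
  have hrun : E.IsRun (i - 1) 2 := by
    refine HSequence.Completion.isRun_of_joints (by omega) (Or.inr (by rwa [sub_add_cancel]))
      (fun k hk => ?_)
      (HSequence.Completion.not_joint_of_not_mem h1) (HSequence.Completion.not_joint_of_not_mem ?_)
      (by omega)
    · obtain rfl : k = 0 := by omega
      simpa using hj
    · rwa [Nat.cast_ofNat, show i - 1 + 2 = i + 1 by ring]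
  have hword : E.runWord (i - 1) 2 =
      (((⟨σ.vertex i, []⟩ : Word V).extendLeft q').extendRight q) := by
    rw [HSequence.Completion.runWord_of_not_mem h1 (by
      rwa [Nat.cast_ofNat, show i - 1 + 2 = i + 1 by ring]),
      HSequence.Completion.runLetters_succ', HSequence.Completion.runLetters_one,
      HSequence.Completion.startVertex, hq, sub_add_cancel, hq']
    rfl
  have hdeg : E.letterDeg (i - 1) = σ.deg i := by
    rw [HSequence.Completion.letterDeg_inverse hq, sub_add_cancel]
  have hspan := hrun.exists_spans (K := K) (c := fun _ => 1) (fun _ => one_ne_zero) hdeg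
  rw [hword] at hspan
  have hstr : G.IsString (((⟨σ.vertex i, []⟩ : Word V).extendLeft q').extendRight q) := by
    obtain ⟨n, S, h⟩ := hspan
    have := h.realizes.isString
    rwa [← h.letters] at this
  refine ⟨q, q', GentleQuiver.isOtherLeg_of_isValley pq tq hm,
    GentleQuiver.isOtherLeg_of_isValley pq' tq' (IsValley.symm hm), hstr, ?_, fun d hd => ?_⟩
  · have hsurj : ∀ l b, E.Owns l b → ∃ k : ℕ, k < 2 ∧ i - 1 + (k : ℤ) = l := by
      intro l b hb
      rcases hb with ⟨-, h4, -⟩ | ⟨-, h4, -⟩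
      · exact ⟨1, by omega, by rw [(hmem l).mp h4]; norm_num⟩
      · refine ⟨0, by omega, ?_⟩
        have := (hmem _).mp h4
        omega
    obtain ⟨e⟩ := E.homology_equiv_directSum (K := K) (c := fun _ => 1) (fun _ => one_ne_zero)
      (T := PUnit.{1}) (fun _ => _) (fun _ => i - 1) (fun _ => 2) (fun _ => hstr) (fun _ => hspan)
      (fun _ k hk => (hrun.letterDeg_add hk).trans hdeg) (fun _ _ _ _ _ _ _ => rfl)
      fun l b hb _ => ⟨PUnit.unit, hsurj l b hb⟩
    exact ⟨e.trans (DirectSum.lid _ _ _)⟩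
  · refine E.isZero_homology (fun _ => one_ne_zero) fun l b hb hb' => hd ?_
    rw [← hb', (hmem _).mp hb.mem_pos]

end HomotopyString

namespace HomotopyBand

variable {n : ℕ} [NeZero n] (σ : HomotopyBand G n)

open Classical in
theorem scalar_ne_zero {r : ZMod n} {t : K} (ht : t ≠ 0) (i : ZMod n) :
    (if i = r then t else 1) ≠ 0 := by
  split_ifs
  exacts [ht, one_ne_zero]

theorem mem_pos (i : ZMod n) : i ∈ σ.pos := by
  rw [σ.pos_eq]
  trivial

theorem homology_equiv_summands {r : ZMod n} {t : K} (ht : t ≠ 0) (hσ : ¬ σ.IsAlternating) :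
    ∃ h : ∀ s : σ.Summand, G.IsString s.word, ∀ d : ℤ,
      Nonempty ((σ.bandComplex r t).homology d ≃ₗ[GentleAlgebra K G]
        ⨁ s : {s : σ.Summand // s.degree = d}, stringModule K s.1.word (h s.1)) := by
  obtain ⟨E⟩ := σ.exists_completion
  rw [HSequence.IsAlternating] at hσ
  push Not at hσ
  obtain ⟨i, hi⟩ := hσ
  have hj : ¬ E.Joint (i + 1) := by
    intro hj
    rcases hj.cases (Or.inl (σ.mem_pos _)) with ⟨-, -, h⟩ | ⟨h, -⟩ | ⟨h, -⟩
    · rw [add_sub_cancel_right] at h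
      exact hi h
    · exact h (σ.mem_pos _)
    · exact h (σ.mem_pos _)
  refine E.homology_equiv_summands (scalar_ne_zero ht) (fun j _ => Or.inl (σ.mem_pos _))
    (fun l => ⟨(i - l).val, ?_⟩) fun l => ⟨(l - (i + 1)).val, ?_⟩
  · rwa [ZMod.natCast_zmod_val, add_sub_cancel]
  · rwa [ZMod.natCast_zmod_val, sub_sub_cancel]

end HomotopyBand

end Strings

/-! ### Alternating homotopy bands -/

section Bands

variable {K : Type u} [Field K] [Fintype V] {G : GentleQuiver V} {ι : Type} [CommRing ι]

theorem val_finRotate_cases {n : ℕ} (k : Fin n) :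
    (finRotate n k).val = k.val + 1 ∨ (finRotate n k).val = 0 ∧ k.val + 1 = n := by
  cases n with
  | zero => exact k.elim0
  | succ n =>
    rcases Nat.lt_or_ge k.val n with h | h
    · left
      rw [finRotate_apply, Fin.val_add_one_of_lt (Fin.lt_def.mpr (by simpa using h))]
    · right
      obtain rfl : k = Fin.last n := Fin.ext (by have := k.isLt; simp; omega)
      simp

namespace HSequence

variable {σ : HSequence G ι} {c : ι → K} {d : ℤ}

variable (σ c d) in
/-- The targets of the steps `S`, in cyclic order, satisfy the relations between the basis vectors
of the band module given by the letters of `S` and the parameter `μ`. -/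
structure RealizesBand (μ : K) (S : List (Step K ι V)) : Prop where
  step : ∀ s ∈ S, σ.IsStep c d s
  first : ∀ s ∈ S.head?, ∃ a, s.letter = .fwd a
  next : ∀ (k k' : ℕ) (hk : k < S.length) (hk' : k' < S.length),
    (k' = k + 1 ∨ k' = 0 ∧ k + 1 = S.length) → ∃ t, σ.Follows c d S[k] t ∧
      t.letter = S[k'].letter ∧
      σ.cls c d t.src = (if k' = 0 then μ else 1) • σ.cls c d S[k'].src

/-- The steps define a homomorphism from the band module. Letter number `k` joins the basis vectors `k`
and `k + 1`, so the basis vector `k + 1` goes to the target of step `k`. -/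
theorem RealizesBand.exists_hom {μ : K} {S : List (Step K ι V)} (h : σ.RealizesBand c d μ S)
    (hw : G.IsBand (S.map Step.letter)) :
    ∃ φ : bandModule (S.map Step.letter) hw μ →ₗ[GentleAlgebra K G] σ.Coker c d,
      ∀ k, φ ((bandSchema (S.map Step.letter) hw μ).basis (finRotate _ k)) =
        σ.cls c d (S.get (Fin.cast (by simp) k)).tgt := by
  let rot := finRotate (S.map Step.letter).length
  let st : Fin (S.map Step.letter).length → Step K ι V := fun k => S.get (Fin.cast (by simp) k)
  have hmem : ∀ k, st k ∈ S := fun k => List.get_mem _ _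
  have hlet : ∀ k, (S.map Step.letter).get k = (st k).letter := fun k => by simp [st]
  have hnext : ∀ k, ∃ t, σ.Follows c d (st k) t ∧ t.letter = (st (rot k)).letter ∧
      σ.cls c d t.src = (if (rot k).val = 0 then μ else 1) • σ.cls c d (st (rot k)).src := by
    intro k
    have h1 : (S.map Step.letter).length = S.length := by simp
    exact h.next k.val (rot k).val (by omega) (by have := (rot k).isLt; omega)
      ((val_finRotate_cases k).imp_right fun h2 => ⟨h2.1, h2.2.trans h1⟩)
  let x : Fin (S.map Step.letter).length → σ.Coker c d := fun j => σ.cls c d (st (rot.symm j)).tgt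
  have hx : ∀ k, x (rot k) = σ.cls c d (st k).tgt := fun k => by simp [x]
  have hxsrc : ∀ k, x k = (if k.val = 0 then μ else 1) • σ.cls c d (st k).src := by
    intro k
    obtain ⟨t, h1, -, h2⟩ := hnext (rot.symm k)
    rw [rot.apply_symm_apply] at h2
    rw [← h2]
    exact h1.eq
  have hfirst : ∀ k a, (st k).letter = .bwd a → k.val ≠ 0 := by
    intro k a ha hk
    obtain ⟨b, hb⟩ := h.first (st k) (by
      rw [List.head?_eq_getElem?]
      simp only [st, List.get_eq_getElem, Fin.val_cast, hk]
      exact List.getElem?_eq_getElem _)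
    rw [ha] at hb
    cases hb
  obtain ⟨φ, hφ⟩ : ∃ φ : bandModule (S.map Step.letter) hw μ →ₗ[GentleAlgebra K G] σ.Coker c d,
      ∀ j, φ ((bandSchema (S.map Step.letter) hw μ).basis j) = x j := by
    refine Schema.exists_hom _ _ (fun j => ?_) (fun k => ?_) (fun a i ha => ?_)
      (fun k k' h1 h2 => ?_)
    · obtain ⟨t, h1, h2, -⟩ := hnext (rot.symm j)
      rw [rot.apply_symm_apply] at h2
      have h3 := (h.step _ (hmem (rot.symm j))).target
      rw [h1.comp.1, h2, ← hlet] at h3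
      exact h3
    · have hs := h.step _ (hmem k)
      cases hk : (st k).letter with
      | fwd a =>
        simp only [bandSchema, hlet, hk, Letter.arrow]
        rw [hxsrc, smul_comm, hs.fwd a hk]
        congr 1
        exact (hx k).symm
      | bwd a =>
        simp only [bandSchema, hlet, hk, Letter.arrow, if_neg (hfirst k a hk), one_smul]
        rw [hxsrc k, if_neg (hfirst k a hk), one_smul, ← hs.bwd a hk]
        congr 1
        exact hx k
    · obtain ⟨t, h1, h2, -⟩ := hnext (rot.symm i)
      rw [rot.apply_symm_apply] at h2
      rcases h1.zero a ha with h3 | h3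
      · refine ⟨rot.symm i, ?_⟩
        simp only [bandSchema, hlet, h3, Letter.arrow, true_and]
        exact rot.apply_symm_apply i
      · refine ⟨i, ?_⟩
        rw [h2] at h3
        simp only [bandSchema, hlet, h3, Letter.arrow, true_and]
    · simp only [bandSchema] at h1 h2
      have hc := hw.cyclic
      cases hk : (S.map Step.letter).get k with
      | fwd a =>
        cases hk' : (S.map Step.letter).get k' with
        | fwd b =>
          rw [hk, hk'] at h2
          exact h2
        | bwd b =>
          rw [hk, hk'] at h2 h1
          have h3 := hc k'
          simp only at h2
          rw [← h2, hk, hk'] at h3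
          exact absurd h1.symm h3.2
      | bwd a =>
        cases hk' : (S.map Step.letter).get k' with
        | fwd b =>
          rw [hk, hk'] at h2 h1
          have h3 := hc k
          simp only at h2
          rw [h2, hk, hk'] at h3
          exact absurd h1 h3.2
        | bwd b =>
          rw [hk, hk'] at h2
          exact (finRotate _).injective h2
  exact ⟨φ, fun k => (hφ _).trans (hx k)⟩

theorem cls_mul (η η' : K) (b : ι × List (Arrow V)) :
    σ.cls c d (η * η', b) = η • σ.cls c d (η', b) := by
  rw [cls, cls, mul_smul]
  rfl

namespace Completion

variable {E : σ.Completion}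

/-- The walk along an alternating sequence of letters that closes up. Returning to the start multiplies
the class by the scalar of the last letter, which becomes the parameter of the band module. -/
theorem IsAlternatingRun.realizesBand {r : ι} {N : ℕ} {p q : List (Arrow V)}
    (h : E.IsAlternatingRun r (N + 1)) (hc : ∀ i, c i ≠ 0) (hr : r ∈ σ.pos) (hN : r + N ∈ σ.pos)
    (hcyc : r + N + 1 = r) (hp : E.L r = .direct p) (hq : E.L (r + N) = .inverse q)
    (hd : σ.deg r = d) :
    σ.RealizesBand c d (E.runCoef c r N) (E.runSteps c r (N + 1)) := by
  have hd' : E.letterDeg r = d := (letterDeg_direct hp).trans hd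
  have hchain := List.isChain_iff_getElem.mp (h.isChain hc hd')
  have hlq := letter_of_inverse hq hN
  have hq0 := (σ.inverse_path _ _ hlq).ne_nil
  have hlp : σ.letter r = some (.direct p) := by
    have h1 : r + 1 ∈ σ.pos := by
      cases N with
      | zero =>
        rw [Nat.cast_zero, add_zero] at hcyc
        rwa [hcyc]
      | succ N => simpa using (h.inner 0 (by omega)).1
    exact letter_of_direct hp h1
  have hp0 := (σ.direct_path _ _ hlp).ne_nil
  have hsteps := runSteps_succ (E := E) c r N
  rw [hq, letterSteps] at hsteps
  have hfwd : ∀ η : K, fwdSteps η r p ≠ [] := fun η => by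
    rw [← List.length_pos_iff, length_fwdSteps]
    exact List.length_pos_iff.mpr hp0
  have hhead : ∀ s ∈ (E.runSteps c r (N + 1)).head?, s ∈ (fwdSteps (1 : K) r p).head? := by
    intro s hs
    obtain ⟨S, hS⟩ := E.runSteps_prefix c r h.one_le
    have h1 : E.runSteps c r 1 = fwdSteps 1 r p := by
      simp [runSteps, hp, letterSteps, runCoef]
    rw [h1] at hS
    rwa [← hS, List.head?_append_of_ne_nil _ (hfwd 1)] at hs
  refine ⟨h.isStep c d, fun s hs => ?_, fun k k' hk hk' hkk' => ?_⟩
  · obtain ⟨a, -, hlet, -⟩ := of_mem_head?_fwdSteps (hhead s hs)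
    exact ⟨a, hlet⟩
  · rcases hkk' with rfl | ⟨rfl, hk1⟩
    · exact ⟨_, hchain k hk', rfl, by rw [if_neg (Nat.succ_ne_zero k), one_smul]⟩
    · obtain ⟨t, ht⟩ := Option.ne_none_iff_exists'.mp
        (mt List.head?_eq_none_iff.mp (hfwd (E.runCoef c r N)))
      obtain ⟨a, ha, htl, hts⟩ := of_mem_head?_fwdSteps ht
      obtain ⟨b, hb, hsl, hss⟩ := of_mem_head?_fwdSteps (hhead
        ((E.runSteps c r (N + 1))[0]) (by
          rw [List.head?_eq_getElem?, List.getElem?_eq_getElem hk']; rfl))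
      -- `t` is the first step again, with the scalar of the last letter
      refine ⟨t, ?_, ?_, ?_⟩
      · refine follows_of_opposite (i := r + N) (η := E.runCoef c r N) (η' := E.runCoef c r N) hc
          (by rwa [hcyc]) ((h.letterDeg_add (Nat.lt_succ_self N)).trans hd')
          (by rw [hcyc, hp, hq]; trivial) (by rw [hq]) ?_ (by rw [hcyc, hp]; exact ht)
        have hlast : (E.runSteps c r (N + 1))[k] ∈ (E.runSteps c r (N + 1)).getLast? := by
          rw [List.getLast?_eq_getElem?, ← hk1, Nat.add_sub_cancel, List.getElem?_eq_getElem hk]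
          rfl
        have hne : bwdSteps (E.runCoef c r N) (r + N + 1) q ≠ [] := by
          rw [← List.length_pos_iff, length_bwdSteps]
          exact List.length_pos_iff.mpr hq0
        rw [hq, letterSteps]
        have h2 : (E.runSteps c r (N + 1)).getLast? =
            (bwdSteps (E.runCoef c r N) (r + N + 1) q).getLast? := by
          rw [hsteps, List.getLast?_append_of_ne_nil _ hne]
        rwa [← h2]
      · rw [htl, hsl, ← ha.symm.trans hb |> Option.some.inj]
      · rw [if_pos rfl, hts, hss, ← cls_mul, mul_one]

end Completion

end HSequence

end Bands

/-! ### The walk of an alternating homotopy band -/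

section BandWords

/-- If a concatenation of blocks is a proper power, and the blocks are determined by a relation
between neighbouring entries, also cyclically, then the list of blocks agrees with a nontrivial
rotation of itself. -/
theorem exists_rotate_eq_of_flatten_eq {α : Type*} {r : α → α → Bool} {B : List (List α)}
    (hne : [] ∉ B) (hB : B ≠ []) (hchain : ∀ m ∈ B, m.IsChain fun x y => r x y)
    (hsep : B.IsChain fun a b => ∃ ha hb, r (a.getLast ha) (b.head hb) = false)
    (hcyc : ∀ x ∈ B.flatten.getLast?, ∀ y ∈ B.flatten.head?, r x y = false) {v : List α} {m : ℕ}
    (hm : 2 ≤ m) (hv : B.flatten = (List.replicate m v).flatten) :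
    ∃ b, 0 < b ∧ b < B.length ∧ B.rotate b = B := by
  obtain ⟨m, rfl⟩ : ∃ k, m = k + 2 := ⟨m - 2, by omega⟩
  have hflat : B.flatten ≠ [] := by
    obtain ⟨x, B, rfl⟩ := List.exists_cons_of_ne_nil hB
    intro h
    rw [List.flatten_eq_nil_iff] at h
    exact hne (by simp [h x])
  have hv0 : v ≠ [] := by
    rintro rfl
    exact hflat (by rw [hv]; simp)
  set w := (List.replicate (m + 1) v).flatten with hw
  have hw0 : w ≠ [] := by
    rw [hw, List.replicate_succ, List.flatten_cons]
    exact fun h => hv0 (List.append_eq_nil_iff.mp h).1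
  have h1 : B.flatten = v ++ w := by rw [hv, List.replicate_succ, List.flatten_cons]
  have h2 : B.flatten = w ++ v := by
    rw [hv, List.replicate_succ', List.flatten_append]
    simp [hw]
  have hsplit : B.flatten.splitBy r = B := List.splitBy_flatten hne hchain hsep
  -- no block runs across the border between two copies of `v`
  have h3 : B = v.splitBy r ++ w.splitBy r := by
    rw [← List.splitBy_append, ← h1, hsplit]
    intro x hx y hy
    refine hcyc x ?_ y ?_
    · rwa [h2, List.getLast?_append_of_ne_nil _ hv0]
    · rwa [h2, List.head?_append_of_ne_nil _ hw0]
  have h4 : B = w.splitBy r ++ v.splitBy r := by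
    rw [← List.splitBy_append, ← h2, hsplit]
    intro x hx y hy
    refine hcyc x ?_ y ?_
    · rwa [h1, List.getLast?_append_of_ne_nil _ hw0]
    · rwa [h1, List.head?_append_of_ne_nil _ hv0]
  have hlen : ∀ u : List α, u ≠ [] → 0 < (u.splitBy r).length := fun u hu => by
    rw [List.length_pos_iff, ne_eq, List.splitBy_eq_nil]
    exact hu
  refine ⟨(v.splitBy r).length, hlen v hv0, ?_, ?_⟩
  · have := congrArg List.length h3
    rw [List.length_append] at this
    have := hlen w hw0
    omega
  · conv_lhs => rw [h3]
    rw [List.rotate_append_length_eq, ← h4]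

/-- Whether a letter is an arrow, as opposed to the formal inverse of an arrow. -/
def Letter.isFwd : Letter V → Bool
  | .fwd _ => true
  | .bwd _ => false

theorem isFwd_of_mem_walk_direct {p : List (Arrow V)} {l : Letter V}
    (h : l ∈ (HLetter.direct p).walk) : l.isFwd = true := by
  obtain ⟨a, -, rfl⟩ := List.mem_map.mp h
  rfl

theorem isFwd_of_mem_walk_inverse {p : List (Arrow V)} {l : Letter V}
    (h : l ∈ (HLetter.inverse p).walk) : l.isFwd = false := by
  obtain ⟨a, -, rfl⟩ := List.mem_map.mp (List.mem_reverse.mp h)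
  rfl

theorem isChain_walk (L : HLetter V) :
    L.walk.IsChain fun x y => (x.isFwd == y.isFwd) = true := by
  refine List.Pairwise.isChain (List.pairwise_of_forall_mem_list fun x hx y hy => ?_)
  cases L with
  | direct p => rw [isFwd_of_mem_walk_direct hx, isFwd_of_mem_walk_direct hy]; rfl
  | inverse p => rw [isFwd_of_mem_walk_inverse hx, isFwd_of_mem_walk_inverse hy]; rfl

theorem isFwd_ne_of_opposite {L M : HLetter V} (h : HSequence.Opposite L M) {x y : Letter V}
    (hx : x ∈ L.walk) (hy : y ∈ M.walk) : (x.isFwd == y.isFwd) = false := by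
  rcases L with p | p <;> rcases M with q | q
  · exact h.elim
  · rw [isFwd_of_mem_walk_direct hx, isFwd_of_mem_walk_inverse hy]; rfl
  · rw [isFwd_of_mem_walk_inverse hx, isFwd_of_mem_walk_direct hy]; rfl
  · exact h.elim

theorem walk_injective {L M : HLetter V} (hL : L.walk ≠ []) (h : L.walk = M.walk) : L = M := by
  obtain ⟨x, hx⟩ := List.exists_mem_of_ne_nil _ hL
  have hx' := hx
  rw [h] at hx'
  rcases L with p | p <;> rcases M with q | q
  · rw [List.map_injective_iff.mpr (fun a b h => by cases h; rfl) h]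
  · exact absurd ((isFwd_of_mem_walk_direct hx).symm.trans (isFwd_of_mem_walk_inverse hx'))
      (by decide)
  · exact absurd ((isFwd_of_mem_walk_inverse hx).symm.trans (isFwd_of_mem_walk_direct hx'))
      (by decide)
  · rw [List.map_injective_iff.mpr (fun a b h => by cases h; rfl) (List.reverse_injective h)]

namespace HomotopyBand

variable [Fintype V] {G : GentleQuiver V} {n : ℕ} [NeZero n] {σ : HomotopyBand G n}

theorem letter_eq (E : σ.toHSequence.Completion) (i : ZMod n) : σ.letter i = some (E.L i) :=
  HSequence.Completion.letter_eq_L (σ.mem_pos _) (σ.mem_pos _)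

theorem walk_ne_nil (E : σ.toHSequence.Completion) (i : ZMod n) : (E.L i).walk ≠ [] := by
  have h := letter_eq E i
  rcases hL : E.L i with p | p <;> rw [hL] at h
  · simpa [HLetter.walk] using (σ.direct_path _ _ h).ne_nil
  · simpa [HLetter.walk] using (σ.inverse_path _ _ h).ne_nil

theorem opposite_of_isAlternating (E : σ.toHSequence.Completion) (hσ : σ.IsAlternating)
    (i : ZMod n) : HSequence.Opposite (E.L i) (E.L (i + 1)) := by
  rcases hσ i with ⟨p, q, h1, h2⟩ | ⟨p, q, h1, h2⟩ <;>
    rw [E.eq_of_letter _ _ h1, E.eq_of_letter _ _ h2] <;> trivial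

/-- In an alternating homotopy band every other homotopy letter is direct. -/
theorem direct_and_inverse_of_isAlternating {r : ZMod n} {p : List (Arrow V)}
    (hp : σ.letter r = some (.direct p)) (hσ : σ.IsAlternating) (j : ℕ) :
    (∃ p', σ.letter (r + (2 * j : ℕ)) = some (.direct p')) ∧
      ∃ q, σ.letter (r + (2 * j + 1 : ℕ)) = some (.inverse q) := by
  have next : ∀ (i : ZMod n) p', σ.letter i = some (.direct p') →
      ∃ q, σ.letter (i + 1) = some (.inverse q) := by
    intro i p' h
    rcases hσ i with ⟨-, q, -, h2⟩ | ⟨p, -, h1, -⟩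
    · exact ⟨q, h2⟩
    · rw [h] at h1
      cases h1
  have next' : ∀ (i : ZMod n) q, σ.letter i = some (.inverse q) →
      ∃ p', σ.letter (i + 1) = some (.direct p') := by
    intro i q h
    rcases hσ i with ⟨p, -, h1, -⟩ | ⟨-, q, -, h2⟩
    · rw [h] at h1
      cases h1
    · exact ⟨q, h2⟩
  induction j with
  | zero =>
    refine ⟨⟨p, by simpa using hp⟩, ?_⟩
    simpa using next r p hp
  | succ j ih =>
    obtain ⟨-, q, hq⟩ := ih
    obtain ⟨p', hp'⟩ := next' _ _ hq
    obtain ⟨q', hq'⟩ := next _ _ hp'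
    refine ⟨⟨p', ?_⟩, ⟨q', ?_⟩⟩
    · rw [← hp']
      congr 1
      push_cast
      ring
    · rw [← hq']
      congr 1
      push_cast
      ring

theorem even_of_isAlternating {r : ZMod n} {p : List (Arrow V)}
    (hp : σ.letter r = some (.direct p)) (hσ : σ.IsAlternating) : ∃ m, n = 2 * m + 2 := by
  rcases Nat.even_or_odd' n with ⟨m, hm | hm⟩
  · exact ⟨m - 1, by have := NeZero.ne n; omega⟩
  · obtain ⟨-, q, hq⟩ := direct_and_inverse_of_isAlternating hp hσ m
    rw [← hm, ZMod.natCast_self, add_zero, hp] at hq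
    cases hq

theorem add_natCast_ne (r : ZMod n) {k k' : ℕ} (h : k < k') (h' : k' < n) :
    r + (k : ZMod n) ≠ r + k' := by
  intro e
  have := congrArg ZMod.val (add_left_cancel e)
  rw [ZMod.val_natCast_of_lt (by omega), ZMod.val_natCast_of_lt h'] at this
  omega

theorem exists_add_natCast_eq (r i : ZMod n) : ∃ k < n, r + (k : ZMod n) = i :=
  ⟨(i - r).val, ZMod.val_lt _, by rw [ZMod.natCast_zmod_val, add_sub_cancel]⟩

/-- The walk of an alternating homotopy band is not a proper power: its homotopy letters are its
maximal pieces in one direction, so a period of the walk is a period of the homotopy band. -/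
theorem not_proper_power (E : σ.toHSequence.Completion) (hσ : σ.IsAlternating) (r : ZMod n)
    (v : List (Letter V)) (m : ℕ) (hm : 2 ≤ m) :
    E.runLetters r n ≠ (List.replicate m v).flatten := by
  intro hv
  have hn := NeZero.ne n
  have hopp := opposite_of_isAlternating E hσ
  have hne := walk_ne_nil E
  let B : List (List (Letter V)) := (List.range n).map fun k : ℕ => (E.L (r + k)).walk
  have hB : E.runLetters r n = B.flatten := by
    rw [HSequence.Completion.runLetters, List.flatMap_def]
  obtain ⟨N, hN⟩ : ∃ N, n = N + 1 := ⟨n - 1, by omega⟩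
  have hB' : E.runLetters r (N + 1) = B.flatten := (congrArg (E.runLetters r) hN.symm).trans hB
  have hfirst : B.flatten.head? = (E.L r).walk.head? := by
    rw [← hB', HSequence.Completion.runLetters_succ', List.head?_append_of_ne_nil _ (hne _)]
  have hlast : B.flatten.getLast? = (E.L (r + N)).walk.getLast? := by
    rw [← hB', HSequence.Completion.runLetters_succ, List.getLast?_append_of_ne_nil _ (hne _)]
  have hnil : [] ∉ B := fun h => by
    obtain ⟨k, -, hk⟩ := List.mem_map.mp h
    exact hne _ hk
  have hB0 : B ≠ [] := by
    simpa only [B, ne_eq, List.map_eq_nil_iff, List.range_eq_nil] using hn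
  have hchain : ∀ w ∈ B, w.IsChain fun x y => (x.isFwd == y.isFwd) = true := fun w hw => by
    obtain ⟨k, -, rfl⟩ := List.mem_map.mp hw
    exact isChain_walk _
  have hsep : B.IsChain fun a b =>
      ∃ ha hb, ((a.getLast ha).isFwd == (b.head hb).isFwd) = false := by
    rw [List.isChain_iff_getElem]
    intro k hk
    simp only [B, List.getElem_map, List.getElem_range]
    have h1 := hopp (r + k)
    rw [add_assoc, ← Nat.cast_add_one] at h1
    exact ⟨hne _, hne _, isFwd_ne_of_opposite h1 (List.getLast_mem _) (List.head_mem _)⟩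
  have hcyc : ∀ x ∈ B.flatten.getLast?, ∀ y ∈ B.flatten.head?, (x.isFwd == y.isFwd) = false := by
    intro x hx y hy
    rw [hlast] at hx
    rw [hfirst] at hy
    refine isFwd_ne_of_opposite (L := E.L (r + N)) (M := E.L r) ?_ (List.mem_of_getLast? hx)
      (List.mem_of_head? hy)
    have h1 := hopp (r + N)
    rwa [add_assoc, ← Nat.cast_add_one, ← hN, ZMod.natCast_self, add_zero] at h1
  -- a rotation of the blocks by `b` is a rotation of the homotopy band by `b`
  obtain ⟨b, hb, hbn, hrot⟩ := exists_rotate_eq_of_flatten_eq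
    (r := fun x y : Letter V => x.isFwd == y.isFwd) hnil hB0 hchain hsep hcyc hm (hB ▸ hv)
  simp only [B, List.length_map, List.length_range] at hbn
  obtain ⟨i, hi⟩ := σ.primitive b (by simpa using (add_natCast_ne 0 hb hbn).symm)
  refine hi ?_
  obtain ⟨k, hk, rfl⟩ := exists_add_natCast_eq r i
  have h1 : (B.rotate b)[k]'(by simpa [B]) = B[k]'(by simpa [B]) := by simp only [hrot]
  rw [List.getElem_rotate] at h1
  simp only [B, List.length_map, List.length_range, List.getElem_map, List.getElem_range,
    ZMod.natCast_mod, Nat.cast_add] at h1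
  rw [letter_eq E, letter_eq E, ← walk_injective (hne _) h1, add_assoc]

end HomotopyBand

end BandWords

/-! ### The cohomology of an alternating homotopy band -/

section BandCohomology

variable {K : Type u} [Field K] [Fintype V] {G : GentleQuiver V}

instance (w : List (Letter V)) (hw : G.IsBand w) (μ : K) : Module K (bandModule w hw μ) :=
  inferInstanceAs (Module K (bandSchema w hw μ).module)

instance (w : List (Letter V)) (hw : G.IsBand w) (μ : K) :
    IsScalarTower K (GentleAlgebra K G) (bandModule w hw μ) :=
  inferInstanceAs (IsScalarTower K (GentleAlgebra K G) (bandSchema w hw μ).module)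

/-- The basis of a band module given by the vertices of its word. -/
def bandBasis (w : List (Letter V)) (hw : G.IsBand w) (μ : K) :
    Module.Basis (Fin w.length) K (bandModule w hw μ) :=
  (bandSchema w hw μ).basis

namespace HSequence

variable {ι : Type} [CommRing ι] {σ : HSequence G ι} {c : ι → K} {d : ℤ}

theorem RealizesBand.composable {μ : K} {S : List (Step K ι V)} (h : σ.RealizesBand c d μ S)
    (k : Fin (S.map Step.letter).length) : G.Composable ((S.map Step.letter).get k)
      ((S.map Step.letter).get (finRotate _ k)) := by
  have h1 : (S.map Step.letter).length = S.length := List.length_map _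
  obtain ⟨t, ht, hl, -⟩ := h.next k.val (finRotate _ k).val (by omega)
    (by have := (finRotate _ k).isLt; omega)
    ((val_finRotate_cases k).imp_right fun h2 => ⟨h2.1, h2.2.trans h1⟩)
  have h3 := ht.comp
  rw [hl] at h3
  simpa using h3

namespace Completion

/-- The cohomology is a band module if the walk of the band passes once through each path that
represents a cohomology class. -/
theorem homology_equiv_bandModule (E : σ.Completion) (hc : ∀ i, c i ≠ 0) {μ : K}
    {S : List (Step K ι V)} (h : σ.RealizesBand c d μ S) (hw : G.IsBand (S.map Step.letter))
    (hnodup : (S.map fun s => s.tgt.2).Nodup)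
    (hmem : ∀ b, b ∈ S.map (fun s => s.tgt.2) ↔ ∃ l, E.Owns l b)
    (hdeg : ∀ l b, E.Owns l b → σ.deg b.1 = d) (hne : ∀ s ∈ S, s.tgt.1 ≠ 0) :
    Nonempty ((σ.complex c).homology d ≃ₗ[GentleAlgebra K G]
      bandModule (S.map Step.letter) hw μ) := by
  obtain ⟨φ, hφ⟩ := h.exists_hom hw
  have hlen : (S.map Step.letter).length = S.length := List.length_map _
  let st : Fin (S.map Step.letter).length → Step K ι V := fun k => S.get (Fin.cast hlen k)
  have hst : ∀ k, st k ∈ S := fun k => List.get_mem _ _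
  refine E.homology_equiv hc ((bandBasis _ hw μ).reindex (finRotate _).symm) φ
    (fun k => (st k).tgt.2) (fun k => (st k).tgt.1) (fun k => hne _ (hst k)) (fun k => ?_)
    (fun k k' hk => ?_) (fun k => ?_) fun l b hb _ => ?_
  · rw [Module.Basis.reindex_apply, Equiv.symm_symm]
    exact hφ k
  · rw [List.nodup_iff_injective_get] at hnodup
    have h3 := @hnodup (Fin.cast (by simp) k) (Fin.cast (by simp) k') (by simpa [st] using hk)
    simpa [Fin.ext_iff] using h3
  · obtain ⟨l, hl⟩ := (hmem _).mp (List.mem_map_of_mem (hst k))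
    exact ⟨⟨l, hl⟩, hdeg l _ hl⟩
  · obtain ⟨s, hs, rfl⟩ := List.mem_map.mp ((hmem b).mpr ⟨l, hb⟩)
    obtain ⟨k, rfl⟩ := List.mem_iff_get.mp hs
    exact ⟨Fin.cast hlen.symm k, rfl⟩

end Completion

end HSequence

namespace HomotopyBand

open HSequence.Completion

variable {n : ℕ} [NeZero n] {σ : HomotopyBand G n} {r : ZMod n} {p : List (Arrow V)}

theorem isAlternatingRun (E : σ.toHSequence.Completion) (hσ : σ.IsAlternating) (r : ZMod n) :
    E.IsAlternatingRun r n where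
  one_le := NeZero.one_le
  touches := Or.inl (σ.mem_pos _)
  inner _ _ := ⟨σ.mem_pos _, opposite_of_isAlternating E hσ _⟩

/-- The scalars along the walk of an alternating homotopy band. The sign changes at each place between
a direct letter and an inverse one, and the parameter only enters at the first of these places. -/
theorem runCoef_eq (E : σ.toHSequence.Completion) (hσ : σ.IsAlternating)
    (hp : σ.letter r = some (.direct p)) (t : K) (j : ℕ) (hj : 2 * j + 1 < n) :
    E.runCoef (fun i => if i = r then t else 1) r (2 * j + 1) = (-1) ^ (j + 1) * t⁻¹ := by
  have hne : ∀ k : ℕ, 0 < k → k < n → r + (k : ZMod n) ≠ r := fun k h1 h2 => by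
    simpa using (add_natCast_ne r h1 h2).symm
  have hodd : r + ((2 * j : ℕ) : ZMod n) + 1 ≠ r := by
    simpa [add_assoc] using hne (2 * j + 1) (by omega) hj
  induction j with
  | zero =>
    have h1 := E.eq_of_letter _ _ hp
    simp only [mul_zero, Nat.cast_zero, add_zero] at hodd
    simp [runCoef, h1, hodd]
  | succ j ih =>
    obtain ⟨⟨p', h1⟩, -⟩ := direct_and_inverse_of_isAlternating hp hσ (j + 1)
    obtain ⟨-, q, h2⟩ := direct_and_inverse_of_isAlternating hp hσ j
    have h3 := E.eq_of_letter _ _ h1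
    have h4 := E.eq_of_letter _ _ h2
    have h5 := hne (2 * (j + 1)) (by omega) (by omega)
    rw [runCoef, h3]
    simp only [if_neg h5, if_neg hodd, mul_one, div_one]
    rw [show 2 * (j + 1) = 2 * j + 1 + 1 by ring, runCoef, h4]
    simp only
    rw [ih (by omega) (by simpa [add_assoc] using hne (2 * j + 1) (by omega) (by omega))]
    ring

/-- The walk once around an alternating homotopy band passes through all paths that represent
cohomology classes. -/
theorem homology_of_isAlternating {t : K} (hp : σ.letter r = some (.direct p)) (ht : t ≠ 0)
    (hσ : σ.IsAlternating) :
    ∃ h : G.IsBand (σ.subword r n).letters,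
      Nonempty ((σ.bandComplex r t).homology (σ.deg r) ≃ₗ[GentleAlgebra K G]
        bandModule _ h ((-1) ^ (n / 2) * t⁻¹)) ∧
      ∀ d : ℤ, d ≠ σ.deg r → Limits.IsZero ((σ.bandComplex r t).homology d) := by
  obtain ⟨E⟩ := σ.exists_completion
  obtain ⟨m, hm⟩ := even_of_isAlternating hp hσ
  let c : ZMod n → K := fun i => if i = r then t else 1
  have hc : ∀ i, c i ≠ 0 := scalar_ne_zero ht
  have hrun := isAlternatingRun E hσ r
  have hLr := E.eq_of_letter _ _ hp
  obtain ⟨-, q, hq⟩ := direct_and_inverse_of_isAlternating hp hσ m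
  have hcyc : r + ((2 * m + 1 : ℕ) : ZMod n) + 1 = r := by
    rw [add_assoc, ← Nat.cast_add_one, show 2 * m + 1 + 1 = n by omega, ZMod.natCast_self, add_zero]
  have hband := IsAlternatingRun.realizesBand (E := E) (c := c) (N := 2 * m + 1)
    (show E.IsAlternatingRun r (2 * m + 2) from hm ▸ hrun) hc (σ.mem_pos _) (σ.mem_pos _) hcyc hLr
    (E.eq_of_letter _ _ hq) rfl
  rw [runCoef_eq E hσ hp t m (by omega), show m + 1 = n / 2 by omega] at hband
  have hsteps : E.runSteps c r (2 * m + 1 + 1) = E.runSteps c r n :=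
    congrArg (E.runSteps c r) hm.symm
  rw [hsteps] at hband
  have hletters : (σ.subword r n).letters = (E.runSteps c r n).map Step.letter := by
    rw [runSteps_map_letter, runLetters_eq_subword fun k _ => ⟨σ.mem_pos _, σ.mem_pos _⟩]
  have hdeg : ∀ l b, E.Owns l b → σ.deg b.1 = σ.deg r := by
    intro l b hb
    obtain ⟨k, hk, rfl⟩ := exists_add_natCast_eq r l
    rw [← hb.letterDeg_eq, hrun.letterDeg_add hk, letterDeg_direct hLr]
  have hword : G.IsBand ((E.runSteps c r n).map Step.letter) := by
    refine ⟨?_, hband.composable, fun v k hk => ?_⟩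
    · rw [← hletters]
      exact subword_ne_nil (NeZero.ne n) (σ.mem_pos _) (σ.mem_pos _)
    · rw [runSteps_map_letter]
      exact not_proper_power E hσ r v k hk
  rw [hletters]
  refine ⟨hword, E.homology_equiv_bandModule hc hband hword ?_ (fun b => ?_) hdeg
    (fun s hs => coef_ne_zero_of_mem_runSteps hc hs), fun d hd => ?_⟩
  · exact hrun.nodup_targets fun k k' h h' => add_natCast_ne r h h'
  · rw [mem_targets_runSteps]
    have hopp := opposite_of_isAlternating E hσ
    constructor
    · rintro ⟨k, hk, hb⟩
      refine ⟨r + k, ?_⟩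
      have h1 := hopp (r + k)
      rcases hA : E.L (r + k) with p' | p' <;> rw [hA] at hb h1
      · obtain ⟨h2, h3, h4⟩ := mem_targets_fwdSteps.mp hb
        refine Or.inl ⟨h2, σ.mem_pos _, p', hA, h3, h4, fun _ _ => ?_⟩
        rcases hB : E.L (r + k + 1) with q' | q'
        · rw [hB] at h1
          exact h1.elim
        · exact ⟨q', rfl⟩
      · obtain ⟨h2, h3, h4⟩ := mem_targets_bwdSteps.mp hb
        refine Or.inr ⟨h2, σ.mem_pos _, p', hA, h3, fun h => absurd h h4, fun _ => ?_⟩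
        rcases hB : E.L (r + k + 1) with q' | q'
        · exact ⟨q', rfl⟩
        · rw [hB] at h1
          exact h1.elim
    · rintro ⟨l, hl⟩
      obtain ⟨k, hk, rfl⟩ := exists_add_natCast_eq r l
      refine ⟨k, hk, ?_⟩
      rcases hl with ⟨h1, -, p', hA, h3, h4, -⟩ | ⟨h1, -, p', hA, h3, h4, -⟩
      · rw [hA]
        exact mem_targets_fwdSteps.mpr ⟨h1, h3, h4⟩
      · rw [hA]
        exact mem_targets_bwdSteps.mpr ⟨h1, h3, fun h => h4 h (σ.mem_pos _)⟩
  · exact E.isZero_homology hc fun l b hb hb' => hd (hb'.symm.trans (hdeg l b hb))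

end HomotopyBand

end BandCohomology

end

end GentleCohomology

theorem mainTheorem4 {K : Type*} [Field K] {V : Type*} [Fintype V] [Quiver V]
    (G : GentleQuiver V) :
    -- homotopy strings with at least one homotopy letter
    (∀ σ : HomotopyString G, (∃ i, σ.letter i ≠ none) →
      ∃ h : ∀ s : σ.Summand, G.IsString s.word, ∀ d : ℤ,
        Nonempty ((σ.stringComplex K).homology d ≃ₗ[GentleAlgebra K G]
          ⨁ s : {s : σ.Summand // s.degree = d}, stringModule K s.1.word (h s.1))) ∧
    -- trivial homotopy strings
    (∀ (σ : HomotopyString G) (i : ℤ), σ.pos = {i} →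
      ∃ q q' : List (Arrow V), G.IsOtherLeg (σ.vertex i) q' q ∧ G.IsOtherLeg (σ.vertex i) q q' ∧
        ∃ h : G.IsString (((⟨σ.vertex i, []⟩ : Word V).extendLeft q').extendRight q),
          Nonempty ((σ.stringComplex K).homology (σ.deg i) ≃ₗ[GentleAlgebra K G]
            stringModule K _ h) ∧
          ∀ d : ℤ, d ≠ σ.deg i → Limits.IsZero ((σ.stringComplex K).homology d)) ∧
    -- homotopy bands, with a nonzero parameter on a direct homotopy letter
    (∀ (n : ℕ) [NeZero n] (σ : HomotopyBand G n) (r : ZMod n) (p : List (Arrow V)) (t : K),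
      σ.letter r = some (.direct p) → t ≠ 0 →
      (¬ σ.IsAlternating →
        ∃ h : ∀ s : σ.Summand, G.IsString s.word, ∀ d : ℤ,
          Nonempty ((σ.bandComplex r t).homology d ≃ₗ[GentleAlgebra K G]
            ⨁ s : {s : σ.Summand // s.degree = d}, stringModule K s.1.word (h s.1))) ∧
      (σ.IsAlternating →
        ∃ h : G.IsBand (σ.subword r n).letters,
          Nonempty ((σ.bandComplex r t).homology (σ.deg r) ≃ₗ[GentleAlgebra K G]
            bandModule _ h ((-1) ^ (n / 2) * t⁻¹)) ∧
          ∀ d : ℤ, d ≠ σ.deg r → Limits.IsZero ((σ.bandComplex r t).homology d))) := by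
  exact ⟨fun σ hσ => σ.homology_equiv_summands hσ, fun σ i hi => σ.homology_of_trivial hi,
    fun n _ σ r p t hp ht => ⟨fun hσ => σ.homology_equiv_summands ht hσ,
      fun hσ => HomotopyBand.homology_of_isAlternating hp ht hσ⟩⟩
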